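/- \textbf{Setting.} Let $\mathbb{K}$ be an algebraically closed field of characteristic $p>0$ and $G$ a connected reductive algebraic group over $\mathbb{K}$ with maximal torus $T$ and a Borel subgroup containing $T$; let $X=X(T)$ and $Y=Y(T)$ be the character and cocharacter lattices, $R\subset X$ the roots, $R^+$ the positive roots, $\Pi$ the simple roots, $\mathfrak g=\mathrm{Lie}(G)$, $\mathfrak h=\mathrm{Lie}(T)=\mathbb{K}\otimes_{\mathbb Z}Y$, and let $e_\alpha$ ($\alpha\in R$) be the root vectors of a Chevalley basis, so that $h_\alpha:=[e_\alpha,e_{-\alpha}]=1\otimes\alpha^\vee$. For $\mu\in X$ let $d\mu\in\mathfrak h^*$ be its differential. Assume that the derived subgroup of $G$ is simply connected, that $p$ is good for $G$, and that $\mathfrak g$ has a non-degenerate $G$-invariant bilinear form. Let $\chi\in\mathfrak g^*$ be in standard Levi form with associated subset $I\subseteq\Pi$: $\chi$ vanishes on $\mathfrak h$ and on $e_\alpha$ for $\alpha\in R^+$, and for $\alpha\in R^+$ one has $\chi(e_{-\alpha})=1$ if $\alpha\in I$ and $\chi(e_{-\alpha})=0$ otherwise. Put $R_I=R\cap\mathbb{Z}I$.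 For a subset $S\subseteq R$ for which $\mathfrak h$ and the $e_\alpha$, $\alpha\in S$, span a Lie subalgebra $\mathfrak g_S$ of $\mathfrak g$, put $U_S=U(\mathfrak g_S)/\langle e_\alpha^p-\chi(e_\alpha)^p\mid\alpha\in S\rangle$, and write $U_\chi=U_R$. \textbf{The categories.} Let $A$ be a commutative Noetherian algebra over $U(\mathfrak h)=S(\mathfrak h)$ with structure map $\pi$. The category $\mathcal C_A^S$ has as objects the $U_S\otimes_{\mathbb K} A$-modules $M$, finitely generated over $A$, with a decomposition into $A$-submodules $M=\bigoplus M_{\lambda+\mathbb{Z}I}^{d\mu}$ over all pairs $(\lambda+\mathbb{Z}I,d\mu)$ with $\lambda\in X$ and $\mu\in\lambda+\mathbb{Z}I+pX$, such that $hm=(\pi(h)+d\mu(h))m$ for $h\in\mathfrak h$, $m\in M_{\lambda+\mathbb{Z}I}^{d\mu}$, and $e_\alpha M_{\lambda+\mathbb{Z}I}^{d\mu}\subseteq M_{\lambda+\alpha+\mathbb{Z}I}^{d(\mu+\alpha)}$ for $\alpha\in S$; morphisms are the $U_S\otimes A$-linear maps that preserve the decompositions. This is an abelian category. Write $\mathcal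 C_A=\mathcal C_A^R$. For an $A$-algebra $A'$ (commutative and Noetherian) the functor $-\otimes_AA':\mathcal C_A^S\to\mathcal C_{A'}^S$ is extension of scalars. \textbf{The modules $Q^I_{A,\chi}(\lambda)$.} Suppose that $\pi(h_\alpha)=0$ for all $\alpha\in R_I$, and let $\lambda\in X$. Regard $\mathbb K$ as an $S(\mathfrak h)$-algebra with $\mathfrak h\mapsto 0$. Let $\mathbb{K}^\lambda\in\mathcal C_{\mathbb K}^{R_I\cap R^+}$ be $\mathbb K$ placed in weight $(\lambda+\mathbb{Z}I,d\lambda)$ with $e_\alpha$ acting by $0$, let $Z(\lambda)=U_{R_I}\otimes_{U_{R_I\cap R^+}}\mathbb{K}^\lambda\in\mathcal C_{\mathbb K}^{R_I}$, and let $Q(\lambda)$ be the projective cover of $Z(\lambda)$ in $\mathcal C_{\mathbb K}^{R_I}$. Let $Q_{A,I,\chi}(\lambda)\in\mathcal C_A^{R_I}$ be $Q(\lambda)\otimes_{\mathbb K}A$ with the same decomposition and the same action of the $e_\alpha$, $\alpha\in R_I$, and with $h\in\mathfrak h$ acting by $\pi(h)+d\mu(h)$ on the piece of index $(\nu+\mathbb{Z}I,d\mu)$.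 View it as an object of $\mathcal C_A^{R_I\cup R^+}$ by letting $e_\alpha$ act by $0$ for $\alpha\in R^+\setminus R_I$, and put $Q_{A,\chi}^I(\lambda)=U_\chi\otimes_{U_{R_I\cup R^+}}Q_{A,I,\chi}(\lambda)\in\mathcal C_A$, with the induced decomposition. An object of $\mathcal C_A$ has a \emph{$Q$-filtration} if it has a finite filtration in $\mathcal C_A$ all of whose sections are isomorphic to objects $Q_{A,\chi}^I(\lambda)$, $\lambda\in X$. \textbf{Proposition.} Let $\pi(h_\alpha)=0$ for all $\alpha\in R_I$. Let $M\in\mathcal C_A$ have a $Q$-filtration and let $N\in\mathcal C_A$ be projective as an $A$-module. Suppose that for all maximal ideals $\mathfrak m$ of $A$ and all $i>0$ $$\mathrm{Ext}^i_{\mathcal C_{A/\mathfrak m}}(M\otimes_AA/\mathfrak m,\;N\otimes_AA/\mathfrak m)=0.$$ Then: (1) $\mathrm{Hom}_{\mathcal C_A}(M,N)$ is projective as an $A$-module. (2) For all commutative Noetherian $A$-algebras $A'$ and all $i>0$, $\mathrm{Ext}^i_{\mathcal C_{A'}}(M\otimes_AA',N\otimes_AA')=0$. (3) For all commutative Noetherian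 $A$-algebras $A'$ the canonical map $\mathrm{Hom}_{\mathcal C_A}(M,N)\otimes_AA'\to\mathrm{Hom}_{\mathcal C_{A'}}(M\otimes_AA',N\otimes_AA')$, $f\otimes a\mapsto a\,(f\otimes\mathrm{id}_{A'})$, is an isomorphism. -/

import Mathlib

open CategoryTheory
open scoped TensorProduct

universe u

noncomputable section

/-! ### Gradings of modules through projections -/

namespace WGrading

variable {J A M N : Type*} [CommRing A] [AddCommGroup M] [Module A M] [AddCommGroup N] [Module A N]

theorem exists_proj (P : J → Submodule A M) (hi : iSupIndep P) (hs : ⨆ w, P w = ⊤) :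
    ∃ q : J → M →ₗ[A] M, (∀ w x, q w x ∈ P w) ∧ (∀ w, ∀ x ∈ P w, q w x = x) ∧
      (∀ v w, v ≠ w → ∀ x ∈ P v, q w x = 0) ∧
      (∀ x, ∃ s : Finset J, x = ∑ w ∈ s, q w x) := by
  classical
  have hint : DirectSum.IsInternal P :=
    (DirectSum.isInternal_submodule_iff_iSupIndep_and_iSup_eq_top P).2 ⟨hi, hs⟩
  let _ := hint.chooseDecomposition
  refine ⟨fun w => (P w).subtype ∘ₗ DirectSum.component A J (fun i => P i) w ∘ₗ
    (DirectSum.decomposeLinearEquiv P).toLinearMap, ?_, ?_, ?_, ?_⟩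
  · intro w x
    simp
  · intro w x hx
    exact DirectSum.decompose_of_mem_same P hx
  · intro v w hvw x hx
    exact DirectSum.decompose_of_mem_ne P hx hvw
  · intro x
    exact ⟨_, (DirectSum.sum_support_decompose P x).symm⟩

theorem indep_of_proj (P : J → Submodule A M) (q : J → M →ₗ[A] M)
    (h1 : ∀ w, ∀ x ∈ P w, q w x = x) (h2 : ∀ v w, v ≠ w → ∀ x ∈ P v, q w x = 0) :
    iSupIndep P := by
  intro w
  rw [Submodule.disjoint_def]
  intro x hx hx'
  rw [← h1 w x hx]
  have : (⨆ j, ⨆ (_ : j ≠ w), P j) ≤ LinearMap.ker (q w) :=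
    iSup_le fun j => iSup_le fun hj y hy => h2 j w hj y hy
  exact this hx'

theorem pow_comm (f : M →ₗ[A] N) (a : Module.End A M) (b : Module.End A N)
    (h : ∀ m, f (a m) = b (f m)) (n : ℕ) (m : M) : f ((a ^ n) m) = (b ^ n) (f m) := by
  induction n generalizing m with
  | zero => rfl
  | succ n ih => rw [pow_succ, pow_succ, Module.End.mul_apply, Module.End.mul_apply, ih, h]

end WGrading

/-! ### Lie algebras of connected reductive groups -/

/-- The Lie algebra `𝔥 = K ⊗ Y` of a torus with cocharacter lattice `Y`. -/
abbrev CartanAlg (K Y : Type*) [Field K] [AddCommGroup Y] : Type _ := K ⊗[ℤ] Y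

/-- The Lie algebra `𝔤` of a connected reductive group over `K` with a chosen maximal torus `T` and
Borel subgroup: `P` is the (reduced) root datum of the group with character lattice `X = X(T)` and
cocharacter lattice `Y = Y(T)`, `b` is the base given by the Borel subgroup, `h` is the inclusion of
`Lie T = K ⊗ Y`, and the `e α` are root vectors which form a Chevalley basis together with a basis
of `Y`. (`q = P.chainBotCoeff α β` is the largest `q` such that `β - q α` is a root.)
The Lie algebra of the reductive group with root datum `P` is the one with these relations. -/
structure ReductiveLie (K ι X Y 𝔤 : Type*) [Field K] [Finite ι] [AddCommGroup X] [AddCommGroup Y]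
    [LieRing 𝔤] [LieAlgebra K 𝔤] where
  P : RootPairing ι ℤ X Y
  isReduced : P.IsReduced
  b : P.Base
  h : CartanAlg K Y →ₗ[K] 𝔤
  e : ι → 𝔤
  bijective : Function.Bijective
    (LinearMap.coprod h (Finsupp.linearCombination K e) : CartanAlg K Y × (ι →₀ K) →ₗ[K] 𝔤)
  lie_h_h : ∀ x y, ⁅h x, h y⁆ = 0
  lie_h_e : ∀ (y : Y) (α : ι), ⁅h (1 ⊗ₜ y), e α⁆ = P.toLinearMap (P.root α) y • e α
  lie_e_neg : ∀ α β, P.root β = -P.root α → ⁅e α, e β⁆ = h (1 ⊗ₜ P.coroot α)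
  lie_e_e : ∀ α β γ, P.root α + P.root β = P.root γ →
    ⁅e α, e β⁆ = (P.chainBotCoeff α β + 1) • e γ ∨ ⁅e α, e β⁆ = -((P.chainBotCoeff α β + 1) • e γ)
  lie_e_e_zero : ∀ α β, P.root α + P.root β ≠ 0 → P.root α + P.root β ∉ Set.range P.root →
    ⁅e α, e β⁆ = 0

namespace ReductiveLie

variable {K ι X Y 𝔤 : Type*} [Field K] [Finite ι] [AddCommGroup X] [AddCommGroup Y]
  [LieRing 𝔤] [LieAlgebra K 𝔤] (D : ReductiveLie K ι X Y 𝔤)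

/-- The differential `dμ ∈ 𝔥*` of a character `μ`, with `dμ (c ⊗ y) = c ⟨μ, y⟩`. -/
def diff : X →+ Module.Dual K (CartanAlg K Y) where
  toFun μ := (TensorProduct.AlgebraTensorModule.rid ℤ K K).toLinearMap ∘ₗ
    (D.P.toLinearMap μ).baseChange K
  map_zero' := by ext; simp
  map_add' μ ν := by ext; simp

/-- The derived subgroup is simply connected: the coroot lattice is saturated in `Y`. -/
def SimplyConnectedDerived : Prop :=
  ∀ (y : Y) (n : ℤ), n ≠ 0 → n • y ∈ AddSubgroup.closure (Set.range D.P.coroot) →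
    y ∈ AddSubgroup.closure (Set.range D.P.coroot)

/-- `p` is good for the root system: it divides no non-zero coefficient of a root with respect to
the simple roots (equivalently, no coefficient of the highest root of a component). -/
def IsGoodPrime (p : ℕ) : Prop :=
  ∀ (α : ι) (c : ι → ℤ), D.P.root α = ∑ i ∈ D.b.support, c i • D.P.root i →
    ∀ i ∈ D.b.support, c i ≠ 0 → ¬ (p : ℤ) ∣ c i

/-- There is a non-degenerate invariant bilinear form on `𝔤`. Of the invariance under the group we
only ask the invariance under its maximal torus (first two conditions: weight spaces
whose weights do not add up to zero are orthogonal) and under its Lie algebra (last condition). -/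
def HasInvariantForm : Prop :=
  ∃ B : LinearMap.BilinForm K 𝔤, B.Nondegenerate ∧
    (∀ x α, B (D.h x) (D.e α) = 0 ∧ B (D.e α) (D.h x) = 0) ∧
    (∀ α β, D.P.root α + D.P.root β ≠ 0 → B (D.e α) (D.e β) = 0) ∧
    (∀ x y z, B ⁅x, y⁆ z = B x ⁅y, z⁆)

end ReductiveLie

/-- A linear form `χ` on `𝔤` in standard Levi form, with its set `I` of simple roots. -/
structure StdLevi {K ι X Y 𝔤 : Type*} [Field K] [Finite ι] [AddCommGroup X] [AddCommGroup Y]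
    [LieRing 𝔤] [LieAlgebra K 𝔤] (D : ReductiveLie K ι X Y 𝔤) where
  I : Set ι
  I_subset : I ⊆ D.b.support
  χ : Module.Dual K 𝔤
  χ_h : ∀ x, χ (D.h x) = 0
  χ_pos : ∀ α, D.b.IsPos α → χ (D.e α) = 0
  χ_neg_mem : ∀ α β, D.b.IsPos α → D.P.root β = -D.P.root α → α ∈ I → χ (D.e β) = 1
  χ_neg_not_mem : ∀ α β, D.b.IsPos α → D.P.root β = -D.P.root α → α ∉ I → χ (D.e β) = 0

namespace StdLevi

variable {K ι X Y 𝔤 : Type*} [Field K] [Finite ι] [AddCommGroup X] [AddCommGroup Y]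
  [LieRing 𝔤] [LieAlgebra K 𝔤] {D : ReductiveLie K ι X Y 𝔤} (L : StdLevi D)

/-- The subgroup `ℤI` of `X`. -/
def ZI : AddSubgroup X := AddSubgroup.closure (D.P.root '' L.I)

/-- `R_I = R ∩ ℤI`. -/
def RI : Set ι := {α | D.P.root α ∈ L.ZI}

/-- `R_I⁺ = R⁺ ∩ ℤI`; the corresponding subalgebra of `U_χ` is the algebra `U⁰U⁺` of `𝔤_I`. -/
def RIpos : Set ι := {α | D.P.root α ∈ L.ZI ∧ D.b.IsPos α}

/-- `R_I ∪ R⁺`, the roots of the parabolic subalgebra `𝔭 = 𝔤_I ⊕ 𝔲⁺`. -/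
def RP : Set ι := {α | D.P.root α ∈ L.ZI ∨ D.b.IsPos α}

theorem RIpos_subset_RI : L.RIpos ⊆ L.RI := fun _ h => h.1

theorem RI_subset_RP : L.RI ⊆ L.RP := fun _ h => Or.inl h

/-- `μ ↦ (μ + ℤI, dμ)`. -/
def wtHom : X →+ (X ⧸ L.ZI) × Module.Dual K (CartanAlg K Y) :=
  (QuotientAddGroup.mk' L.ZI).prod D.diff

/-- The pairs `(λ + ℤI, dμ)` with `μ ∈ λ + ℤI + pX`. As `d` kills `pX`, these are the pairs
`(γ + ℤI, dγ)` with `γ ∈ X`. -/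
abbrev Wt : Type _ := L.wtHom.range

/-- The pair `(μ + ℤI, dμ)`. -/
def wt : X →+ L.Wt := L.wtHom.rangeRestrict

/-- The Lie subalgebra `𝔤_S` of `𝔤` generated by `𝔥` and the `e α` with `α ∈ S`. Thus it is `𝔤`,
`𝔤_I`, `𝔭` and the Borel subalgebra of `𝔤_I` for `S` the set of all roots, `R_I`, `R_I ∪ R⁺` and
`R_I⁺` respectively. -/
def gS (_L : StdLevi D) (S : Set ι) : LieSubalgebra K 𝔤 :=
  LieSubalgebra.lieSpan K 𝔤 (Set.range D.h ∪ D.e '' S)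

theorem gS_mono {S T : Set ι} (hST : S ⊆ T) : L.gS S ≤ L.gS T :=
  LieSubalgebra.lieSpan_mono (Set.union_subset_union_right _ (Set.image_mono hST))

/-- The elements of `𝔥` in `𝔤_S`. -/
def hS (S : Set ι) (x : CartanAlg K Y) : L.gS S :=
  ⟨D.h x, LieSubalgebra.subset_lieSpan (Or.inl ⟨x, rfl⟩)⟩

/-- The root vectors in `𝔤_S`. -/
def eS {S : Set ι} (α : ι) (hα : α ∈ S) : L.gS S :=
  ⟨D.e α, LieSubalgebra.subset_lieSpan (Or.inr ⟨α, hα, rfl⟩)⟩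

attribute [local instance] LieRing.ofAssociativeRing

/-- The relations `e_α ^ p = χ(e_α) ^ p`, `α ∈ S`. -/
inductive URel (p : ℕ) (S : Set ι) :
    UniversalEnvelopingAlgebra K (L.gS S) → UniversalEnvelopingAlgebra K (L.gS S) → Prop
  | pow (α : ι) (hα : α ∈ S) : URel p S
      (UniversalEnvelopingAlgebra.ι K (L.eS α hα) ^ p)
      (algebraMap K _ (L.χ (D.e α) ^ p))

/-- The algebra `U(𝔤_S) / ⟨e_α ^ p - χ(e_α) ^ p | α ∈ S⟩`: it is `U_χ` when `S` is the set of all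
roots, `U^I` when `S = R_I` and `U^I U_I⁺` when `S = R_I ∪ R⁺`. -/
abbrev US (p : ℕ) (S : Set ι) : Type _ := RingQuot (L.URel p S)

/-- The canonical map `𝔤_S → U_S`. -/
def toUS (p : ℕ) (S : Set ι) (x : L.gS S) : L.US p S :=
  RingQuot.mkAlgHom K (L.URel p S) (UniversalEnvelopingAlgebra.ι K x)

/-- The canonical homomorphism `U_S → U_T` for `S ⊆ T`. -/
def inclUS (p : ℕ) {S T : Set ι} (hST : S ⊆ T) : L.US p S →ₐ[K] L.US p T :=
  RingQuot.liftAlgHom K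
    ⟨(RingQuot.mkAlgHom K (L.URel p T)).comp
      (UniversalEnvelopingAlgebra.lift K
        ((UniversalEnvelopingAlgebra.ι K).comp (LieSubalgebra.inclusion (L.gS_mono hST)))), by
      rintro _ _ ⟨α, hα⟩
      have := RingQuot.mkAlgHom_rel K (URel.pow (L := L) (p := p) α (hST hα))
      rw [map_pow, AlgHom.commutes] at this ⊢
      rw [AlgHom.comp_apply, UniversalEnvelopingAlgebra.lift_ι_apply]
      exact this⟩

end StdLevi

/-! ### The categories -/

section Cat

variable {K : Type u} {ι X Y 𝔤 : Type*} [Field K] [Finite ι] [AddCommGroup X] [AddCommGroup Y]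
  [LieRing 𝔤] [LieAlgebra K 𝔤] {D : ReductiveLie K ι X Y 𝔤}

/-- The objects of the category `𝒞_A` of `U_S ⊗ A`-modules, for the commutative algebra `A` over
`U⁰ = S(𝔥)` given by the linear map `π : 𝔥 → A`. A `U_S ⊗ A`-module is an `A`-module with an
`A`-linear representation `ρ` of `𝔤_S` for which `ρ (e_α) ^ p = χ (e_α) ^ p` if `α ∈ S`. The graded
pieces `M_{λ+ℤI}^{dμ}` are `piece w` with `w = (λ + ℤI, dμ)`, and `M_{λ+ℤI}` is the sum of the pieces
whose first component is `λ + ℤI`. Finite generation of `M` says that only finitely many of the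
`M_{λ+ℤI}` are non-zero and that each of these is finitely generated. -/
structure CMod (p : ℕ) (L : StdLevi D) (S : Set ι) (A : Type u) [CommRing A] [Algebra K A]
    (π : CartanAlg K Y →ₗ[K] A) where
  carrier : Type u
  [addCommGroup : AddCommGroup carrier]
  [module : Module A carrier]
  ρ : L.gS S →ₛₗ[algebraMap K A] Module.End A carrier
  ρ_lie : ∀ x y, ρ ⁅x, y⁆ = ρ x * ρ y - ρ y * ρ x
  ρ_pow : ∀ α (hα : α ∈ S) m, (ρ (L.eS α hα) ^ p) m = algebraMap K A (L.χ (D.e α) ^ p) • m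
  finite : Module.Finite A carrier
  piece : L.Wt → Submodule A carrier
  piece_indep : iSupIndep piece
  piece_span : ⨆ w, piece w = ⊤
  h_act : ∀ w, ∀ m ∈ piece w, ∀ x,
    ρ (L.hS S x) m = (π x + algebraMap K A (w.1.2 x)) • m
  e_act : ∀ α (hα : α ∈ S), ∀ w, ∀ m ∈ piece w,
    ρ (L.eS α hα) m ∈ piece (w + L.wt (D.P.root α))

namespace CMod

variable {p : ℕ} {L : StdLevi D} {S : Set ι} {A : Type u} [CommRing A] [Algebra K A]
  {π : CartanAlg K Y →ₗ[K] A}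

instance : CoeSort (CMod p L S A π) (Type u) := ⟨CMod.carrier⟩

instance (M : CMod p L S A π) : AddCommGroup M := M.addCommGroup

instance (M : CMod p L S A π) : Module A M := M.module

instance (M : CMod p L S A π) : Module.Finite A M := M.finite

/-- The morphisms `M → N`: the homomorphisms of `U_S ⊗ A`-modules that preserve the pieces. -/
def homs (M N : CMod p L S A π) : Submodule A (M →ₗ[A] N) where
  carrier := {f | (∀ x m, f (M.ρ x m) = N.ρ x (f m)) ∧ ∀ w, ∀ m ∈ M.piece w, f m ∈ N.piece w}
  zero_mem' := ⟨by simp, by simp⟩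
  add_mem' hf hg := ⟨fun x m => by simp [hf.1, hg.1],
    fun w m hm => add_mem (hf.2 w m hm) (hg.2 w m hm)⟩
  smul_mem' a f hf := ⟨fun x m => by simp [hf.1],
    fun w m hm => Submodule.smul_mem _ _ (hf.2 w m hm)⟩

instance : Category (CMod p L S A π) where
  Hom M N := homs M N
  id M := ⟨LinearMap.id, fun _ _ => rfl, fun _ _ h => h⟩
  comp f g := ⟨g.1 ∘ₗ f.1, fun x m => by simp [f.2.1, g.2.1],
    fun w m hm => g.2.2 w _ (f.2.2 w m hm)⟩

/-- The underlying linear map of a morphism. -/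
def lin {M N : CMod p L S A π} (f : M ⟶ N) : M →ₗ[A] N := Subtype.val f

/-- Constructor for morphisms. -/
def mkHom {M N : CMod p L S A π} (f : M →ₗ[A] N) (h1 : ∀ x m, f (M.ρ x m) = N.ρ x (f m))
    (h2 : ∀ w, ∀ m ∈ M.piece w, f m ∈ N.piece w) : M ⟶ N := ⟨f, h1, h2⟩

@[simp] theorem lin_mkHom {M N : CMod p L S A π} (f : M →ₗ[A] N) (h1 h2) :
    lin (mkHom f h1 h2 : M ⟶ N) = f := rfl

@[simp] theorem lin_id (M : CMod p L S A π) : lin (𝟙 M) = LinearMap.id := rfl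

@[simp] theorem lin_comp {M N Q : CMod p L S A π} (f : M ⟶ N) (g : N ⟶ Q) :
    lin (f ≫ g) = lin g ∘ₗ lin f := rfl

@[ext] theorem hom_ext {M N : CMod p L S A π} {f g : M ⟶ N} (h : ∀ m, lin f m = lin g m) :
    f = g := Subtype.ext (LinearMap.ext h)

theorem lin_ρ {M N : CMod p L S A π} (f : M ⟶ N) (x) (m : M) :
    lin f (M.ρ x m) = N.ρ x (lin f m) := f.2.1 x m

theorem lin_piece {M N : CMod p L S A π} (f : M ⟶ N) (w) (m : M) (hm : m ∈ M.piece w) :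
    lin f m ∈ N.piece w := f.2.2 w m hm

instance (M N : CMod p L S A π) : AddCommGroup (M ⟶ N) :=
  inferInstanceAs (AddCommGroup (homs M N))

instance (M N : CMod p L S A π) : Module A (M ⟶ N) := inferInstanceAs (Module A (homs M N))

@[simp] theorem lin_add {M N : CMod p L S A π} (f g : M ⟶ N) : lin (f + g) = lin f + lin g := rfl

@[simp] theorem lin_zero {M N : CMod p L S A π} : lin (0 : M ⟶ N) = 0 := rfl

@[simp] theorem lin_smul {M N : CMod p L S A π} (a : A) (f : M ⟶ N) :
    lin (a • f) = a • lin f := rfl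

instance : Preadditive (CMod p L S A π) where
  add_comp _ _ _ f f' g := by ext; simp
  comp_add _ _ _ f g g' := by ext; simp

instance : Linear A (CMod p L S A π) where
  smul_comp _ _ _ a f g := by ext; simp
  comp_smul _ _ _ f a g := by ext; simp

/-! #### Projections onto the pieces -/

/-- The projection onto a piece. -/
def proj (M : CMod p L S A π) : L.Wt → M →ₗ[A] M :=
  (WGrading.exists_proj M.piece M.piece_indep M.piece_span).choose

theorem proj_mem (M : CMod p L S A π) (w) (m : M) : M.proj w m ∈ M.piece w :=
  (WGrading.exists_proj M.piece M.piece_indep M.piece_span).choose_spec.1 w m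

theorem proj_same (M : CMod p L S A π) (w) (m : M) (h : m ∈ M.piece w) : M.proj w m = m :=
  (WGrading.exists_proj M.piece M.piece_indep M.piece_span).choose_spec.2.1 w m h

theorem proj_ne (M : CMod p L S A π) (v w) (hvw : v ≠ w) (m : M) (h : m ∈ M.piece v) :
    M.proj w m = 0 :=
  (WGrading.exists_proj M.piece M.piece_indep M.piece_span).choose_spec.2.2.1 v w hvw m h

theorem proj_sum (M : CMod p L S A π) (m : M) : ∃ s : Finset L.Wt, m = ∑ w ∈ s, M.proj w m :=
  (WGrading.exists_proj M.piece M.piece_indep M.piece_span).choose_spec.2.2.2 m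

theorem lin_proj {M N : CMod p L S A π} (f : M ⟶ N) (w) (m : M) :
    lin f (M.proj w m) = N.proj w (lin f m) := by
  have hm : m ∈ ⨆ w, M.piece w := by rw [M.piece_span]; trivial
  induction hm using Submodule.iSup_induction' with
  | mem v x hx =>
    by_cases hvw : v = w
    · subst hvw
      rw [proj_same _ _ _ hx, proj_same _ _ _ (lin_piece f _ _ hx)]
    · rw [proj_ne _ v w hvw _ hx, proj_ne _ v w hvw _ (lin_piece f _ _ hx), map_zero]
  | zero => simp
  | add x y _ _ hx hy => simp [hx, hy]

/-! #### Subobjects, quotients, sums -/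

/-- The object on a stable graded submodule. -/
def sub [IsNoetherianRing A] (M : CMod p L S A π) (N : Submodule A M)
    (hρ : ∀ x, ∀ m ∈ N, M.ρ x m ∈ N) (hp : ∀ w, ∀ m ∈ N, M.proj w m ∈ N) : CMod p L S A π where
  carrier := N
  ρ :=
    { toFun := fun x => (M.ρ x).restrict (hρ x)
      map_add' := fun x y => by ext; simp
      map_smul' := fun c x => by ext; simp }
  ρ_lie x y := by ext m; simp [M.ρ_lie]
  ρ_pow α hα m := Subtype.ext (by
    have := WGrading.pow_comm N.subtype ((M.ρ (L.eS α hα)).restrict (hρ _)) (M.ρ (L.eS α hα))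
      (fun _ => rfl) p m
    exact this.trans (M.ρ_pow α hα m))
  finite := inferInstance
  piece w := (M.piece w).comap N.subtype
  piece_indep := by
    refine WGrading.indep_of_proj _ (fun w => (M.proj w).restrict (hp w)) ?_ ?_
    · intro w x hx
      exact Subtype.ext (M.proj_same w x hx)
    · intro v w hvw x hx
      exact Subtype.ext (M.proj_ne v w hvw x hx)
  piece_span := by
    rw [eq_top_iff]
    intro x _
    obtain ⟨s, hs⟩ := M.proj_sum (x : M)
    have : x = ∑ w ∈ s, (M.proj w).restrict (hp w) x := Subtype.ext (by simpa using hs)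
    rw [this]
    exact Submodule.sum_mem _ fun w _ => Submodule.mem_iSup_of_mem w (M.proj_mem w x)
  h_act w m hm x := Subtype.ext (M.h_act w m hm x)
  e_act α hα w m hm := M.e_act α hα w m hm

/-- The object on the quotient by a stable graded submodule. -/
def quot (M : CMod p L S A π) (N : Submodule A M)
    (hρ : ∀ x, ∀ m ∈ N, M.ρ x m ∈ N) (hp : ∀ w, ∀ m ∈ N, M.proj w m ∈ N) : CMod p L S A π where
  carrier := M ⧸ N
  ρ :=
    { toFun := fun x => N.mapQ N (M.ρ x) (hρ x)
      map_add' := fun x y => by ext; simp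
      map_smul' := fun c x => by ext; simp }
  ρ_lie x y := by ext m; simp [M.ρ_lie]
  ρ_pow α hα := by
    intro m
    obtain ⟨m, rfl⟩ := N.mkQ_surjective m
    have := WGrading.pow_comm N.mkQ (M.ρ (L.eS α hα)) (N.mapQ N (M.ρ (L.eS α hα)) (hρ _))
      (fun _ => rfl) p m
    refine this.symm.trans ?_
    rw [M.ρ_pow α hα m, map_smul]
  finite := inferInstance
  piece w := (M.piece w).map N.mkQ
  piece_indep := by
    refine WGrading.indep_of_proj _ (fun w => N.mapQ N (M.proj w) (hp w)) ?_ ?_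
    · rintro w _ ⟨x, hx, rfl⟩
      simp [M.proj_same w x hx]
    · rintro v w hvw _ ⟨x, hx, rfl⟩
      simp [M.proj_ne v w hvw x hx]
  piece_span := by
    rw [← Submodule.map_iSup, M.piece_span, Submodule.map_top, Submodule.range_mkQ]
  h_act := by
    rintro w _ ⟨m, hm, rfl⟩ x
    simp [M.h_act w m hm x]
  e_act := by
    rintro α hα w _ ⟨m, hm, rfl⟩
    exact ⟨_, M.e_act α hα w m hm, by simp⟩

/-- The zero object. -/
def zeroObj : CMod p L S A π where
  carrier := PUnit
  ρ := 0
  ρ_lie x y := by ext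
  ρ_pow α hα m := rfl
  finite := inferInstance
  piece w := ⊤
  piece_indep := fun w => by rw [Submodule.disjoint_def]; intros; rfl
  piece_span := Subsingleton.elim _ _
  h_act w m hm x := rfl
  e_act α hα w m hm := trivial

/-- The direct sum of two objects. -/
def prod (M N : CMod p L S A π) : CMod p L S A π where
  carrier := M × N
  ρ :=
    { toFun := fun x => (M.ρ x).prodMap (N.ρ x)
      map_add' := fun x y => by ext <;> simp
      map_smul' := fun c x => by ext <;> simp }
  ρ_lie x y := by ext m <;> simp [M.ρ_lie, N.ρ_lie]
  ρ_pow α hα m := by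
    have h1 := WGrading.pow_comm (LinearMap.fst A M N)
      ((M.ρ (L.eS α hα)).prodMap (N.ρ (L.eS α hα))) (M.ρ (L.eS α hα)) (fun _ => rfl) p m
    have h2 := WGrading.pow_comm (LinearMap.snd A M N)
      ((M.ρ (L.eS α hα)).prodMap (N.ρ (L.eS α hα))) (N.ρ (L.eS α hα)) (fun _ => rfl) p m
    exact Prod.ext (h1.trans (M.ρ_pow α hα m.1)) (h2.trans (N.ρ_pow α hα m.2))
  finite := inferInstance
  piece w := (M.piece w).prod (N.piece w)
  piece_indep := by
    refine WGrading.indep_of_proj _ (fun w => (M.proj w).prodMap (N.proj w)) ?_ ?_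
    · rintro w ⟨x, y⟩ ⟨hx, hy⟩
      simp [M.proj_same w x hx, N.proj_same w y hy]
    · rintro v w hvw ⟨x, y⟩ ⟨hx, hy⟩
      simp [M.proj_ne v w hvw x hx, N.proj_ne v w hvw y hy]
  piece_span := by
    rw [eq_top_iff]
    rintro ⟨x, y⟩ -
    have hx : (x, (0 : N)) ∈ ⨆ w, (M.piece w).prod (N.piece w) := by
      obtain ⟨s, hs⟩ := M.proj_sum x
      have : (x, (0 : N)) = ∑ w ∈ s, (M.proj w x, (0 : N)) := by
        ext <;> simp [Prod.fst_sum, Prod.snd_sum, ← hs]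
      rw [this]
      exact Submodule.sum_mem _ fun w _ => Submodule.mem_iSup_of_mem w ⟨M.proj_mem w x, zero_mem _⟩
    have hy : ((0 : M), y) ∈ ⨆ w, (M.piece w).prod (N.piece w) := by
      obtain ⟨s, hs⟩ := N.proj_sum y
      have : ((0 : M), y) = ∑ w ∈ s, ((0 : M), N.proj w y) := by
        ext <;> simp [Prod.fst_sum, Prod.snd_sum, ← hs]
      rw [this]
      exact Submodule.sum_mem _ fun w _ => Submodule.mem_iSup_of_mem w ⟨zero_mem _, N.proj_mem w y⟩
    simpa using add_mem hx hy
  h_act := by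
    rintro w ⟨m, n⟩ ⟨hm, hn⟩ x
    exact Prod.ext (M.h_act w m hm x) (N.h_act w n hn x)
  e_act := by
    rintro α hα w ⟨m, n⟩ ⟨hm, hn⟩
    exact ⟨M.e_act α hα w m hm, N.e_act α hα w n hn⟩

/-! #### The category is abelian -/

section Abelian

open Limits

theorem mono_of_inj {M N : CMod p L S A π} (f : M ⟶ N) (h : Function.Injective (lin f)) :
    Mono f := ⟨fun g g' hg => by
  ext m
  exact h (congrArg (fun k => lin k m) hg)⟩

theorem epi_of_surj {M N : CMod p L S A π} (f : M ⟶ N) (h : Function.Surjective (lin f)) :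
    Epi f := ⟨fun g g' hg => by
  ext m
  obtain ⟨m, rfl⟩ := h m
  exact congrArg (fun k => lin k m) hg⟩

/-- The kernel of a morphism. -/
def ker [IsNoetherianRing A] {M N : CMod p L S A π} (f : M ⟶ N) : CMod p L S A π :=
  M.sub (LinearMap.ker (lin f))
    (fun x m hm => by
      rw [LinearMap.mem_ker] at hm ⊢
      rw [lin_ρ, hm, map_zero])
    (fun w m hm => by
      rw [LinearMap.mem_ker] at hm ⊢
      rw [lin_proj, hm, map_zero])

/-- The inclusion of the kernel. -/
def kerι [IsNoetherianRing A] {M N : CMod p L S A π} (f : M ⟶ N) : ker f ⟶ M :=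
  mkHom (LinearMap.ker (lin f)).subtype (fun _ _ => rfl) (fun _ _ h => h)

theorem kerι_comp [IsNoetherianRing A] {M N : CMod p L S A π} (f : M ⟶ N) : kerι f ≫ f = 0 := by
  ext m
  exact m.2

/-- The universal property of the kernel. -/
def kerIsLimit [IsNoetherianRing A] {M N : CMod p L S A π} (f : M ⟶ N) :
    IsLimit (KernelFork.ofι (kerι f) (kerι_comp f)) :=
  KernelFork.IsLimit.ofι _ _
    (fun {W} g hg => mkHom ((lin g).codRestrict _ fun m => congrArg (fun k => lin k m) hg)
      (fun x m => Subtype.ext (lin_ρ g x m)) (fun w m hm => lin_piece g w m hm))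
    (fun _ _ => rfl)
    (fun g hg k hk => by
      ext m
      exact Subtype.ext (congrArg (fun k => lin k m) hk))

/-- The cokernel of a morphism. -/
def coker {M N : CMod p L S A π} (f : M ⟶ N) : CMod p L S A π :=
  N.quot (LinearMap.range (lin f))
    (by rintro x _ ⟨m, rfl⟩; exact ⟨_, lin_ρ f x m⟩)
    (by rintro w _ ⟨m, rfl⟩; exact ⟨_, lin_proj f w m⟩)

/-- The projection to the cokernel. -/
def cokerπ {M N : CMod p L S A π} (f : M ⟶ N) : N ⟶ coker f :=
  mkHom (LinearMap.range (lin f)).mkQ (fun _ _ => rfl) (fun _ m h => ⟨m, h, rfl⟩)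

theorem comp_cokerπ {M N : CMod p L S A π} (f : M ⟶ N) : f ≫ cokerπ f = 0 := by
  ext m
  exact (Submodule.Quotient.mk_eq_zero _).2 ⟨m, rfl⟩

/-- The universal property of the cokernel. -/
def cokerIsColimit {M N : CMod p L S A π} (f : M ⟶ N) :
    IsColimit (CokernelCofork.ofπ (cokerπ f) (comp_cokerπ f)) :=
  CokernelCofork.IsColimit.ofπ _ _
    (fun {W} g hg => mkHom ((LinearMap.range (lin f)).liftQ (lin g)
        (by rintro _ ⟨m, rfl⟩; exact congrArg (fun k => lin k m) hg))
      (by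
        intro x m
        obtain ⟨m, rfl⟩ := (LinearMap.range (lin f)).mkQ_surjective m
        exact lin_ρ g x m)
      (by
        rintro w _ ⟨m, hm, rfl⟩
        exact lin_piece g w m hm))
    (fun _ _ => rfl)
    (fun g hg k hk => by
      ext m
      obtain ⟨m, rfl⟩ := (LinearMap.range (lin f)).mkQ_surjective m
      exact congrArg (fun k => lin k m) hk)

theorem inj_of_mono [IsNoetherianRing A] {M N : CMod p L S A π} (f : M ⟶ N) [Mono f] :
    Function.Injective (lin f) := by
  rw [injective_iff_map_eq_zero]
  intro m hm
  have h0 : kerι f = 0 := (cancel_mono f).1 (by rw [kerι_comp, zero_comp])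
  exact congrArg (fun k : ker f ⟶ M => lin k ⟨m, hm⟩) h0

theorem surj_of_epi {M N : CMod p L S A π} (f : M ⟶ N) [Epi f] :
    Function.Surjective (lin f) := by
  intro n
  have h0 : cokerπ f = 0 := (cancel_epi f).1 (by rw [comp_cokerπ, comp_zero])
  have : (LinearMap.range (lin f)).mkQ n = 0 := congrArg (fun k : N ⟶ coker f => lin k n) h0
  exact (Submodule.Quotient.mk_eq_zero _).1 this

/-- A monomorphism is the kernel of its cokernel. -/
@[reducible] def normalMono [IsNoetherianRing A] {M N : CMod p L S A π} (f : M ⟶ N) [Mono f] :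
    NormalMono f where
  Z := coker f
  g := cokerπ f
  w := comp_cokerπ f
  isLimit :=
    let φ : M ≃ₗ[A] LinearMap.range (lin f) := LinearEquiv.ofInjective (lin f) (inj_of_mono f)
    have hφ : ∀ y, lin f (φ.symm y) = y := fun y => congrArg Subtype.val (φ.apply_symm_apply y)
    KernelFork.IsLimit.ofι _ _
      (fun {W} g hg => mkHom
        (φ.symm.toLinearMap ∘ₗ (lin g).codRestrict (LinearMap.range (lin f)) (fun m =>
          (Submodule.Quotient.mk_eq_zero _).1 (congrArg (fun k => lin k m) hg)))
        (fun x m => inj_of_mono f (by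
          rw [lin_ρ]
          simp only [LinearMap.coe_comp, LinearEquiv.coe_coe, Function.comp_apply, hφ]
          exact lin_ρ g x m))
        (fun w m hm => by
          have h1 : lin f (φ.symm ((lin g).codRestrict (LinearMap.range (lin f)) (fun m =>
            (Submodule.Quotient.mk_eq_zero _).1 (congrArg (fun k => lin k m) hg)) m)) = lin g m :=
            hφ _
          have h2 := lin_proj f w (φ.symm ((lin g).codRestrict (LinearMap.range (lin f)) (fun m =>
            (Submodule.Quotient.mk_eq_zero _).1 (congrArg (fun k => lin k m) hg)) m))
          rw [h1, proj_same _ _ _ (lin_piece g w m hm), ← h1] at h2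
          have h3 := inj_of_mono f h2
          change φ.symm _ ∈ _
          rw [← h3]
          exact proj_mem _ _ _))
      (fun g hg => by
        ext m
        exact hφ _)
      (fun g hg k hk => (cancel_mono f).1 (by
        rw [hk]
        ext m
        refine Eq.symm ?_
        exact hφ _))

/-- An epimorphism is the cokernel of its kernel. -/
@[reducible] def normalEpi [IsNoetherianRing A] {M N : CMod p L S A π} (f : M ⟶ N) [Epi f] :
    NormalEpi f where
  W := ker f
  g := kerι f
  w := kerι_comp f
  isColimit :=
    have hf := surj_of_epi f
    let φ : (M ⧸ LinearMap.ker (lin f)) ≃ₗ[A] N :=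
      LinearMap.quotKerEquivOfSurjective (lin f) hf
    have hφ : ∀ m, φ.symm (lin f m) = (LinearMap.ker (lin f)).mkQ m := fun m => by
      rw [LinearEquiv.symm_apply_eq]
      rfl
    CokernelCofork.IsColimit.ofπ _ _
      (fun {W} g hg =>
        have hg' : LinearMap.ker (lin f) ≤ LinearMap.ker (lin g) :=
          fun m hm => congrArg (fun k : ker f ⟶ W => lin k ⟨m, hm⟩) hg
        have key : ∀ m, ((LinearMap.ker (lin f)).liftQ (lin g) hg' ∘ₗ φ.symm.toLinearMap)
            (lin f m) = lin g m := fun m => by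
          simp only [LinearMap.coe_comp, LinearEquiv.coe_coe, Function.comp_apply, hφ]
          rfl
        mkHom ((LinearMap.ker (lin f)).liftQ (lin g) hg' ∘ₗ φ.symm.toLinearMap)
          (fun x n => by
            obtain ⟨m, rfl⟩ := hf n
            rw [← lin_ρ, key, key, lin_ρ])
          (fun w n hn => by
            obtain ⟨m, rfl⟩ := hf n
            rw [← proj_same _ _ _ hn, ← lin_proj, key]
            exact lin_piece g w _ (proj_mem _ _ _)))
      (fun g hg => by
        ext m
        simp only [lin_comp, lin_mkHom, LinearMap.coe_comp, LinearEquiv.coe_coe,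
          Function.comp_apply, hφ]
        rfl)
      (fun g hg k hk => (cancel_epi f).1 (by
        rw [hk]
        ext m
        simp only [lin_comp, lin_mkHom, LinearMap.coe_comp, LinearEquiv.coe_coe,
          Function.comp_apply, hφ]
        rfl))

theorem zeroObj_isZero : IsZero (zeroObj : CMod p L S A π) := by
  rw [IsZero.iff_id_eq_zero]
  ext
  rfl

instance : HasZeroObject (CMod p L S A π) := ⟨⟨zeroObj, zeroObj_isZero⟩⟩

/-- The direct sum as a bicone. -/
def prodBicone (M N : CMod p L S A π) : BinaryBicone M N where
  pt := M.prod N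
  fst := mkHom (LinearMap.fst A M N) (fun _ _ => rfl) (fun _ _ h => h.1)
  snd := mkHom (LinearMap.snd A M N) (fun _ _ => rfl) (fun _ _ h => h.2)
  inl := mkHom (LinearMap.inl A M N) (fun x _ => Prod.ext rfl (map_zero (N.ρ x)).symm)
    (fun _ _ h => ⟨h, zero_mem _⟩)
  inr := mkHom (LinearMap.inr A M N) (fun x _ => Prod.ext (map_zero (M.ρ x)).symm rfl)
    (fun _ _ h => ⟨zero_mem _, h⟩)
  inl_fst := rfl
  inl_snd := rfl
  inr_fst := rfl
  inr_snd := rfl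

instance : HasBinaryBiproducts (CMod p L S A π) where
  has_binary_biproduct M N := HasBinaryBiproduct.mk
    ⟨prodBicone M N, isBinaryBilimitOfTotal _ (by
      ext m
      exact Prod.ext (add_zero (Prod.fst (α := M) (β := N) m))
        (zero_add (Prod.snd (α := M) (β := N) m)))⟩

instance : HasFiniteProducts (CMod p L S A π) :=
  hasFiniteProducts_of_has_binary_and_terminal

instance [IsNoetherianRing A] : HasKernels (CMod p L S A π) :=
  ⟨fun f => ⟨⟨⟨_, kerIsLimit f⟩⟩⟩⟩

instance : HasCokernels (CMod p L S A π) :=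
  ⟨fun f => ⟨⟨⟨_, cokerIsColimit f⟩⟩⟩⟩

instance [IsNoetherianRing A] : CategoryTheory.Abelian (CMod p L S A π) where
  normalMonoOfMono f _ := ⟨normalMono f⟩
  normalEpiOfEpi f _ := ⟨normalEpi f⟩

end Abelian

/-- `Ext^i(M, N) = 0` in the abelian category of objects. -/
def ExtVanishes [IsNoetherianRing A] (M N : CMod p L S A π) (i : ℕ) : Prop :=
  haveI := HasExt.standard (CMod p L S A π)
  Subsingleton (Abelian.Ext M N i)

/-! #### Restriction, extension of scalars, induction -/

/-- The restriction of an object to a smaller set of roots. -/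
def res {T : Set ι} (hST : S ⊆ T) (M : CMod p L T A π) : CMod p L S A π where
  carrier := M
  ρ := M.ρ.comp (LieSubalgebra.inclusion (L.gS_mono hST) : L.gS S →ₗ[K] L.gS T)
  ρ_lie x y := M.ρ_lie (LieSubalgebra.inclusion (L.gS_mono hST) x)
    (LieSubalgebra.inclusion (L.gS_mono hST) y)
  ρ_pow α hα := M.ρ_pow α (hST hα)
  finite := M.finite
  piece := M.piece
  piece_indep := M.piece_indep
  piece_span := M.piece_span
  h_act w m hm x := M.h_act w m hm x
  e_act α hα := M.e_act α (hST hα)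

/-- The structure map `𝔥 → A → A'` of an `A`-algebra `A'`. -/
def bcπ (A' : Type u) [CommRing A'] [Algebra K A'] [Algebra A A'] [IsScalarTower K A A']
    (π : CartanAlg K Y →ₗ[K] A) : CartanAlg K Y →ₗ[K] A' :=
  (IsScalarTower.toAlgHom K A A').toLinearMap ∘ₗ π

section BaseChange

variable (A' : Type u) [CommRing A'] [Algebra K A'] [Algebra A A'] [IsScalarTower K A A']

/-- Extension of scalars `M ⊗_A A'`. -/
def baseChange (M : CMod p L S A π) : CMod p L S A' (bcπ A' π) where
  carrier := A' ⊗[A] M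
  ρ :=
    { toFun := fun x => (M.ρ x).baseChange A'
      map_add' := fun x y => by rw [map_add, LinearMap.baseChange_add]
      map_smul' := fun c x => by
        ext m
        simp [IsScalarTower.algebraMap_apply K A A', TensorProduct.smul_tmul', Algebra.smul_def] }
  ρ_lie x y := by
    ext m
    simp [M.ρ_lie]
  ρ_pow α hα m := by
    simp only [LinearMap.coe_mk, AddHom.coe_mk, ← LinearMap.baseChange_pow]
    induction m with
    | zero => simp
    | add x y hx hy => simp only [map_add, smul_add, hx, hy]
    | tmul a m =>
      rw [LinearMap.baseChange_tmul, M.ρ_pow, IsScalarTower.algebraMap_apply K A A',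
        algebraMap_smul A', TensorProduct.tmul_smul]
  finite := inferInstance
  piece w := (M.piece w).baseChange A'
  piece_indep := by
    refine WGrading.indep_of_proj _ (fun w => (M.proj w).baseChange A') ?_ ?_
    · intro w x hx
      rw [Submodule.baseChange_eq_span] at hx
      induction hx using Submodule.span_induction with
      | mem x hx =>
        obtain ⟨m, hm, rfl⟩ := hx
        simp [M.proj_same w m hm]
      | zero => simp
      | add x y _ _ hx hy => rw [map_add, hx, hy]
      | smul a x _ hx => rw [map_smul, hx]
    · intro v w hvw x hx
      rw [Submodule.baseChange_eq_span] at hx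
      induction hx using Submodule.span_induction with
      | mem x hx =>
        obtain ⟨m, hm, rfl⟩ := hx
        simp [M.proj_ne v w hvw m hm]
      | zero => simp
      | add x y _ _ hx hy => rw [map_add, hx, hy, add_zero]
      | smul a x _ hx => rw [map_smul, hx, smul_zero]
  piece_span := by
    rw [eq_top_iff]
    intro x _
    induction x with
    | zero => exact zero_mem _
    | add x y hx hy => exact add_mem (hx trivial) (hy trivial)
    | tmul a m =>
      obtain ⟨s, hs⟩ := M.proj_sum m
      rw [hs, TensorProduct.tmul_sum]
      exact Submodule.sum_mem _ fun w _ => Submodule.mem_iSup_of_mem w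
        (Submodule.tmul_mem_baseChange_of_mem a (M.proj_mem w m))
  h_act w m hm x := by
    rw [Submodule.baseChange_eq_span] at hm
    induction hm using Submodule.span_induction with
    | mem y hy =>
      obtain ⟨m, hm, rfl⟩ := hy
      simp only [LinearMap.coe_mk, AddHom.coe_mk, TensorProduct.mk_apply,
        LinearMap.baseChange_tmul, M.h_act w m hm x]
      rw [TensorProduct.tmul_smul, ← algebraMap_smul A', map_add,
        ← IsScalarTower.algebraMap_apply]
      rfl
    | zero => simp
    | add y z _ _ hy hz => rw [map_add, hy, hz, smul_add]
    | smul a y _ hy => rw [map_smul, hy, smul_comm]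
  e_act α hα w m hm := by
    rw [Submodule.baseChange_eq_span] at hm
    induction hm using Submodule.span_induction with
    | mem y hy =>
      obtain ⟨m, hm, rfl⟩ := hy
      exact Submodule.tmul_mem_baseChange_of_mem 1 (M.e_act α hα w m hm)
    | zero => rw [map_zero]; exact zero_mem _
    | add y z _ _ hy hz => rw [map_add]; exact add_mem hy hz
    | smul a y _ hy => rw [map_smul]; exact Submodule.smul_mem _ _ hy

theorem baseChange_ρ {M N : CMod p L S A π} (f : M ⟶ N) (x) (m : A' ⊗[A] M) :
    (lin f).baseChange A' ((M.ρ x).baseChange A' m) =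
      (N.ρ x).baseChange A' ((lin f).baseChange A' m) := by
  induction m with
  | zero => simp
  | add y z hy hz => simp only [map_add, hy, hz]
  | tmul a m => simp [lin_ρ]

theorem baseChange_piece {M N : CMod p L S A π} (f : M ⟶ N) (w) (m : A' ⊗[A] M)
    (hm : m ∈ (M.piece w).baseChange A') :
    (lin f).baseChange A' m ∈ (N.piece w).baseChange A' := by
  rw [Submodule.baseChange_eq_span] at hm
  induction hm using Submodule.span_induction with
  | mem y hy =>
    obtain ⟨m, hm, rfl⟩ := hy
    exact Submodule.tmul_mem_baseChange_of_mem 1 (lin_piece f w m hm)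
  | zero => rw [map_zero]; exact zero_mem _
  | add y z _ _ hy hz => rw [map_add]; exact add_mem hy hz
  | smul a y _ hy => rw [map_smul]; exact Submodule.smul_mem _ _ hy

/-- Extension of scalars on morphisms, `f ↦ f ⊗ id`. -/
def baseChangeMap {M N : CMod p L S A π} (f : M ⟶ N) : M.baseChange A' ⟶ N.baseChange A' :=
  mkHom ((lin f).baseChange A') (baseChange_ρ A' f) (baseChange_piece A' f)

end BaseChange

attribute [local instance] LieRing.ofAssociativeRing in
/-- The action of `U_S` on an object. -/
def act (M : CMod p L S A π) : L.US p S →+* Module.End A M :=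
  letI : Algebra K (Module.End A M) :=
    ((algebraMap A (Module.End A M)).comp (algebraMap K A)).toAlgebra' fun c f => by
      ext m; simp
  (RingQuot.liftAlgHom K
    ⟨UniversalEnvelopingAlgebra.lift K
      { toFun := M.ρ
        map_add' := map_add _
        map_smul' := fun c x => by
          rw [LinearMap.map_smulₛₗ, Algebra.smul_def, Algebra.smul_def]; rfl
        map_lie' := fun {x y} => M.ρ_lie x y }, by
      rintro _ _ ⟨α, hα⟩
      ext m
      rw [map_pow, UniversalEnvelopingAlgebra.lift_ι_apply, AlgHom.commutes]
      exact M.ρ_pow α hα m⟩ : L.US p S →ₐ[K] Module.End A M).toRingHom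

/-- The map `U_T ⊗_ℤ M → G`, `u ⊗ m ↦ u • i m`. -/
def indMap {T : Set ι} (hST : S ⊆ T) {M : CMod p L S A π} {G : CMod p L T A π}
    (i : M ⟶ G.res hST) : L.US p T ⊗[ℤ] M →ₗ[ℤ] G :=
  TensorProduct.lift (LinearMap.mk₂ ℤ (fun u m => G.act u (show G from lin i m))
    (fun u v m => by rw [map_add]; rfl)
    (fun n u m => by rw [map_zsmul]; rfl)
    (fun u m m' => by rw [map_add]; exact map_add (G.act u) _ _)
    (fun n u m => by rw [map_zsmul]; exact map_zsmul (G.act u) _ _))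

/-- For `S ⊆ T`, `M` an object for `S` and `G` an object for `T`: the object `G` is the induced object
`U_T ⊗_{U_S} M`. That is, there is a morphism `i` from `M` to the restriction of `G` such that
`u ⊗ m ↦ u • i m` induces a bijection with `G` of `U_T ⊗_{U_S} M`, the quotient of `U_T ⊗_ℤ M` by
the elements `u b ⊗ m - u ⊗ b m` with `b ∈ U_S`. (As `i` respects the pieces, the piece of `G` of
weight `w` is then the sum of the images of the `(U_T)_v ⊗ M_{w - v}`.) -/
def IsInduced {T : Set ι} (hST : S ⊆ T) (M : CMod p L S A π) (G : CMod p L T A π) : Prop :=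
  ∃ i : M ⟶ G.res hST, Function.Surjective (indMap hST i) ∧
    LinearMap.ker (indMap hST i) = Submodule.span ℤ
      {t | ∃ (u : L.US p T) (b : L.US p S) (m : M),
        t = (u * L.inclUS p hST b) ⊗ₜ[ℤ] m - u ⊗ₜ[ℤ] (M.act b m)}

/-- `N` is isomorphic to `A^μ`: it is free of rank one over `A`, is concentrated in
weight `(μ + ℤI, dμ)`, and the root vectors act on it by zero. -/
def IsCharacter (μ : X) (N : CMod p L S A π) : Prop :=
  ∃ v ∈ N.piece (L.wt μ), Function.Bijective (fun a : A => a • v) ∧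
    ∀ α (hα : α ∈ S), N.ρ (L.eS α hα) v = 0

/-- `Z` is isomorphic to the baby Verma module `Z_{A,I,χ}(μ)` for `𝔤_I`, which is induced
from `A^μ`. -/
def IsBabyVermaI (μ : X) (Z : CMod p L L.RI A π) : Prop :=
  ∃ N : CMod p L L.RIpos A π, N.IsCharacter μ ∧ IsInduced L.RIpos_subset_RI N Z

/-- `N` is isomorphic to `Θ(M)`: it has the same `A`-module structure, the same pieces and the same
action of the root vectors as `M`, while `𝔥` acts in the way required by the other structure map. -/
def IsTheta {π' : CartanAlg K Y →ₗ[K] A} (M : CMod p L S A π') (N : CMod p L S A π) : Prop :=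
  ∃ φ : M ≃ₗ[A] N, (∀ w m, m ∈ M.piece w ↔ φ m ∈ N.piece w) ∧
    ∀ α (hα : α ∈ S) m, φ (M.ρ (L.eS α hα) m) = N.ρ (L.eS α hα) (φ m)

/-- The object `N` for `𝔭 = 𝔤_I ⊕ 𝔲⁺` is the object `M` for `𝔤_I` on which `𝔲⁺` acts by zero. -/
def IsInflation (M : CMod p L L.RI A π) (N : CMod p L L.RP A π) : Prop :=
  Nonempty (N.res L.RI_subset_RP ≅ M) ∧
    ∀ α (hα : α ∈ L.RP), α ∉ L.RI → ∀ n, N.ρ (L.eS α hα) n = 0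

end CMod

/-- A projective cover: an epimorphism from a projective object that is essential. -/
structure IsProjectiveCover {C : Type*} [Category C] {Q Z : C} (f : Q ⟶ Z) : Prop where
  projective : Projective Q
  epi : Epi f
  essential : ∀ {W : C} (g : W ⟶ Q), Epi (g ≫ f) → Epi g

namespace CMod

variable {p : ℕ} {L : StdLevi D} {A : Type u} [CommRing A] [Algebra K A]
  {π : CartanAlg K Y →ₗ[K] A}

/-- `N` is isomorphic to `Q_{A,I,χ}(μ) = Θ_A(Q ⊗_K A)`, where `Q` is the projective cover of the baby
Verma module `Z_{K,I,χ}(μ)` for `𝔤_I` over `K` (with structure map zero on `𝔥`). -/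
def IsQLevi (μ : X) (N : CMod p L L.RI A π) : Prop :=
  ∃ (Z Q : CMod p L L.RI K 0) (f : Q ⟶ Z),
    Z.IsBabyVermaI μ ∧ IsProjectiveCover f ∧ (Q.baseChange A).IsTheta N

/-- `G` is isomorphic to `Q_{A,χ}^I(μ) = Γ_{A,χ}(Q_{A,I,χ}(μ)) = U_χ ⊗_{U^I U_I⁺} Q_{A,I,χ}(μ)`. -/
def IsQI (μ : X) (G : CMod p L Set.univ A π) : Prop :=
  ∃ (N : CMod p L L.RI A π) (N' : CMod p L L.RP A π),
    N.IsQLevi μ ∧ N.IsInflation N' ∧ IsInduced (Set.subset_univ L.RP) N' G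

/-- `M` has a finite filtration in `𝒞_A` whose sections are of the form `Q_{A,χ}^I(μ)`. -/
inductive HasQFiltration : CMod p L Set.univ A π → Prop
  | zero (M) (hM : Limits.IsZero M) : HasQFiltration M
  | step (T : ShortComplex (CMod p L Set.univ A π)) (hT : T.ShortExact)
      (h₁ : HasQFiltration T.X₁) (μ : X) (h₃ : T.X₃.IsQI μ) : HasQFiltration T.X₂

end CMod
end Cat
end

/-!
Every object of the category is covered by a free one, freely generated by finitely many vectors of
given weights: such objects exist because `U_S` is free over `U(𝔥)` on products of root vectors, by
the Poincaré–Birkhoff–Witt theorem and the centrality of the elements `e_α ^ p` in `U(𝔤_S)`.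
Morphisms from a free object `P` to `N` amount to elements of pieces of `N`. Hence `Hom(P, N)` is
finitely generated and projective over `A` if `N` is projective, and it commutes with extension of
scalars.

Let `P₂ → P₁ → P₀ → M → 0` be a free presentation. An object with a `Q`-filtration is projective
over `A`, so the presentation stays exact after an extension of scalars to `A'`, and `Ext¹` over
`A'` is the cohomology of `A' ⊗ Hom(P₀, N) → A' ⊗ Hom(P₁, N) → A' ⊗ Hom(P₂, N)` in the middle. If
it vanishes for `A' = A ⧸ 𝔪` and all maximal ideals `𝔪`, then by Nakayama's lemma the cokernel of
the first map is a direct summand of `Hom(P₂, N)` when `A' = A`, so the complex has a contraction in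
the middle. The contraction survives every extension of scalars, which gives all three claims for
`Ext¹`; the higher `Ext` groups reduce to `Ext¹` of a syzygy.
-/

noncomputable section

/-! ### The Poincaré–Birkhoff–Witt theorem -/

namespace PBW

section Defect

variable {k 𝔩 E : Type*} [CommRing k] [LieRing 𝔩] [LieAlgebra k 𝔩] [Ring E] [Algebra k E]
  (ρ : 𝔩 →ₗ[k] E)

/-- The failure of a linear map from a Lie algebra to an associative algebra to be a homomorphism
of Lie algebras, as a bilinear map. -/
def defect : 𝔩 →ₗ[k] 𝔩 →ₗ[k] E :=
  LinearMap.mk₂ k (fun x y => ρ x * ρ y - ρ y * ρ x - ρ ⁅x, y⁆)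
    (fun x x' y => by simp only [map_add, add_lie]; noncomm_ring)
    (fun a x y => by simp only [map_smul, smul_lie, smul_mul_assoc, mul_smul_comm, smul_sub])
    (fun x y y' => by simp only [map_add, lie_add]; noncomm_ring)
    (fun a x y => by simp only [map_smul, lie_smul, smul_mul_assoc, mul_smul_comm, smul_sub])

theorem defect_apply (x y : 𝔩) : defect ρ x y = ρ x * ρ y - ρ y * ρ x - ρ ⁅x, y⁆ := rfl

theorem defect_swap (x y : 𝔩) : defect ρ y x = -defect ρ x y := by
  rw [defect_apply, defect_apply, ← lie_skew y x, map_neg]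
  abel

theorem defect_mul_cyclic (x y z : 𝔩) :
    defect ρ x y * ρ z + defect ρ y z * ρ x + defect ρ z x * ρ y =
      ρ z * defect ρ x y + ρ x * defect ρ y z + ρ y * defect ρ z x -
        (defect ρ ⁅x, y⁆ z + defect ρ ⁅y, z⁆ x + defect ρ ⁅z, x⁆ y) := by
  have jacobi : ρ ⁅⁅x, y⁆, z⁆ + ρ ⁅⁅y, z⁆, x⁆ + ρ ⁅⁅z, x⁆, y⁆ = 0 := by
    rw [← map_add, ← map_add, ← lie_skew ⁅x, y⁆ z, ← lie_skew ⁅y, z⁆ x, ← lie_skew ⁅z, x⁆ y,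
      ← neg_add, ← neg_add, add_rotate, lie_jacobi, neg_zero, map_zero]
  simp only [defect_apply]
  linear_combination (norm := noncomm_ring) -jacobi

end Defect

section Operators

variable {k 𝔩 I : Type*} [CommRing k]

/-- The monomial of a multiset in the symmetric algebra, which is modelled as the free module on
multisets of indices. -/
abbrev sym (k : Type*) [CommRing k] {I : Type*} (s : Multiset I) : Multiset I →₀ k :=
  Finsupp.single s 1

/-- The part of degree at most `n` of the symmetric algebra. -/
def degLE (k I : Type*) [CommRing k] (n : ℕ) : Submodule k (Multiset I →₀ k) :=
  Submodule.span k (sym k '' {s | s.card ≤ n})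

theorem sym_mem_degLE {s : Multiset I} {n : ℕ} (h : s.card ≤ n) : sym k s ∈ degLE k I n :=
  Submodule.subset_span ⟨s, h, rfl⟩

theorem degLE_mono {m n : ℕ} (h : m ≤ n) : degLE k I m ≤ degLE k I n :=
  Submodule.span_mono (Set.image_mono fun _ hs => le_trans hs h)

theorem map_mem_of_mem_degLE {M : Type*} [AddCommGroup M] [Module k M] {n : ℕ}
    (T : (Multiset I →₀ k) →ₗ[k] M) (W : Submodule k M)
    (h : ∀ s : Multiset I, s.card ≤ n → T (sym k s) ∈ W) {v} (hv : v ∈ degLE k I n) : T v ∈ W :=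
  (Submodule.span_le (p := W.comap T)).2 (Set.forall_mem_image.2 fun s hs => h s hs) hv

theorem map_eq_of_mem_degLE {M : Type*} [AddCommGroup M] [Module k M] {n : ℕ}
    (T T' : (Multiset I →₀ k) →ₗ[k] M)
    (h : ∀ s : Multiset I, s.card ≤ n → T (sym k s) = T' (sym k s)) {v} (hv : v ∈ degLE k I n) :
    T v = T' v :=
  LinearMap.eqOn_span (Set.forall_mem_image.2 fun s hs => h s hs) hv

theorem forall_le_or_exists_eq_cons [LinearOrder I] (i : I) (s : Multiset I) :
    (∀ j ∈ s, i ≤ j) ∨ ∃ j t, s = j ::ₘ t ∧ (∀ l ∈ t, j ≤ l) ∧ j < i := by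
  refine or_iff_not_imp_left.2 fun h => ?_
  push Not at h
  obtain ⟨j, hj, hji⟩ := h
  obtain ⟨m, hm, hmin⟩ := s.toFinset.exists_minimal ⟨j, Multiset.mem_toFinset.2 hj⟩
  have hle : ∀ l ∈ s, m ≤ l := fun l hl =>
    (le_total m l).elim id fun h => hmin (Multiset.mem_toFinset.2 hl) h
  obtain ⟨t, rfl⟩ := Multiset.exists_cons_of_mem (Multiset.mem_toFinset.1 hm)
  exact ⟨m, t, rfl, fun l hl => hle l (Multiset.mem_cons_of_mem hl), (hle j hj).trans_lt hji⟩

variable [LieRing 𝔩] [LieAlgebra k 𝔩] (b : Module.Basis I k 𝔩)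

theorem constr_apply_mem {M : Type*} [AddCommGroup M] [Module k M] (T : I → M →ₗ[k] M)
    (W : Submodule k M) (v : M) (h : ∀ i, T i v ∈ W) (x : 𝔩) : b.constr k T x v ∈ W := by
  rw [Module.Basis.constr_apply, Finsupp.sum, LinearMap.sum_apply]
  exact Submodule.sum_mem _ fun i _ => Submodule.smul_mem _ _ (h i)

theorem constr_apply_congr {M : Type*} [AddCommGroup M] [Module k M] (T T' : I → M →ₗ[k] M)
    (v : M) (h : ∀ i, T i v = T' i v) (x : 𝔩) : b.constr k T x v = b.constr k T' x v := by
  simp only [Module.Basis.constr_apply, Finsupp.sum, LinearMap.sum_apply, LinearMap.smul_apply, h]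

variable [LinearOrder I]

/-- One step of the recursion for left multiplication by basis vectors on ordered monomials: for
`j < i` and `j ≤ t` it imposes `x_i (x_j t) = x_j (x_i t) + [x_i, x_j] t`, where the operators `T`
supply the terms of lower degree. -/
def step (T : I → (Multiset I →₀ k) →ₗ[k] (Multiset I →₀ k)) (i : I) :
    (Multiset I →₀ k) →ₗ[k] (Multiset I →₀ k) :=
  Finsupp.linearCombination k fun s =>
    match s.sort with
    | [] => sym k (i ::ₘ s)
    | j :: t => if i ≤ j then sym k (i ::ₘ s) else
        sym k (i ::ₘ s) + T j (T i (sym k (t : Multiset I)) - sym k (i ::ₘ (t : Multiset I))) +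
          b.constr k T ⁅b i, b j⁆ (sym k (t : Multiset I))

/-- Operators which agree with left multiplication by the basis vectors in degrees up to `n`. -/
def approxLeftMul : ℕ → I → (Multiset I →₀ k) →ₗ[k] (Multiset I →₀ k)
  | 0 => fun i => Finsupp.linearCombination k fun s => sym k (i ::ₘ s)
  | n + 1 => step b (approxLeftMul n)

/-- The operators of left multiplication by the basis vectors, transported from the enveloping
algebra to the symmetric algebra along ordered monomials. -/
def leftMul (i : I) : (Multiset I →₀ k) →ₗ[k] (Multiset I →₀ k) :=
  Finsupp.linearCombination k fun s => approxLeftMul b s.card i (sym k s)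

theorem step_of_le (T : I → (Multiset I →₀ k) →ₗ[k] (Multiset I →₀ k)) {i : I} {s : Multiset I}
    (h : ∀ j ∈ s, i ≤ j) : step b T i (sym k s) = sym k (i ::ₘ s) := by
  simp only [step, Finsupp.linearCombination_single, one_smul]
  split
  · rfl
  · rename_i j t hs
    rw [if_pos (h j (by rw [← Multiset.mem_sort (· ≤ ·), hs]; exact List.mem_cons_self))]

theorem step_of_lt (T : I → (Multiset I →₀ k) →ₗ[k] (Multiset I →₀ k)) {i j : I} {t : Multiset I}
    (h : ∀ l ∈ t, j ≤ l) (hij : j < i) : step b T i (sym k (j ::ₘ t)) =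
      sym k (i ::ₘ j ::ₘ t) + T j (T i (sym k t) - sym k (i ::ₘ t)) +
        b.constr k T ⁅b i, b j⁆ (sym k t) := by
  simp only [step, Finsupp.linearCombination_single, one_smul, Multiset.sort_cons j t (· ≤ ·) h,
    if_neg hij.not_ge, Multiset.sort_eq]

theorem approxLeftMul_sub_mem (n : ℕ) (i : I) (s : Multiset I) :
    approxLeftMul b n i (sym k s) - sym k (i ::ₘ s) ∈ degLE k I s.card := by
  induction n generalizing i s with
  | zero => simp [approxLeftMul]
  | succ n ih =>
    have raises_degree (l : I) (m : ℕ) (v) (hv : v ∈ degLE k I m) :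
        approxLeftMul b n l v ∈ degLE k I (m + 1) := by
      refine map_mem_of_mem_degLE _ _ (fun s hs => ?_) hv
      rw [← sub_add_cancel (approxLeftMul b n l (sym k s)) (sym k (l ::ₘ s))]
      exact add_mem (degLE_mono (by omega) (ih l s)) (sym_mem_degLE (by simpa using hs))
    rcases forall_le_or_exists_eq_cons i s with h | ⟨j, t, rfl, h, hij⟩
    · rw [approxLeftMul, step_of_le b _ h, sub_self]
      exact zero_mem _
    · rw [approxLeftMul, step_of_lt b _ h hij, add_assoc, add_sub_cancel_left, Multiset.card_cons]
      exact add_mem (raises_degree _ _ _ (ih i t)) (constr_apply_mem b _ _ _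
        (fun l => raises_degree l _ _ (sym_mem_degLE le_rfl)) _)

theorem approxLeftMul_succ (n : ℕ) (i : I) (s : Multiset I) (hs : s.card ≤ n) :
    approxLeftMul b (n + 1) i (sym k s) = approxLeftMul b n i (sym k s) := by
  induction n generalizing i s with
  | zero =>
    obtain rfl : s = 0 := by simpa using hs
    rw [approxLeftMul.eq_2, step_of_le b _ (by simp)]
    simp [approxLeftMul]
  | succ n ih =>
    rcases forall_le_or_exists_eq_cons i s with h | ⟨j, t, rfl, h, hij⟩
    · rw [approxLeftMul, step_of_le b _ h, approxLeftMul, step_of_le b _ h]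
    · have ht : t.card ≤ n := by simpa using hs
      rw [approxLeftMul, step_of_lt b _ h hij, approxLeftMul, step_of_lt b _ h hij,
        ← approxLeftMul, ih i t ht,
        map_eq_of_mem_degLE (n := n) _ _ (fun s hs => ih j s hs)
          (degLE_mono ht (approxLeftMul_sub_mem b n i t)),
        constr_apply_congr b _ _ _ fun l => ih l t ht]

theorem leftMul_eq_approxLeftMul {n : ℕ} (i : I) (s : Multiset I) (hs : s.card ≤ n) :
    leftMul b i (sym k s) = approxLeftMul b n i (sym k s) := by
  induction n, hs using Nat.le_induction with
  | base => simp [leftMul]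
  | succ n hn ih => rw [ih, approxLeftMul_succ b n i s hn]

theorem leftMul_of_le {i : I} {s : Multiset I} (h : ∀ j ∈ s, i ≤ j) :
    leftMul b i (sym k s) = sym k (i ::ₘ s) := by
  rw [leftMul_eq_approxLeftMul b i s (Nat.le_succ _), approxLeftMul, step_of_le b _ h]

theorem leftMul_sub_mem (i : I) (s : Multiset I) :
    leftMul b i (sym k s) - sym k (i ::ₘ s) ∈ degLE k I s.card := by
  rw [leftMul_eq_approxLeftMul b i s le_rfl]
  exact approxLeftMul_sub_mem b _ _ _

/-- The linear map on the symmetric algebra attached to an element of the Lie algebra; it is a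
representation by `rep_lie`. -/
def rep : 𝔩 →ₗ[k] Module.End k (Multiset I →₀ k) := b.constr k (leftMul b)

theorem rep_basis (i : I) : rep b (b i) = leftMul b i := b.constr_basis k _ i

theorem leftMul_of_lt {i j : I} {t : Multiset I} (h : ∀ l ∈ t, j ≤ l) (hij : j < i) :
    leftMul b i (sym k (j ::ₘ t)) =
      leftMul b j (leftMul b i (sym k t)) + rep b ⁅b i, b j⁆ (sym k t) := by
  have leftMul_cons : leftMul b j (sym k (i ::ₘ t)) = sym k (i ::ₘ j ::ₘ t) := by
    rw [leftMul_of_le, Multiset.cons_swap]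
    simpa using ⟨hij.le, h⟩
  rw [leftMul_eq_approxLeftMul b i _ (n := t.card + 1) (by simp), approxLeftMul,
    step_of_lt b _ h hij, ← leftMul_cons, rep,
    constr_apply_congr b (leftMul b) (approxLeftMul b t.card) _
      fun l => leftMul_eq_approxLeftMul b l t le_rfl,
    ← leftMul_eq_approxLeftMul b i t le_rfl,
    ← map_eq_of_mem_degLE (n := t.card) _ _ (fun s hs => leftMul_eq_approxLeftMul b j s hs)
      (leftMul_sub_mem b i t), map_sub]
  abel

/-- The failure of `rep` to be a representation. -/
abbrev repDefect : 𝔩 →ₗ[k] 𝔩 →ₗ[k] Module.End k (Multiset I →₀ k) :=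
  defect (E := Module.End k (Multiset I →₀ k)) (rep b)

theorem repDefect_swap (x y : 𝔩) (v : Multiset I →₀ k) :
    repDefect b y x v = -repDefect b x y v := by
  rw [repDefect, defect_swap, LinearMap.neg_apply]

theorem repDefect_of_le {i j : I} {s : Multiset I} (h : ∀ l ∈ s, j ≤ l) (hij : j < i) :
    repDefect b (b i) (b j) (sym k s) = 0 := by
  simp only [repDefect, defect_apply, rep_basis, LinearMap.sub_apply, Module.End.mul_apply,
    leftMul_of_le b h, leftMul_of_lt b h hij]
  abel

theorem repDefect_sym (x y : 𝔩) (s : Multiset I) : repDefect b x y (sym k s) = 0 := by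
  induction hn : s.card using Nat.strong_induction_on generalizing s x y with
  | _ n ih =>
  subst hn
  have repDefect_lower {m : ℕ} (hm : m < s.card) (x y : 𝔩) {v} (hv : v ∈ degLE k I m) :
      repDefect b x y v = 0 :=
    map_eq_of_mem_degLE (repDefect b x y) 0 (fun t ht => ih _ (ht.trans_lt hm) x y t rfl) hv
  suffices basis_case : ∀ i j, j < i → repDefect b (b i) (b j) (sym k s) = 0 by
    have : (repDefect b).compr₂ (LinearMap.applyₗ (sym k s)) = 0 := b.ext fun i => b.ext fun j => by
      rcases lt_trichotomy i j with h | rfl | h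
      · simpa [repDefect_swap b (b j) (b i)] using basis_case j i h
      · simp [repDefect, defect_apply]
      · exact basis_case i j h
    exact LinearMap.congr_fun₂ this x y
  intro i j hij
  rcases forall_le_or_exists_eq_cons j s with h | ⟨l, t, rfl, h, hlj⟩
  · exact repDefect_of_le b h hij
  have hlt : t.card < (l ::ₘ t).card := by simp
  have repDefect_rep {m m' : I} (hm : l < m) (hm' : l < m') :
      repDefect b (b m) (b l) (rep b (b m') (sym k t)) = 0 := by
    rw [rep_basis, ← sub_add_cancel (leftMul b m' (sym k t)) (sym k (m' ::ₘ t)), map_add,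
      repDefect_lower hlt _ _ (leftMul_sub_mem b m' t), zero_add]
    exact repDefect_of_le b (by simpa using ⟨hm'.le, h⟩) hm
  have cyclic := LinearMap.congr_fun
    (defect_mul_cyclic (E := Module.End k (Multiset I →₀ k)) (rep b) (b i) (b j) (b l)) (sym k t)
  simp only [LinearMap.add_apply, LinearMap.sub_apply, Module.End.mul_apply,
    repDefect_lower hlt _ _ (sym_mem_degLE le_rfl), map_zero, add_zero, sub_zero,
    repDefect_rep hlj (hlj.trans hij), repDefect_swap b (b i) (b l),
    repDefect_rep (hlj.trans hij) hlj, neg_zero, rep_basis b l, leftMul_of_le b h] at cyclic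
  exact cyclic

theorem rep_lie (x y : 𝔩) : rep b ⁅x, y⁆ = rep b x * rep b y - rep b y * rep b x := by
  have : repDefect b x y = 0 :=
    Finsupp.lhom_ext' fun s => LinearMap.ext_ring (repDefect_sym b x y s)
  exact (sub_eq_zero.1 this).symm

attribute [local instance] LieRing.ofAssociativeRing

/-- The representation of the enveloping algebra on the symmetric algebra. -/
def envRep : UniversalEnvelopingAlgebra k 𝔩 →ₐ[k] Module.End k (Multiset I →₀ k) :=
  UniversalEnvelopingAlgebra.lift k { rep b with map_lie' := fun {x y} => rep_lie b x y }

theorem envRep_ι (x : 𝔩) : envRep b (UniversalEnvelopingAlgebra.ι k x) = rep b x :=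
  UniversalEnvelopingAlgebra.lift_ι_apply k _ x

theorem envRep_ι_pow {i : I} {s : Multiset I} (h : ∀ j ∈ s, i ≤ j) (n : ℕ) :
    envRep b (UniversalEnvelopingAlgebra.ι k (b i) ^ n) (sym k s) =
      sym k (Multiset.replicate n i + s) := by
  induction n with
  | zero => simp
  | succ n ih =>
    rw [pow_succ', map_mul, Module.End.mul_apply, ih, envRep_ι, rep_basis, leftMul_of_le,
      Multiset.replicate_succ, Multiset.cons_add]
    intro j hj
    rcases Multiset.mem_add.1 hj with hj | hj
    · exact (Multiset.eq_of_mem_replicate hj).ge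
    · exact h j hj

end Operators
end PBW

namespace PBW

section Monomials

variable {k R I Γ : Type*}

/-- The monomial with exponents `f` in the family `x`, its factors ordered as in the list `l`. -/
def monomial [Monoid R] (x : I → R) (l : List I) (f : I → ℕ) : R :=
  (l.map fun i => x i ^ f i).prod

/-- The degree of the monomial with exponents `f`, the `i`-th variable having degree `d i`. -/
def degree [AddCommMonoid Γ] (d : I → Γ) (l : List I) (f : I → ℕ) : Γ :=
  (l.map fun i => f i • d i).sum

theorem monomial_cons [Monoid R] (x : I → R) (i : I) (l : List I) (f : I → ℕ) :
    monomial x (i :: l) f = x i ^ f i * monomial x l f := by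
  simp [monomial]

theorem monomial_append [Monoid R] (x : I → R) (l l' : List I) (f : I → ℕ) :
    monomial x (l ++ l') f = monomial x l f * monomial x l' f := by
  simp [monomial]

theorem monomial_map {I' : Type*} [Monoid R] (x : I → R) (φ : I' → I) (l : List I') (f : I → ℕ) :
    monomial x (l.map φ) f = monomial (x ∘ φ) l (f ∘ φ) := by
  simp [monomial, Function.comp_def]

theorem map_monomial {R' F : Type*} [Monoid R] [Monoid R'] [FunLike F R R'] [MonoidHomClass F R R']
    (φ : F) (x : I → R) (l : List I) (f : I → ℕ) :
    φ (monomial x l f) = monomial (fun i => φ (x i)) l f := by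
  simp [monomial, map_list_prod, Function.comp_def]

theorem monomial_congr [Monoid R] (x : I → R) (l : List I) {f g : I → ℕ}
    (h : ∀ i ∈ l, f i = g i) : monomial x l f = monomial x l g := by
  rw [monomial, monomial, List.map_congr_left fun i hi => by rw [h i hi]]

theorem monomial_eq_prod_map_flatten [Monoid R] (x : I → R) (l : List I) (f : I → ℕ) :
    monomial x l f = (((l.map fun i => List.replicate (f i) i).flatten).map x).prod := by
  induction l with
  | nil => simp [monomial]
  | cons i l ih => simp [monomial_cons, ih]

variable [AddCommMonoid Γ]

theorem degree_eq_sum [DecidableEq I] (d : I → Γ) {l : List I} (hl : l.Nodup) (f : I → ℕ) :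
    degree d l f = ∑ i ∈ l.toFinset, f i • d i :=
  (List.sum_toFinset _ hl).symm

theorem degree_cons (d : I → Γ) (i : I) (l : List I) (f : I → ℕ) :
    degree d (i :: l) f = f i • d i + degree d l f := by
  simp [degree]

theorem degree_append (d : I → Γ) (l l' : List I) (f : I → ℕ) :
    degree d (l ++ l') f = degree d l f + degree d l' f := by
  simp [degree]

theorem degree_map {I' : Type*} (d : I → Γ) (φ : I' → I) (l : List I') (f : I → ℕ) :
    degree d (l.map φ) f = degree (d ∘ φ) l (f ∘ φ) := by
  simp [degree, Function.comp_def]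

theorem sum_map_flatten (d : I → Γ) (l : List I) (f : I → ℕ) :
    (((l.map fun i => List.replicate (f i) i).flatten).map d).sum = degree d l f := by
  induction l with
  | nil => simp [degree]
  | cons i l ih =>
    rw [List.map_cons, List.flatten_cons, List.map_append, List.sum_append, ih, degree_cons,
      List.map_replicate, List.sum_replicate]

theorem count_degree_singleton [DecidableEq I] {l : List I} (hl : l.Nodup) (f : I → ℕ) {i : I}
    (hi : i ∈ l) : (degree (fun i => ({i} : Multiset I)) l f).count i = f i := by
  simp [degree_eq_sum _ hl, Multiset.count_sum', Multiset.count_singleton, hi]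

theorem mem_of_mem_degree_singleton {l : List I} {f : I → ℕ} {i : I}
    (hi : i ∈ degree (fun i => ({i} : Multiset I)) l f) : i ∈ l := by
  induction l with
  | nil => simp [degree] at hi
  | cons j l ih =>
    rw [degree_cons, Multiset.mem_add] at hi
    rcases hi with hi | hi
    · exact (Multiset.mem_singleton.1 (Multiset.mem_of_mem_nsmul hi)) ▸ List.mem_cons_self
    · exact List.mem_cons_of_mem _ (ih hi)

theorem perm_flatten_replicate_count [DecidableEq I] {l : List I} (hl : l.Nodup)
    (hmem : ∀ i, i ∈ l) (m : List I) :
    m.Perm (l.map fun i => List.replicate (m.count i) i).flatten := by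
  refine List.perm_iff_count.2 fun i => ?_
  have := sum_map_flatten (fun i => ({i} : Multiset I)) l (m.count ·)
  rw [← Multiset.sum_coe, ← Multiset.map_coe, Multiset.sum_map_singleton] at this
  rw [← Multiset.coe_count i (List.flatten _), this, count_degree_singleton hl _ (hmem i)]

end Monomials

section Independence

variable {k 𝔩 I : Type*} [CommRing k] [LieRing 𝔩] [LieAlgebra k 𝔩]

attribute [local instance] LieRing.ofAssociativeRing

theorem envRep_monomial [LinearOrder I] (b : Module.Basis I k 𝔩) (l : List I)
    (hl : l.Pairwise (· < ·)) (f : I → ℕ) :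
    envRep b (monomial (fun i => UniversalEnvelopingAlgebra.ι k (b i)) l f) (sym k 0) =
      sym k (degree (fun i => ({i} : Multiset I)) l f) := by
  induction l with
  | nil => simp [monomial, degree]
  | cons i l ih =>
    obtain ⟨hi, hl⟩ := List.pairwise_cons.1 hl
    rw [monomial_cons, map_mul, Module.End.mul_apply, ih hl,
      envRep_ι_pow b fun j hj => (hi j (mem_of_mem_degree_singleton hj)).le,
      degree_cons, Multiset.nsmul_singleton]

theorem linearIndependent_monomial (b : Module.Basis I k 𝔩) {l : List I} (hl : l.Nodup)
    (hmem : ∀ i, i ∈ l) :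
    LinearIndependent k (monomial (fun i => UniversalEnvelopingAlgebra.ι k (b i)) l) := by
  classical
  have idxOf_lt : l.Pairwise fun i j => l.idxOf i < l.idxOf j :=
    List.pairwise_iff_getElem.2 fun i j hi hj hij => by rwa [hl.idxOf_getElem, hl.idxOf_getElem]
  let _ : LinearOrder I := LinearOrder.lift' (fun i => l.idxOf i)
    fun i j h => (List.idxOf_inj (hmem i)).1 h
  have sorted : l.Pairwise (· < ·) := idxOf_lt
  have degree_injective :
      Function.Injective fun f : I → ℕ => degree (fun i => ({i} : Multiset I)) l f :=
    fun f g h => funext fun i => by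
      rw [← count_degree_singleton hl f (hmem i), ← count_degree_singleton hl g (hmem i)]
      exact congrArg _ h
  refine LinearIndependent.of_comp
    ((LinearMap.applyₗ (sym k 0)).comp (envRep b).toLinearMap) ?_
  convert (Finsupp.linearIndependent_single_one k (Multiset I)).comp _ degree_injective using 1
  exact funext fun f => envRep_monomial b l sorted f

end Independence

section Straightening

variable {k R I Γ : Type*} [CommRing k] [Ring R] [Algebra k R] [AddCommMonoid Γ]
  {x : I → R} {d : I → Γ}

/-- The span of the products of at most `n` members of the family `x` of total degree `g`, where
`x i` has degree `d i`. -/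
def wordsLE (k : Type*) [CommRing k] [Algebra k R] (x : I → R) (d : I → Γ) (n : ℕ) (g : Γ) :
    Submodule k R :=
  Submodule.span k ((fun m : List I => (m.map x).prod) '' {m | m.length ≤ n ∧ (m.map d).sum = g})

theorem word_mem_wordsLE {m : List I} {n : ℕ} (h : m.length ≤ n) :
    (m.map x).prod ∈ wordsLE k x d n (m.map d).sum := Submodule.subset_span ⟨m, ⟨h, rfl⟩, rfl⟩

theorem mul_mem_wordsLE (i : I) {n : ℕ} {g : Γ} {v : R} (hv : v ∈ wordsLE k x d n g) :
    x i * v ∈ wordsLE k x d (n + 1) (d i + g) := by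
  refine (Submodule.span_le
    (p := (wordsLE k x d (n + 1) (d i + g)).comap (LinearMap.mulLeft k (x i)))).2 ?_ hv
  rintro _ ⟨m, ⟨hm, rfl⟩, rfl⟩
  have := word_mem_wordsLE (k := k) (x := x) (d := d) (m := i :: m) (n := n + 1) (by simpa using hm)
  simpa using this

theorem sub_mem_wordsLE_of_perm
    (hx : ∀ i j, x i * x j - x j * x i ∈ Submodule.span k (x '' {a | d a = d i + d j}))
    {m m' : List I} (h : m.Perm m') {n : ℕ} (hn : m.length ≤ n + 1) :
    (m.map x).prod - (m'.map x).prod ∈ wordsLE k x d n (m.map d).sum := by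
  induction h generalizing n with
  | nil => simp
  | @cons a m m' h ih =>
    simp only [List.map_cons, List.prod_cons, List.sum_cons, ← mul_sub]
    cases n with
    | zero =>
      obtain rfl : m = [] := by simpa using hn
      rw [List.nil_perm.1 h, sub_self, mul_zero]
      exact zero_mem _
    | succ n => exact mul_mem_wordsLE a (ih (by simpa using hn))
  | swap a a' m =>
    obtain ⟨n, rfl⟩ : ∃ n', n = n' + 1 := ⟨n - 1, by simp at hn; omega⟩
    have hm : m.length ≤ n := by simpa using hn
    simp only [List.map_cons, List.prod_cons, List.sum_cons, ← mul_assoc, ← sub_mul, ← add_assoc]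
    refine (Submodule.span_le (p := (wordsLE k x d (n + 1) _).comap
      (LinearMap.mulRight k (m.map x).prod))).2 ?_ (hx a' a)
    rintro _ ⟨i, hi, rfl⟩
    have := mul_mem_wordsLE i (word_mem_wordsLE (k := k) (x := x) (d := d) hm)
    rwa [hi] at this
  | trans h1 _ ih1 ih2 =>
    rw [← sub_add_sub_cancel]
    refine add_mem (ih1 hn) ?_
    rw [(h1.map d).sum_eq]
    exact ih2 (by rwa [← h1.length_eq])

theorem word_mem_span_monomial
    (hx : ∀ i j, x i * x j - x j * x i ∈ Submodule.span k (x '' {a | d a = d i + d j}))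
    {l : List I} (hl : l.Nodup) (hmem : ∀ i, i ∈ l) (m : List I) :
    (m.map x).prod ∈
      Submodule.span k (monomial x l '' {f | degree d l f = (m.map d).sum}) := by
  classical
  induction hn : m.length using Nat.strong_induction_on generalizing m with
  | _ n ih =>
  subst hn
  have hperm := perm_flatten_replicate_count hl hmem m
  have hmono : monomial x l (fun i => m.count i) ∈
      Submodule.span k (monomial x l '' {f | degree d l f = (m.map d).sum}) :=
    Submodule.subset_span ⟨_, by rw [Set.mem_ofPred, ← sum_map_flatten, (hperm.map d).sum_eq], rfl⟩
  rw [← sub_add_cancel (m.map x).prod (monomial x l fun i => m.count i)]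
  refine add_mem ?_ hmono
  rcases Nat.eq_zero_or_pos m.length with hm | hm
  · obtain rfl := List.length_eq_zero_iff.1 hm
    simp [monomial]
  · rw [monomial_eq_prod_map_flatten]
    refine Submodule.span_le.2 ?_
      (sub_mem_wordsLE_of_perm hx hperm (n := m.length - 1) (by omega))
    rintro _ ⟨m', ⟨hlen, hdeg⟩, rfl⟩
    exact hdeg ▸ ih _ (by omega) m' rfl

theorem span_words_eq_top (hgen : Algebra.adjoin k (Set.range x) = ⊤) :
    Submodule.span k (Set.range fun m : List I => (m.map x).prod) = ⊤ := by
  rw [eq_top_iff, ← Algebra.top_toSubmodule, ← hgen, Algebra.adjoin_eq_span]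
  refine Submodule.span_mono fun y hy => ?_
  obtain ⟨m, hm, rfl⟩ := Submonoid.exists_list_of_mem_closure hy
  obtain ⟨m', rfl⟩ : m ∈ Set.range (List.map x) := by rwa [Set.range_list_map]
  exact ⟨m', rfl⟩

theorem span_monomial_eq_top
    (hx : ∀ i j, x i * x j - x j * x i ∈ Submodule.span k (Set.range x))
    (hgen : Algebra.adjoin k (Set.range x) = ⊤) {l : List I} (hl : l.Nodup) (hmem : ∀ i, i ∈ l) :
    Submodule.span k (Set.range (monomial x l)) = ⊤ := by
  rw [eq_top_iff, ← span_words_eq_top hgen, Submodule.span_le]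
  rintro _ ⟨m, rfl⟩
  have := word_mem_span_monomial (k := k) (x := x) (d := fun _ => PUnit.unit) (by simpa using hx)
    hl hmem m
  simpa using this

end Straightening
end PBW

namespace PBW

section Truncation

variable {k I : Type*} [CommRing k] (p : ℕ) (T : Set I) (c : I → k)

/-- The exponents which are smaller than `p` on `T`. -/
abbrev TruncExp := {f : I → ℕ // ∀ i ∈ T, f i < p}

open scoped Classical in
/-- The exponents obtained from `f` by reducing those in `T` modulo `p`. -/
def truncate [NeZero p] (f : I → ℕ) : TruncExp p T :=
  ⟨fun i => if i ∈ T then f i % p else f i,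
    fun i hi => by simpa only [if_pos hi] using Nat.mod_lt _ (NeZero.pos p)⟩

open scoped Classical in
/-- The scalar relating the monomial with exponents `f` to the one with truncated exponents, when
the `p`-th power of the `i`-th variable is `c i` for `i ∈ T`. -/
def truncCoeff (l : List I) (f : I → ℕ) : k :=
  (l.map fun i => if i ∈ T then c i ^ (f i / p) else 1).prod

variable {p T}

theorem truncate_apply_of_mem [NeZero p] (f : I → ℕ) {i : I} (hi : i ∈ T) :
    (truncate p T f).1 i = f i % p := if_pos hi

theorem truncate_apply_of_notMem [NeZero p] (f : I → ℕ) {i : I} (hi : i ∉ T) :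
    (truncate p T f).1 i = f i := if_neg hi

theorem truncate_val [NeZero p] (f : TruncExp p T) : truncate p T f.1 = f :=
  Subtype.ext <| funext fun i => by
    by_cases hi : i ∈ T
    · rw [truncate_apply_of_mem _ hi, Nat.mod_eq_of_lt (f.2 i hi)]
    · rw [truncate_apply_of_notMem _ hi]

theorem truncCoeff_cons (i : I) (l : List I) (f : I → ℕ) : truncCoeff p T c (i :: l) f =
    (open scoped Classical in if i ∈ T then c i ^ (f i / p) else 1) * truncCoeff p T c l f := by
  simp [truncCoeff]

theorem truncCoeff_val (l : List I) (f : TruncExp p T) : truncCoeff p T c l f.1 = 1 := by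
  refine List.prod_eq_one fun y hy => ?_
  obtain ⟨i, _, rfl⟩ := List.mem_map.1 hy
  split_ifs with hi
  · rw [Nat.div_eq_of_lt (f.2 i hi), pow_zero]
  · rfl

theorem monomial_eq_truncCoeff_smul [NeZero p] {R : Type*} [Ring R] [Algebra k R] {x : I → R}
    (hx : ∀ i ∈ T, x i ^ p = algebraMap k R (c i)) (l : List I) (f : I → ℕ) :
    monomial x l f = truncCoeff p T c l f • monomial x l (truncate p T f).1 := by
  induction l with
  | nil => simp [monomial, truncCoeff]
  | cons i l ih =>
    rw [monomial_cons, monomial_cons, truncCoeff_cons, ih, ← smul_mul_smul_comm]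
    congr 1
    by_cases hi : i ∈ T
    · rw [if_pos hi, truncate_apply_of_mem f hi, Algebra.smul_def, map_pow, ← hx i hi, ← pow_mul,
        ← pow_add, Nat.div_add_mod]
    · rw [if_neg hi, truncate_apply_of_notMem f hi, one_smul]

theorem degree_truncate [NeZero p] {Γ : Type*} [AddCommMonoid Γ] {d : I → Γ}
    (hd : ∀ i ∈ T, c i ≠ 0 → p • d i = 0) {l : List I} {f : I → ℕ}
    (hf : truncCoeff p T c l f ≠ 0) : degree d l (truncate p T f).1 = degree d l f := by
  refine congrArg List.sum (List.map_congr_left fun i hi => ?_)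
  by_cases hT : i ∈ T
  · have hpow : c i ^ (f i / p) ≠ 0 := fun h =>
      hf (List.prod_eq_zero (List.mem_map.2 ⟨i, hi, by rw [if_pos hT, h]⟩))
    have hquot : (p * (f i / p)) • d i = 0 := by
      by_cases hc : c i = 0
      · rw [hc] at hpow
        rw [show f i / p = 0 from by_contra fun h => hpow (zero_pow h), mul_zero, zero_smul]
      · rw [mul_comm, mul_smul, hd i hT hc, smul_zero]
    conv_rhs => rw [← Nat.div_add_mod (f i) p, add_smul, hquot, zero_add]
    rw [truncate_apply_of_mem f hT]
  · rw [truncate_apply_of_notMem f hT]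

theorem monomial_mem_span_truncated [NeZero p] {R Γ : Type*} [Ring R] [Algebra k R]
    [AddCommMonoid Γ] {x : I → R} {d : I → Γ} (hx : ∀ i ∈ T, x i ^ p = algebraMap k R (c i))
    (hd : ∀ i ∈ T, c i ≠ 0 → p • d i = 0) (l : List I) (f : I → ℕ) :
    monomial x l f ∈ Submodule.span k
      ((fun g : TruncExp p T => monomial x l g.1) '' {g | degree d l g.1 = degree d l f}) := by
  rw [monomial_eq_truncCoeff_smul c hx]
  by_cases hf : truncCoeff p T c l f = 0
  · rw [hf, zero_smul]
    exact zero_mem _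
  · exact Submodule.smul_mem _ _ (Submodule.subset_span ⟨_, degree_truncate c hd hf, rfl⟩)

theorem word_mem_span_truncated [NeZero p] {R Γ : Type*} [Ring R] [Algebra k R]
    [AddCommMonoid Γ] {x : I → R} {d : I → Γ}
    (hcomm : ∀ i j, x i * x j - x j * x i ∈ Submodule.span k (x '' {a | d a = d i + d j}))
    (hx : ∀ i ∈ T, x i ^ p = algebraMap k R (c i)) (hd : ∀ i ∈ T, c i ≠ 0 → p • d i = 0)
    {l : List I} (hl : l.Nodup) (hmem : ∀ i, i ∈ l) (m : List I) :
    (m.map x).prod ∈ Submodule.span k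
      ((fun g : TruncExp p T => monomial x l g.1) '' {g | degree d l g.1 = (m.map d).sum}) := by
  refine Submodule.span_le.2 ?_ (word_mem_span_monomial hcomm hl hmem m)
  rintro _ ⟨f, hf, rfl⟩
  rw [← Set.mem_ofPred.1 hf]
  exact monomial_mem_span_truncated c hx hd l f

theorem span_truncated_eq_top [NeZero p] {R : Type*} [Ring R] [Algebra k R] {x : I → R}
    (hcomm : ∀ i j, x i * x j - x j * x i ∈ Submodule.span k (Set.range x))
    (hgen : Algebra.adjoin k (Set.range x) = ⊤)
    (hx : ∀ i ∈ T, x i ^ p = algebraMap k R (c i)) {l : List I} (hl : l.Nodup)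
    (hmem : ∀ i, i ∈ l) :
    Submodule.span k (Set.range fun g : TruncExp p T => monomial x l g.1) = ⊤ := by
  rw [eq_top_iff, ← span_words_eq_top hgen, Submodule.span_le]
  rintro _ ⟨m, rfl⟩
  have := word_mem_span_truncated (k := k) (d := fun _ : I => PUnit.unit) c (by simpa using hcomm)
    hx (fun _ _ _ => rfl) hl hmem m
  simpa using this

section Update

variable [DecidableEq I] {l : List I} {i : I}

theorem pow_mul_monomial {R : Type*} [Monoid R] (x : I → R) (hl : l.Nodup) (hi : i ∈ l)
    (hc : ∀ j, Commute (x i ^ p) (x j)) (f : I → ℕ) :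
    x i ^ p * monomial x l f = monomial x l (Function.update f i (f i + p)) := by
  induction l with
  | nil => simp at hi
  | cons a l ih =>
    rw [List.nodup_cons] at hl
    rw [monomial_cons, monomial_cons]
    rcases eq_or_ne a i with rfl | h
    · rw [← mul_assoc, ← pow_add, Function.update_self, add_comm,
        monomial_congr x l fun j hj =>
          (Function.update_of_ne (ne_of_mem_of_not_mem hj hl.1) _ f).symm]
    · rw [Function.update_of_ne h, ← mul_assoc, ((hc a).pow_right _).eq, mul_assoc,
        ih hl.2 ((List.mem_cons.1 hi).resolve_left h.symm)]

theorem truncCoeff_update [NeZero p] (hl : l.Nodup) (hi : i ∈ l) (hT : i ∈ T) (f : I → ℕ) :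
    truncCoeff p T c l (Function.update f i (f i + p)) = c i * truncCoeff p T c l f := by
  induction l with
  | nil => simp at hi
  | cons a l ih =>
    rw [List.nodup_cons] at hl
    rw [truncCoeff_cons, truncCoeff_cons]
    rcases eq_or_ne a i with rfl | h
    · have unchanged : truncCoeff p T c l (Function.update f a (f a + p)) = truncCoeff p T c l f :=
        congrArg List.prod (List.map_congr_left fun j hj => by
          rw [Function.update_of_ne (ne_of_mem_of_not_mem hj hl.1)])
      rw [unchanged, Function.update_self, if_pos hT, if_pos hT, Nat.add_div_right _ (NeZero.pos p),
        pow_succ', mul_assoc]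
    · rw [Function.update_of_ne h, ih hl.2 ((List.mem_cons.1 hi).resolve_left h.symm),
        mul_left_comm]

theorem truncate_update [NeZero p] (hT : i ∈ T) (f : I → ℕ) :
    truncate p T (Function.update f i (f i + p)) = truncate p T f :=
  Subtype.ext <| funext fun j => by
    rcases eq_or_ne j i with rfl | h
    · rw [truncate_apply_of_mem _ hT, truncate_apply_of_mem _ hT, Function.update_self,
        Nat.add_mod_right]
    · simp only [truncate, Function.update_of_ne h]

end Update

end Truncation

section Quotient

variable {k R I : Type*} [CommRing k] [Ring R] [Algebra k R]

theorem map_eq_of_mkAlgHom_eq {V : Type*} [AddCommGroup V] [Module k V] {r : R → R → Prop}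
    {τ : R →ₗ[k] V} (h : ∀ u v, r u v → ∀ a b, τ (a * u * b) = τ (a * v * b)) {u v : R}
    (huv : RingQuot.mkAlgHom k r u = RingQuot.mkAlgHom k r v) : τ u = τ v := by
  have map_eq_of_rel {u v} (huv : RingQuot.Rel r u v) : ∀ a b, τ (a * u * b) = τ (a * v * b) := by
    induction huv with
    | of huv => exact h _ _ huv
    | add_left _ ih => intro a b; simp only [mul_add, add_mul, map_add, ih]
    | mul_left _ ih => intro a b; simpa only [mul_assoc] using ih a _
    | mul_right _ ih => intro a b; simpa only [mul_assoc] using ih (a * _) b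
  have hquot : Quot.mk (RingQuot.Rel r) u = Quot.mk (RingQuot.Rel r) v := by
    simp only [RingQuot.mkAlgHom, RingQuot.mkRingHom] at huv
    exact congrArg RingQuot.toQuot huv
  have hgen := Quot.eqvGen_exact hquot
  clear huv hquot
  induction hgen with
  | rel u v huv => simpa using map_eq_of_rel huv 1 1
  | refl => rfl
  | symm _ _ _ ih => exact ih.symm
  | trans _ _ _ _ _ ih1 ih2 => exact ih1.trans ih2

theorem exists_comp_mkAlgHom_eq {V : Type*} [AddCommGroup V] [Module k V] {r : R → R → Prop}
    {τ : R →ₗ[k] V} (h : ∀ u v, r u v → ∀ a b, τ (a * u * b) = τ (a * v * b)) :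
    ∃ σ : RingQuot r →ₗ[k] V, ∀ u, σ (RingQuot.mkAlgHom k r u) = τ u := by
  let mk := (RingQuot.mkAlgHom k r).toLinearMap
  have hker : LinearMap.ker mk ≤ LinearMap.ker τ := fun u hu =>
    (map_eq_of_mkAlgHom_eq h (hu.trans (map_zero (RingQuot.mkAlgHom k r)).symm)).trans (map_zero τ)
  let e := mk.quotKerEquivOfSurjective (RingQuot.mkAlgHom_surjective k r)
  refine ⟨(LinearMap.ker mk).liftQ τ hker ∘ₗ e.symm, fun u => ?_⟩
  rw [LinearMap.comp_apply, LinearEquiv.coe_coe,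
    show RingQuot.mkAlgHom k r u = e (Submodule.Quotient.mk u) from rfl,
    LinearEquiv.symm_apply_apply, Submodule.liftQ_apply]

variable (p : ℕ) [NeZero p] (T : Set I) (c : I → k) (l : List I)
  (B : Module.Basis (I → ℕ) k R)

/-- Truncation of exponents, as a linear map on an algebra with a basis of monomials; it is the
coordinate map of the quotient by the relations `x i ^ p = c i`, `i ∈ T`. -/
def truncation : R →ₗ[k] (TruncExp p T →₀ k) :=
  B.constr k fun f => Finsupp.single (truncate p T f) (truncCoeff p T c l f)

variable {p T l B} {x : I → R}

theorem truncation_monomial (hB : ∀ f, B f = monomial x l f) (f : I → ℕ) :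
    truncation p T c l B (monomial x l f) =
      Finsupp.single (truncate p T f) (truncCoeff p T c l f) := by
  rw [← hB, truncation, B.constr_basis]

theorem truncation_pow_mul (hB : ∀ f, B f = monomial x l f) (hl : l.Nodup) {i : I} (hi : i ∈ l)
    (hT : i ∈ T) (hcentral : ∀ u, Commute (x i ^ p) u) (u : R) :
    truncation p T c l B (x i ^ p * u) = c i • truncation p T c l B u := by
  classical
  suffices truncation p T c l B ∘ₗ LinearMap.mulLeft k (x i ^ p) = c i • truncation p T c l B from
    LinearMap.congr_fun this u
  refine B.ext fun f => ?_
  rw [LinearMap.comp_apply, LinearMap.mulLeft_apply, LinearMap.smul_apply, hB,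
    pow_mul_monomial x hl hi fun j => hcentral _, truncation_monomial c hB,
    truncation_monomial c hB, truncCoeff_update c hl hi hT, truncate_update hT, Finsupp.smul_single,
    smul_eq_mul]

theorem linearIndependent_truncated (hB : ∀ f, B f = monomial x l f) (hl : l.Nodup)
    (hmem : ∀ i ∈ T, i ∈ l) (hcentral : ∀ i ∈ T, ∀ u, Commute (x i ^ p) u) {r : R → R → Prop}
    (hr : ∀ u v, r u v → ∃ i ∈ T, u = x i ^ p ∧ v = algebraMap k R (c i)) :
    LinearIndependent k fun f : TruncExp p T =>
      monomial (fun i => RingQuot.mkAlgHom k r (x i)) l f.1 := by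
  have respects_rel (u v) (huv : r u v) (a b : R) :
      truncation p T c l B (a * u * b) = truncation p T c l B (a * v * b) := by
    obtain ⟨i, hi, rfl, rfl⟩ := hr u v huv
    rw [← (hcentral i hi a).eq, mul_assoc,
      truncation_pow_mul c hB hl (hmem i hi) hi (hcentral i hi), ← Algebra.commutes,
      mul_assoc, ← Algebra.smul_def, map_smul]
  obtain ⟨σ, hσ⟩ := exists_comp_mkAlgHom_eq respects_rel
  have σ_monomial (f : TruncExp p T) :
      σ (monomial (fun i => RingQuot.mkAlgHom k r (x i)) l f.1) = Finsupp.single f 1 := by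
    rw [← map_monomial, hσ, truncation_monomial c hB, truncate_val, truncCoeff_val]
  refine LinearIndependent.of_comp σ ?_
  simpa only [Function.comp_def, σ_monomial] using
    Finsupp.linearIndependent_single_one k (TruncExp p T)

end Quotient

section EnvelopingAlgebra

attribute [local instance] LieRing.ofAssociativeRing

open UniversalEnvelopingAlgebra (ι)

variable {k 𝔩 I : Type*} [CommRing k] [LieRing 𝔩] [LieAlgebra k 𝔩]

theorem ι_mem_span_image {y : I → 𝔩} {s : Set I} {z : 𝔩} (hz : z ∈ Submodule.span k (y '' s)) :
    ι k z ∈ Submodule.span k ((fun i => ι k (y i)) '' s) := by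
  have := Submodule.mem_map_of_mem (f := (ι k : 𝔩 →ₗ⁅k⁆ _).toLinearMap) hz
  rwa [Submodule.map_span, ← Set.image_comp] at this

theorem ι_mul_sub_mul (y z : 𝔩) : ι k y * ι k z - ι k z * ι k y = ι k ⁅y, z⁆ := by
  rw [LieHom.map_lie, LieRing.of_associative_ring_bracket]

theorem adjoin_range_ι : Algebra.adjoin k (Set.range (ι k : 𝔩 →ₗ⁅k⁆ _)) = ⊤ := by
  set W := Algebra.adjoin k (Set.range (ι k : 𝔩 →ₗ⁅k⁆ _))
  let ιW : 𝔩 →ₗ⁅k⁆ W :=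
    { ((ι k : 𝔩 →ₗ⁅k⁆ _) : 𝔩 →ₗ[k] _).codRestrict (Subalgebra.toSubmodule W)
        fun y => Algebra.subset_adjoin ⟨y, rfl⟩ with
      map_lie' := fun {y z} => Subtype.ext (LieHom.map_lie _ y z) }
  have hid : W.val.comp (UniversalEnvelopingAlgebra.lift k ιW) = AlgHom.id k _ := by
    refine UniversalEnvelopingAlgebra.hom_ext k (LieHom.ext fun y => ?_)
    exact congrArg W.val (UniversalEnvelopingAlgebra.lift_ι_apply k ιW y)
  refine eq_top_iff.2 fun u _ => ?_
  rw [← AlgHom.id_apply (R := k) u, ← hid]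
  exact (UniversalEnvelopingAlgebra.lift k ιW u).2

theorem adjoin_range_ι_of_span {y : I → 𝔩} (hy : Submodule.span k (Set.range y) = ⊤) :
    Algebra.adjoin k (Set.range fun i => ι k (y i)) = ⊤ := by
  rw [eq_top_iff, ← adjoin_range_ι, Algebra.adjoin_le_iff]
  rintro _ ⟨z, rfl⟩
  rw [← Set.image_univ] at hy ⊢
  exact Algebra.span_le_adjoin k _ (ι_mem_span_image (hy ▸ Submodule.mem_top))

/-- The basis of ordered monomials of the enveloping algebra. -/
def monomialBasis (b : Module.Basis I k 𝔩) {l : List I} (hl : l.Nodup) (hmem : ∀ i, i ∈ l) :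
    Module.Basis (I → ℕ) k (UniversalEnvelopingAlgebra k 𝔩) :=
  Module.Basis.mk (linearIndependent_monomial b hl hmem) (span_monomial_eq_top (fun i j => by
    rw [ι_mul_sub_mul, ← Set.image_univ]
    exact ι_mem_span_image (by simp)) (adjoin_range_ι_of_span b.span_eq) hl hmem).ge

theorem monomialBasis_apply (b : Module.Basis I k 𝔩) {l : List I} (hl : l.Nodup)
    (hmem : ∀ i, i ∈ l) (f : I → ℕ) :
    monomialBasis b hl hmem f = monomial (fun i => ι k (b i)) l f := by
  simp [monomialBasis]

end EnvelopingAlgebra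

section RestrictedPower

attribute [local instance] LieRing.ofAssociativeRing

open UniversalEnvelopingAlgebra (ι)

variable {k 𝔩 : Type*} [Field k] [LieRing 𝔩] [LieAlgebra k 𝔩] {p : ℕ} [Fact p.Prime] [CharP k p]

-- In characteristic `p` the operator `ad (x ^ p)` is the `p`-th power of `ad x`, because the left
-- and right multiplications by `x` commute.
theorem commute_pow_ι_ι {x y : 𝔩} (hx : ((LieAlgebra.ad k 𝔩 x) ^ p) y = 0) :
    Commute (ι k x ^ p) (ι k y) := by
  rcases subsingleton_or_nontrivial (UniversalEnvelopingAlgebra k 𝔩)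
  · exact Subsingleton.elim _ _
  have _ : CharP (Module.End k (UniversalEnvelopingAlgebra k 𝔩)) p :=
    charP_of_injective_algebraMap (algebraMap k _).injective p
  have ad_pow (n : ℕ) : ((LinearMap.mulLeft k (ι k x) - LinearMap.mulRight k (ι k x)) ^ n) (ι k y) =
      ι k (((LieAlgebra.ad k 𝔩 x) ^ n) y) := by
    induction n with
    | zero => simp
    | succ n ih =>
      rw [pow_succ', Module.End.mul_apply, ih, pow_succ', Module.End.mul_apply,
        LieAlgebra.ad_apply, ← ι_mul_sub_mul]
      rfl
  have := ad_pow p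
  rw [hx, map_zero, sub_pow_char_of_commute p (LinearMap.commute_mulLeft_right _ _),
    LinearMap.pow_mulLeft, LinearMap.pow_mulRight] at this
  exact sub_eq_zero.1 this

theorem commute_pow_ι {x : 𝔩} (hx : ∀ y, ((LieAlgebra.ad k 𝔩 x) ^ p) y = 0)
    (u : UniversalEnvelopingAlgebra k 𝔩) : Commute (ι k x ^ p) u := by
  have hu : u ∈ Algebra.adjoin k (Set.range (ι k : 𝔩 →ₗ⁅k⁆ _)) := by
    rw [adjoin_range_ι]
    exact Algebra.mem_top
  induction hu using Algebra.adjoin_induction with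
  | mem y hy =>
    obtain ⟨y, rfl⟩ := hy
    exact commute_pow_ι_ι (hx y)
  | algebraMap a => exact Algebra.commute_algebraMap_right _ _
  | add y z _ _ hy hz => exact hy.add_right hz
  | mul y z _ _ hy hz => exact hy.mul_right hz

end RestrictedPower
end PBW

/-! ### Root vectors and closed sets of roots -/

namespace ReductiveLie

variable {K ι X Y 𝔤 : Type*} [Field K] [Finite ι] [AddCommGroup X] [AddCommGroup Y]
  [LieRing 𝔤] [LieAlgebra K 𝔤] (D : ReductiveLie K ι X Y 𝔤)

theorem diff_tmul (μ : X) (c : K) (y : Y) :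
    D.diff μ (c ⊗ₜ y) = c * (D.P.toLinearMap μ y : K) := by
  simp [diff, mul_comm]

theorem lie_h_e_eq_diff (x : CartanAlg K Y) (α : ι) :
    ⁅D.h x, D.e α⁆ = D.diff (D.P.root α) x • D.e α := by
  induction x using TensorProduct.induction_on with
  | zero => simp
  | add x y hx hy => rw [map_add, add_lie, hx, hy, map_add, add_smul]
  | tmul c y =>
    have : (c ⊗ₜ[ℤ] y : CartanAlg K Y) = c • (1 ⊗ₜ y) := by simp [TensorProduct.smul_tmul']
    rw [this, map_smul, smul_lie, D.lie_h_e, map_smul, D.diff_tmul, smul_eq_mul, one_mul, mul_smul,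
      Int.cast_smul_eq_zsmul]

theorem lie_e_h (α : ι) (x : CartanAlg K Y) :
    ⁅D.e α, D.h x⁆ = -(D.diff (D.P.root α) x • D.e α) := by
  rw [← lie_skew, D.lie_h_e_eq_diff]

theorem exists_lie_e_e_eq {α β γ : ι} (h : D.P.root α + D.P.root β = D.P.root γ) :
    ∃ z : ℤ, ⁅D.e α, D.e β⁆ = (z * (D.P.chainBotCoeff α β + 1 : ℕ)) • D.e γ := by
  rcases D.lie_e_e α β γ h with h | h
  · exact ⟨1, by rw [h, one_mul, natCast_zsmul]⟩
  · exact ⟨-1, by rw [h, neg_one_mul, neg_smul, natCast_zsmul]⟩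

section AdjointPower

theorem chainBotCoeff_of_root_eq_add_nsmul {α β γ : ι}
    (hli : LinearIndependent ℤ ![D.P.root α, D.P.root β]) {n : ℕ}
    (hγ : D.P.root γ = D.P.root β + n • D.P.root α) :
    D.P.chainBotCoeff α γ = D.P.chainBotCoeff α β + n := by
  have hli' : LinearIndependent ℤ ![D.P.root α, D.P.root γ] := by
    rw [LinearIndependent.pair_iff] at hli ⊢
    intro s t h
    have := hli (s + t * n) t (by rw [← h, hγ]; simp only [← natCast_zsmul]; module)
    exact ⟨by simpa [this.2] using this.1, this.2⟩
  have htop : n ≤ D.P.chainTopCoeff α β := by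
    rw [← RootPairing.root_add_nsmul_mem_range_iff_le_chainTopCoeff hli, ← hγ]
    exact ⟨γ, rfl⟩
  refine eq_of_forall_le_iff fun m => ?_
  have hsub : D.P.root β + n • D.P.root α - m • D.P.root α =
      D.P.root β + ((n : ℤ) - m) • D.P.root α := by
    simp only [← natCast_zsmul]; module
  rw [← RootPairing.root_sub_nsmul_mem_range_iff_le_chainBotCoeff hli', hγ, hsub,
    RootPairing.root_add_zsmul_mem_range_iff hli, Set.mem_Icc]
  omega

theorem ad_e_pow_e {α β : ι} (hli : LinearIndependent ℤ ![D.P.root α, D.P.root β]) (n : ℕ) :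
    (LieAlgebra.ad K 𝔤 (D.e α) ^ n) (D.e β) = 0 ∨ ∃ (γ : ι) (z : ℤ),
      D.P.root γ = D.P.root β + n • D.P.root α ∧
      (LieAlgebra.ad K 𝔤 (D.e α) ^ n) (D.e β) =
        (z * ((D.P.chainBotCoeff α β + 1).ascFactorial n : ℤ)) • D.e γ := by
  induction n with
  | zero => exact Or.inr ⟨β, 1, by simp, by simp⟩
  | succ n ih =>
    rw [pow_succ', Module.End.mul_apply]
    rcases ih with h | ⟨γ, z, hγ, h⟩
    · exact Or.inl (by rw [h, map_zero])
    rw [h, map_zsmul, LieAlgebra.ad_apply]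
    have hsum : D.P.root α + D.P.root γ = D.P.root β + (n + 1) • D.P.root α := by
      rw [hγ]; module
    by_cases hr : D.P.root α + D.P.root γ ∈ Set.range D.P.root
    · obtain ⟨δ, hδ⟩ := hr
      obtain ⟨z', hz'⟩ := D.exists_lie_e_e_eq hδ.symm
      refine Or.inr ⟨δ, z * z', hδ.trans hsum, ?_⟩
      rw [hz', smul_smul, D.chainBotCoeff_of_root_eq_add_nsmul hli hγ, Nat.ascFactorial_succ]
      congr 1
      push_cast
      ring
    · refine Or.inl ?_
      rw [D.lie_e_e_zero α γ (fun h0 => ?_) hr, smul_zero]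
      have := LinearIndependent.pair_iff.1 hli (n + 1) 1 (by rw [← h0, hsum]; module)
      exact one_ne_zero this.2

variable (p : ℕ) [Fact p.Prime]

theorem ad_e_pow_char_h (α : ι) (x : CartanAlg K Y) :
    (LieAlgebra.ad K 𝔤 (D.e α) ^ p) (D.h x) = 0 :=
  Module.End.pow_map_zero_of_le (Fact.out : p.Prime).two_le <| by
    rw [pow_two, Module.End.mul_apply, LieAlgebra.ad_apply, LieAlgebra.ad_apply, D.lie_e_h, lie_neg,
      lie_smul, lie_self, smul_zero, neg_zero]

variable [CharP K p]

theorem ad_e_pow_char_e_of_linearIndependent {α β : ι}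
    (hli : LinearIndependent ℤ ![D.P.root α, D.P.root β]) :
    (LieAlgebra.ad K 𝔤 (D.e α) ^ p) (D.e β) = 0 := by
  rcases D.ad_e_pow_e hli p with h | ⟨γ, z, -, h⟩
  · exact h
  · have hdvd : p ∣ (D.P.chainBotCoeff α β + 1).ascFactorial p :=
      (Nat.dvd_factorial (NeZero.pos p) le_rfl).trans (Nat.factorial_dvd_ascFactorial _ _)
    rw [h, ← Int.cast_smul_eq_zsmul K, Int.cast_mul, Int.cast_natCast,
      (CharP.cast_eq_zero_iff K p _).2 hdvd, mul_zero, zero_smul]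

theorem ad_e_pow_char_e_of_root_eq_neg {α β : ι} (h : D.P.root β = -D.P.root α) :
    (LieAlgebra.ad K 𝔤 (D.e α) ^ p) (D.e β) = 0 := by
  have ad_sq : (LieAlgebra.ad K 𝔤 (D.e α) ^ 2) (D.e β) = -((2 : K) • D.e α) := by
    rw [pow_two, Module.End.mul_apply, LieAlgebra.ad_apply, LieAlgebra.ad_apply,
      D.lie_e_neg α β h, D.lie_e_h, D.diff_tmul,
      show D.P.toLinearMap (D.P.root α) (D.P.coroot α) = 2 from D.P.root_coroot_two α]
    norm_num
  rcases (Fact.out : p.Prime).two_le.eq_or_lt with rfl | hp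
  · rw [ad_sq, CharTwo.two_eq_zero, zero_smul, neg_zero]
  · have ad_cube : (LieAlgebra.ad K 𝔤 (D.e α) ^ 3) (D.e β) = 0 := by
      rw [pow_succ', Module.End.mul_apply, ad_sq, LieAlgebra.ad_apply, lie_neg, lie_smul, lie_self,
        smul_zero, neg_zero]
    exact Module.End.pow_map_zero_of_le hp ad_cube

theorem ad_e_pow_char_e (α β : ι) : (LieAlgebra.ad K 𝔤 (D.e α) ^ p) (D.e β) = 0 := by
  have _ := D.isReduced
  rcases eq_or_ne α β with rfl | hne
  · exact Module.End.pow_map_zero_of_le (Fact.out : p.Prime).one_le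
      (by rw [pow_one, LieAlgebra.ad_apply, lie_self])
  by_cases hneg : D.P.root α = -D.P.root β
  · exact D.ad_e_pow_char_e_of_root_eq_neg p (by rw [hneg, neg_neg])
  · exact D.ad_e_pow_char_e_of_linearIndependent p
      (RootPairing.IsReduced.linearIndependent D.P hne hneg)

theorem ad_e_pow_char (α : ι) : LieAlgebra.ad K 𝔤 (D.e α) ^ p = 0 := by
  have : (LieAlgebra.ad K 𝔤 (D.e α) ^ p) ∘ₗ
      LinearMap.coprod D.h (Finsupp.linearCombination K D.e) = 0 := by
    refine LinearMap.prod_ext (LinearMap.ext fun x => ?_)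
      (Finsupp.lhom_ext' fun β => LinearMap.ext_ring ?_)
    · simpa using D.ad_e_pow_char_h p α x
    · simpa using D.ad_e_pow_char_e p α β
  exact (LinearMap.cancel_right D.bijective.2).1 (by rw [this, LinearMap.zero_comp])

end AdjointPower

/-- A set of roots is closed if it contains every root which is a sum of two of its members. -/
def IsClosedSet (S : Set ι) : Prop :=
  ∀ α ∈ S, ∀ β ∈ S, ∀ γ, D.P.root α + D.P.root β = D.P.root γ → γ ∈ S

theorem isClosedSet_empty : D.IsClosedSet ∅ := fun _ h => h.elim

theorem isClosedSet_univ : D.IsClosedSet Set.univ := fun _ _ _ _ _ _ => trivial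

theorem exists_root_eq_sum_nonneg {β : ι} (hβ : D.b.IsPos β) :
    ∃ f : ι → ℤ, 0 ≤ f ∧ D.P.root β = ∑ i ∈ D.b.support, f i • D.P.root i := by
  obtain ⟨f, -, hf, hβf⟩ := D.b.exists_root_eq_sum_int β
  refine ⟨f, hf.elim le_of_lt fun hf => ?_, hβf⟩
  rw [RootPairing.Base.isPos_iff, RootPairing.Base.height_eq_sum hβf] at hβ
  exact absurd hβ (not_lt.2 (Finset.sum_nonpos fun i _ => hf.le i))

variable {J : Type*} (y : Module.Basis J K (CartanAlg K Y)) (S : Set ι)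

/-- The basis of `𝔤` formed by the root vectors and a basis of `𝔥`. -/
def chevalleyBasis : Module.Basis (J ⊕ ι) K 𝔤 :=
  (y.prod Finsupp.basisSingleOne).map (LinearEquiv.ofBijective _ D.bijective)

theorem chevalleyBasis_inl (j : J) : D.chevalleyBasis y (Sum.inl j) = D.h (y j) := by
  simp [chevalleyBasis]

theorem chevalleyBasis_inr (α : ι) : D.chevalleyBasis y (Sum.inr α) = D.e α := by
  simp [chevalleyBasis]

/-- The generators of `𝔤_S`: the root vectors of roots in `S` and a basis of `𝔥`. -/
def gen : S ⊕ J → 𝔤 := Sum.elim (fun α => D.e α) (fun j => D.h (y j))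

/-- The weights of the generators of `𝔤_S`. -/
def genWeight (J : Type*) : S ⊕ J → X := Sum.elim (fun α => D.P.root α) (fun _ => 0)

variable {S}

theorem h_mem_span_gen (x : CartanAlg K Y) :
    D.h x ∈ Submodule.span K (D.gen y S '' {i | D.genWeight S J i = 0}) := by
  have hx : x ∈ Submodule.span K (Set.range y) := y.span_eq ▸ Submodule.mem_top
  have hmap := Submodule.mem_map_of_mem (f := D.h) hx
  rw [Submodule.map_span] at hmap
  refine Submodule.span_mono ?_ hmap
  rintro _ ⟨_, ⟨j, rfl⟩, rfl⟩
  exact ⟨Sum.inr j, rfl, rfl⟩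

theorem lie_gen_mem_span (hS : D.IsClosedSet S) (i j : S ⊕ J) :
    ⁅D.gen y S i, D.gen y S j⁆ ∈ Submodule.span K
      (D.gen y S '' {a | D.genWeight S J a = D.genWeight S J i + D.genWeight S J j}) := by
  have e_mem (γ : S) (x : X) (hγ : D.P.root γ = x) :
      D.e γ ∈ Submodule.span K (D.gen y S '' {a | D.genWeight S J a = x}) :=
    Submodule.subset_span ⟨Sum.inl γ, hγ, rfl⟩
  rcases i with α | i <;> rcases j with β | j
  · by_cases h0 : D.P.root α + D.P.root β = 0
    · simp only [gen, genWeight, Sum.elim_inl, h0]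
      rw [D.lie_e_neg α β (eq_neg_of_add_eq_zero_right h0)]
      exact D.h_mem_span_gen y _
    by_cases hr : D.P.root α + D.P.root β ∈ Set.range D.P.root
    · obtain ⟨γ, hγ⟩ := hr
      obtain ⟨z, hz⟩ := D.exists_lie_e_e_eq hγ.symm
      simp only [gen, Sum.elim_inl]
      rw [hz]
      exact zsmul_mem (e_mem ⟨γ, hS α α.2 β β.2 γ hγ.symm⟩ _ hγ) _
    · simp only [gen, Sum.elim_inl]
      rw [D.lie_e_e_zero _ _ h0 hr]
      exact zero_mem _
  · simp only [gen, Sum.elim_inl, Sum.elim_inr, lie_e_h]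
    exact neg_mem (Submodule.smul_mem _ _ (e_mem α _ (add_zero _).symm))
  · simp only [gen, Sum.elim_inl, Sum.elim_inr, lie_h_e_eq_diff]
    exact Submodule.smul_mem _ _ (e_mem β _ (zero_add _).symm)
  · simp only [gen, Sum.elim_inr, D.lie_h_h]
    exact zero_mem _

theorem linearIndependent_gen : LinearIndependent K (D.gen y S) := by
  have hinj : Function.Injective (Sum.elim (Sum.inr ∘ Subtype.val) Sum.inl : S ⊕ J → J ⊕ ι) := by
    rintro (α | i) (β | j) h <;> simp_all [Subtype.ext_iff]
  convert (D.chevalleyBasis y).linearIndependent.comp _ hinj using 1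
  funext i
  rcases i with α | j <;> simp [gen, chevalleyBasis_inl, chevalleyBasis_inr]

end ReductiveLie

namespace StdLevi

variable {K ι X Y 𝔤 : Type*} [Field K] [Finite ι] [AddCommGroup X] [AddCommGroup Y]
  [LieRing 𝔤] [LieAlgebra K 𝔤] {D : ReductiveLie K ι X Y 𝔤} (L : StdLevi D)

theorem exists_coeff_of_mem_ZI {x : X} (hx : x ∈ L.ZI) :
    ∃ a : ι → ℤ, (∀ i ∉ L.I, a i = 0) ∧ x = ∑ i ∈ D.b.support, a i • D.P.root i := by
  classical
  induction hx using AddSubgroup.closure_induction with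
  | mem x hx =>
    obtain ⟨i, hi, rfl⟩ := hx
    refine ⟨Pi.single i 1, fun j hj => Pi.single_eq_of_ne (by rintro rfl; exact hj hi) _, ?_⟩
    have hsupp : i ∈ D.b.support := L.I_subset hi
    simp [Pi.single_apply, ite_smul, hsupp]
  | zero => exact ⟨0, by simp, by simp⟩
  | add x y _ _ hx hy =>
    obtain ⟨a, ha, rfl⟩ := hx
    obtain ⟨c, hc, rfl⟩ := hy
    exact ⟨a + c, fun i hi => by simp [ha i hi, hc i hi], by
      simp [add_smul, Finset.sum_add_distrib]⟩
  | neg x _ hx =>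
    obtain ⟨a, ha, rfl⟩ := hx
    exact ⟨-a, fun i hi => by simp [ha i hi], by simp⟩

theorem root_mem_ZI_of_add_mem {β δ : ι} (hβ : D.b.IsPos β) (hδ : D.b.IsPos δ)
    (h : D.P.root β + D.P.root δ ∈ L.ZI) : D.P.root β ∈ L.ZI := by
  obtain ⟨a, ha, hsum⟩ := L.exists_coeff_of_mem_ZI h
  obtain ⟨f, hf, hβf⟩ := D.exists_root_eq_sum_nonneg hβ
  obtain ⟨g, hg, hδg⟩ := D.exists_root_eq_sum_nonneg hδ
  have hcoeff := linearIndepOn_finset_iff.1 D.b.linearIndepOn_root (fun i => f i + g i - a i) (by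
    simp only [sub_smul, add_smul, Finset.sum_sub_distrib, Finset.sum_add_distrib]
    rw [← hβf, ← hδg, ← hsum, sub_self])
  rw [hβf]
  refine AddSubgroup.sum_mem _ fun i hi => ?_
  by_cases hI : i ∈ L.I
  · have hi : D.P.root i ∈ L.ZI := AddSubgroup.subset_closure ⟨i, hI, rfl⟩
    exact zsmul_mem hi _
  · have hfg := hcoeff i hi
    have hfi := hf i
    have hgi := hg i
    simp only [ha i hI, Pi.zero_apply] at hfg hfi hgi
    rw [show f i = 0 by omega, zero_smul]
    exact zero_mem _

theorem mem_RP_of_add {α β γ : ι} (hα : α ∈ L.RI) (hβ : D.b.IsPos β)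
    (h : D.P.root α + D.P.root β = D.P.root γ) : γ ∈ L.RP := by
  refine or_iff_not_imp_right.2 fun hγ => ?_
  let _ := D.P.indexNeg
  have hneg : D.b.IsPos (-γ) := (RootPairing.Base.IsPos.or_neg D.b γ).resolve_left hγ
  have hsum : D.P.root β + D.P.root (-γ) = -D.P.root α := by
    rw [RootPairing.indexNeg_neg, RootPairing.root_reflectionPerm,
      RootPairing.reflection_apply_self, ← h]
    abel
  have hβI := L.root_mem_ZI_of_add_mem hβ hneg (hsum ▸ neg_mem hα)
  exact h ▸ add_mem hα hβI

theorem isClosedSet_RP : D.IsClosedSet L.RP := by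
  rintro α (hα | hα) β (hβ | hβ) γ h
  · exact Or.inl (by rw [← h]; exact add_mem hα hβ)
  · exact L.mem_RP_of_add hα hβ h
  · exact L.mem_RP_of_add hβ hα (by rw [add_comm, h])
  · exact Or.inr (RootPairing.Base.IsPos.add hα hβ h.symm)

variable {J : Type*} (y : Module.Basis J K (CartanAlg K Y)) {S : Set ι}

theorem gS_toSubmodule (hS : D.IsClosedSet S) :
    (L.gS S).toSubmodule = Submodule.span K (Set.range (D.gen y S)) := by
  have lie_mem (u v : 𝔤) (hu : u ∈ Submodule.span K (Set.range (D.gen y S)))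
      (hv : v ∈ Submodule.span K (Set.range (D.gen y S))) :
      ⁅u, v⁆ ∈ Submodule.span K (Set.range (D.gen y S)) := by
    induction hu, hv using Submodule.span_induction₂ with
    | zero_left => rw [zero_lie]; exact zero_mem _
    | zero_right => rw [lie_zero]; exact zero_mem _
    | add_left _ _ _ _ _ _ h1 h2 => rw [add_lie]; exact add_mem h1 h2
    | add_right _ _ _ _ _ _ h1 h2 => rw [lie_add]; exact add_mem h1 h2
    | smul_left _ _ _ _ _ h => rw [smul_lie]; exact Submodule.smul_mem _ _ h
    | smul_right _ _ _ _ _ h => rw [lie_smul]; exact Submodule.smul_mem _ _ h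
    | mem_mem u v hu hv =>
      obtain ⟨i, rfl⟩ := hu
      obtain ⟨j, rfl⟩ := hv
      exact Submodule.span_mono (Set.image_subset_range _ _) (D.lie_gen_mem_span y hS i j)
  let W : LieSubalgebra K 𝔤 :=
    { Submodule.span K (Set.range (D.gen y S)) with lie_mem' := lie_mem _ _ }
  refine le_antisymm (show L.gS S ≤ W from LieSubalgebra.lieSpan_le.2 ?_) (Submodule.span_le.2 ?_)
  · rintro _ (⟨x, rfl⟩ | ⟨α, hα, rfl⟩)
    · exact Submodule.span_mono (Set.image_subset_range _ _) (D.h_mem_span_gen y x)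
    · exact Submodule.subset_span ⟨Sum.inl ⟨α, hα⟩, rfl⟩
  · rintro _ ⟨α | j, rfl⟩
    · exact (L.eS α.1 α.2).2
    · exact (L.hS S (y j)).2

/-- The basis of `𝔤_S` formed by the root vectors of roots in `S` and a basis of `𝔥`. -/
def genBasis (hS : D.IsClosedSet S) : Module.Basis (S ⊕ J) K (L.gS S) :=
  (Module.Basis.span (D.linearIndependent_gen y)).map
    (LinearEquiv.ofEq _ _ (L.gS_toSubmodule y hS).symm)

theorem coe_genBasis (hS : D.IsClosedSet S) (i : S ⊕ J) :
    (L.genBasis y hS i : 𝔤) = D.gen y S i :=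
  congrArg Subtype.val (Module.Basis.span_apply (D.linearIndependent_gen y) i)

theorem genBasis_inl (hS : D.IsClosedSet S) (α : S) :
    L.genBasis y hS (Sum.inl α) = L.eS α.1 α.2 :=
  Subtype.ext (L.coe_genBasis y hS _)

theorem genBasis_inr (hS : D.IsClosedSet S) (j : J) :
    L.genBasis y hS (Sum.inr j) = L.hS S (y j) :=
  Subtype.ext (L.coe_genBasis y hS _)

theorem lie_genBasis_mem_span (hS : D.IsClosedSet S) (i j : S ⊕ J) :
    ⁅L.genBasis y hS i, L.genBasis y hS j⁆ ∈ Submodule.span K (L.genBasis y hS ''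
      {a | D.genWeight S J a = D.genWeight S J i + D.genWeight S J j}) := by
  have hmap := Submodule.map_span (L.gS S).toSubmodule.subtype (L.genBasis y hS ''
    {a | D.genWeight S J a = D.genWeight S J i + D.genWeight S J j})
  rw [← Set.image_comp] at hmap
  obtain ⟨z, hz, hz_eq⟩ := hmap.ge (x := ⁅D.gen y S i, D.gen y S j⁆)
    (by simpa [Function.comp_def, coe_genBasis] using D.lie_gen_mem_span y hS i j)
  have : z = ⁅L.genBasis y hS i, L.genBasis y hS j⁆ := Subtype.ext <| by
    rw [LieSubalgebra.coe_bracket, coe_genBasis, coe_genBasis, ← hz_eq, Submodule.subtype_apply]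
  exact this ▸ hz

end StdLevi

/-! ### Freeness of the reduced enveloping algebras -/

/-- A basis `E` of an algebra `U` as a right module over an algebra `U₀` which acts through `φ`. -/
structure RightBasis {k U₀ U : Type*} [CommRing k] [Ring U₀] [Ring U] [Algebra k U₀] [Algebra k U]
    (φ : U₀ →ₐ[k] U) (κ : Type*) [Fintype κ] where
  E : κ → U
  bijective : Function.Bijective fun c : κ → U₀ => ∑ i, E i * φ (c i)

namespace RightBasis

variable {k U₀ U κ : Type*} [CommRing k] [Ring U₀] [Ring U] [Algebra k U₀] [Algebra k U]
  {φ : U₀ →ₐ[k] U} [Fintype κ]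

section OfBasis

variable [DecidableEq κ] {Φ : Type*} (b₀ : Module.Basis Φ k U₀) (b : Module.Basis (κ × Φ) k U)

/-- A basis over `k` whose members are the products of `E` with a basis of `U₀`. -/
def ofBasis {E : κ → U} (h : ∀ i f, b (i, f) = E i * φ (b₀ f)) : RightBasis φ κ where
  E := E
  bijective := by
    have heq : ⇑((Pi.basis fun _ : κ => b₀).equiv b (Equiv.sigmaEquivProd κ Φ)) =
        fun c => ∑ i, E i * φ (c i) := by
      let F : (κ → U₀) →ₗ[k] U :=
        ∑ i, LinearMap.mulLeft k (E i) ∘ₗ φ.toLinearMap ∘ₗ LinearMap.proj i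
      have hF :
          ((Pi.basis fun _ : κ => b₀).equiv b (Equiv.sigmaEquivProd κ Φ)).toLinearMap = F := by
        refine (Pi.basis fun _ : κ => b₀).ext fun ⟨i, f⟩ => ?_
        rw [LinearEquiv.coe_coe, Module.Basis.equiv_apply]
        simp [F, h, Pi.basis_apply, Pi.single_apply, apply_ite φ]
      funext c
      simpa [F] using LinearMap.congr_fun hF c
    exact heq ▸ LinearEquiv.bijective _

end OfBasis

/-- Changing the index set of a basis over `U₀`. -/
def reindex {κ' : Type*} [Fintype κ'] (B : RightBasis φ κ) (e : κ ≃ κ') : RightBasis φ κ' where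
  E := B.E ∘ e.symm
  bijective := by
    have heq : (fun c : κ' → U₀ => ∑ i, (B.E ∘ e.symm) i * φ (c i)) =
        (fun c => ∑ i, B.E i * φ (c i)) ∘ (Equiv.arrowCongr e (Equiv.refl U₀)).symm :=
      funext fun c => (Fintype.sum_equiv e _ _ (by simp)).symm
    exact heq ▸ B.bijective.comp (Equiv.bijective _)

variable (B : RightBasis φ κ)

/-- The coordinates with respect to a basis over `U₀`. -/
def coord : U ≃ₗ[k] (κ → U₀) :=
  (LinearEquiv.ofBijective
    (∑ i, LinearMap.mulLeft k (B.E i) ∘ₗ φ.toLinearMap ∘ₗ LinearMap.proj i : (κ → U₀) →ₗ[k] U)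
    (by simpa [Function.Bijective, Function.Injective, Function.Surjective] using B.bijective)).symm

theorem coord_symm_apply (c : κ → U₀) : B.coord.symm c = ∑ i, B.E i * φ (c i) := by
  simp [coord]

theorem sum_coord (u : U) : ∑ i, B.E i * φ (B.coord u i) = u := by
  rw [← coord_symm_apply, LinearEquiv.symm_apply_apply]

theorem coord_mul_map (u : U) (a : U₀) : B.coord (u * φ a) = fun i => B.coord u i * a := by
  rw [← LinearEquiv.eq_symm_apply, coord_symm_apply]
  conv_lhs => rw [← B.sum_coord u]
  simp [Finset.sum_mul, mul_assoc]

theorem coord_mul (u v : U) (i : κ) :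
    B.coord (u * v) i = ∑ j, B.coord (u * B.E j) i * B.coord v j := by
  conv_lhs => rw [← B.sum_coord v, Finset.mul_sum, map_sum, Finset.sum_apply]
  simp_rw [← mul_assoc, coord_mul_map]

theorem coord_E_mul_map [DecidableEq κ] (i : κ) (a : U₀) :
    B.coord (B.E i * φ a) = Pi.single i a := by
  rw [← LinearEquiv.eq_symm_apply, coord_symm_apply]
  simp [Pi.single_apply, apply_ite φ]

theorem coord_E [DecidableEq κ] (i : κ) : B.coord (B.E i) = Pi.single i 1 := by
  simpa using B.coord_E_mul_map i 1

theorem coord_eq_zero_of_mem_span {s : Set κ} {u : U} (hu : u ∈ Submodule.span k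
    (Set.image2 (fun i a => B.E i * φ a) s Set.univ)) {i : κ} (hi : i ∉ s) : B.coord u i = 0 := by
  classical
  induction hu using Submodule.span_induction with
  | mem u hu =>
    obtain ⟨j, hj, a, -, rfl⟩ := hu
    rw [coord_E_mul_map, Pi.single_eq_of_ne (by rintro rfl; exact hi hj)]
  | zero => simp
  | add u v _ _ hu hv => simp [hu, hv]
  | smul c u _ hu => simp [hu]

/-- The matrices of the left multiplications. -/
def leftMulMatrix [DecidableEq κ] : U →ₐ[k] Matrix κ κ U₀ :=
  AlgHom.ofLinearMap
    { toFun := fun u => Matrix.of fun i j => B.coord (u * B.E j) i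
      map_add' := fun u v => by ext; simp [add_mul]
      map_smul' := fun c u => by ext; simp }
    (by ext i j; simp [coord_E, Matrix.one_apply, Pi.single_apply])
    (fun u v => by
      ext i j
      simp only [LinearMap.coe_mk, AddHom.coe_mk, Matrix.of_apply, Matrix.mul_apply]
      rw [mul_assoc, coord_mul])

end RightBasis

namespace PBW

section SumIndex

variable {k A B : Type*} [CommRing k] {p : ℕ} {T : Set B}

/-- Exponents on a disjoint union which are truncated on the whole of the first summand. -/
def truncExpSum : (A → Fin p) × TruncExp p T ≃ TruncExp p (Set.range Sum.inl ∪ Sum.inr '' T :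
    Set (A ⊕ B)) where
  toFun gf := ⟨Sum.elim (fun a => gf.1 a) gf.2.1, by
    rintro _ (⟨a, rfl⟩ | ⟨b, hb, rfl⟩)
    · exact (gf.1 a).2
    · exact gf.2.2 b hb⟩
  invFun f := (fun a => ⟨f.1 (Sum.inl a), f.2 _ (Or.inl ⟨a, rfl⟩)⟩,
    ⟨f.1 ∘ Sum.inr, fun b hb => f.2 _ (Or.inr ⟨b, hb, rfl⟩)⟩)
  left_inv _ := rfl
  right_inv f := Subtype.ext (Sum.elim_comp_inl_inr f.1)

theorem monomial_truncExpSum {R : Type*} [Monoid R] (x : A ⊕ B → R) (l₁ : List A) (l₂ : List B)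
    (g : A → Fin p) (f : TruncExp p T) :
    monomial x (l₁.map Sum.inl ++ l₂.map Sum.inr) (truncExpSum (g, f)).1 =
      monomial (x ∘ Sum.inl) l₁ (fun a => g a) * monomial (x ∘ Sum.inr) l₂ f.1 := by
  rw [monomial_append, monomial_map, monomial_map]
  rfl

theorem degree_truncExpSum {Γ : Type*} [AddCommMonoid Γ] {d : A ⊕ B → Γ}
    (hd : ∀ i, d (Sum.inr i) = 0) (l₁ : List A) (l₂ : List B) (g : A → Fin p) (f : TruncExp p T) :
    degree d (l₁.map Sum.inl ++ l₂.map Sum.inr) (truncExpSum (g, f)).1 =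
      degree (d ∘ Sum.inl) l₁ (fun a => g a) := by
  have h₂ : degree (d ∘ Sum.inr) l₂ f.1 = 0 := by simp [degree, hd]
  rw [degree_append, degree_map, degree_map]
  exact (congrArg _ h₂).trans (add_zero _)

theorem word_mem_span_monomial_mul [NeZero p] {R R₀ Γ : Type*} [Ring R] [Algebra k R] [Ring R₀]
    [Algebra k R₀] [AddCommMonoid Γ] (c : A ⊕ B → k) {x : A ⊕ B → R} {d : A ⊕ B → Γ}
    (hcomm : ∀ i j, x i * x j - x j * x i ∈ Submodule.span k (x '' {a | d a = d i + d j}))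
    (hx : ∀ i ∈ (Set.range Sum.inl ∪ Sum.inr '' T : Set (A ⊕ B)), x i ^ p = algebraMap k R (c i))
    (hd : ∀ i ∈ (Set.range Sum.inl ∪ Sum.inr '' T : Set (A ⊕ B)), c i ≠ 0 → p • d i = 0)
    (hd₀ : ∀ i, d (Sum.inr i) = 0) {φ : R₀ →ₐ[k] R} {x₀ : B → R₀}
    (hφ : ∀ i, φ (x₀ i) = x (Sum.inr i)) {l₁ : List A} {l₂ : List B}
    (hl : (l₁.map Sum.inl ++ l₂.map Sum.inr : List (A ⊕ B)).Nodup)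
    (hmem : ∀ i, i ∈ (l₁.map Sum.inl ++ l₂.map Sum.inr : List (A ⊕ B))) (m : List (A ⊕ B)) :
    (m.map x).prod ∈ Submodule.span k (Set.image2
      (fun (g : A → Fin p) u => monomial (x ∘ Sum.inl) l₁ (fun a => g a) * φ u)
      {g | degree (d ∘ Sum.inl) l₁ (fun a => g a) = (m.map d).sum} Set.univ) := by
  refine Submodule.span_mono ?_ (word_mem_span_truncated c hcomm hx hd hl hmem m)
  rintro _ ⟨f, hf, rfl⟩
  obtain ⟨⟨g, f⟩, rfl⟩ := truncExpSum.surjective f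
  rw [Set.mem_ofPred_eq, degree_truncExpSum hd₀] at hf
  refine ⟨g, hf, monomial x₀ l₂ f.1, trivial, ?_⟩
  simp only [map_monomial, hφ, monomial_truncExpSum, Function.comp_def]

variable {U₀ U : Type*} [Ring U₀] [Ring U] [Algebra k U₀] [Algebra k U] {φ : U₀ →ₐ[k] U}
  [Fintype A] [DecidableEq A] {l₁ : List A} {l₂ : List B} {x : A ⊕ B → U} {x₀ : B → U₀}

/-- The right basis formed by the truncated monomials in the generators outside `U₀`. -/
def monomialRightBasis (hφ : ∀ i, φ (x₀ i) = x (Sum.inr i))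
    (b₀ : Module.Basis (TruncExp p T) k U₀) (hb₀ : ∀ f, b₀ f = monomial x₀ l₂ f.1)
    (b : Module.Basis (TruncExp p (Set.range Sum.inl ∪ Sum.inr '' T : Set (A ⊕ B))) k U)
    (hb : ∀ f, b f = monomial x (l₁.map Sum.inl ++ l₂.map Sum.inr) f.1) :
    RightBasis φ (A → Fin p) :=
  .ofBasis b₀ (b.reindex truncExpSum.symm) (E := fun g => monomial (x ∘ Sum.inl) l₁ fun a => g a)
    fun g f => by
      rw [Module.Basis.reindex_apply, Equiv.symm_symm, hb, monomial_truncExpSum, hb₀, map_monomial]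
      simp only [hφ, Function.comp_def]

end SumIndex

section ReducedBasis

attribute [local instance] LieRing.ofAssociativeRing

open UniversalEnvelopingAlgebra (ι)

variable {k 𝔩 I : Type*} [LieRing 𝔩]

theorem mkAlgHom_ι_comm_mem_span [CommRing k] [LieAlgebra k 𝔩] {Γ : Type*} [Add Γ] {y : I → 𝔩}
    {d : I → Γ} (hd : ∀ i j, ⁅y i, y j⁆ ∈ Submodule.span k (y '' {a | d a = d i + d j}))
    (r : UniversalEnvelopingAlgebra k 𝔩 → UniversalEnvelopingAlgebra k 𝔩 → Prop) (i j : I) :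
    RingQuot.mkAlgHom k r (ι k (y i)) * RingQuot.mkAlgHom k r (ι k (y j)) -
      RingQuot.mkAlgHom k r (ι k (y j)) * RingQuot.mkAlgHom k r (ι k (y i)) ∈
      Submodule.span k ((fun i => RingQuot.mkAlgHom k r (ι k (y i))) '' {a | d a = d i + d j}) := by
  rw [← map_mul (RingQuot.mkAlgHom k r), ← map_mul (RingQuot.mkAlgHom k r), ← map_sub,
    ι_mul_sub_mul]
  have := Submodule.mem_map_of_mem (f := (RingQuot.mkAlgHom k r).toLinearMap)
    (ι_mem_span_image (hd i j))
  rwa [Submodule.map_span, ← Set.image_comp] at this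

theorem adjoin_range_mkAlgHom_ι [CommRing k] [LieAlgebra k 𝔩] {y : I → 𝔩}
    (hy : Submodule.span k (Set.range y) = ⊤)
    (r : UniversalEnvelopingAlgebra k 𝔩 → UniversalEnvelopingAlgebra k 𝔩 → Prop) :
    Algebra.adjoin k (Set.range fun i => RingQuot.mkAlgHom k r (ι k (y i))) = ⊤ := by
  have := congrArg (Subalgebra.map (RingQuot.mkAlgHom k r)) (adjoin_range_ι_of_span hy)
  rwa [AlgHom.map_adjoin, ← Set.range_comp, Algebra.map_top,
    (AlgHom.range_eq_top _).2 (RingQuot.mkAlgHom_surjective k r)] at this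

variable [Field k] [LieAlgebra k 𝔩] {p : ℕ} [Fact p.Prime] [CharP k p]
  (b : Module.Basis I k 𝔩) {T : Set I} (c : I → k)
  {r : UniversalEnvelopingAlgebra k 𝔩 → UniversalEnvelopingAlgebra k 𝔩 → Prop} {l : List I}

/-- The basis of truncated monomials of a reduced enveloping algebra. -/
def reducedBasis (hT : ∀ i ∈ T, ∀ y, (LieAlgebra.ad k 𝔩 (b i) ^ p) y = 0)
    (hr : ∀ u v, r u v ↔ ∃ i ∈ T, u = ι k (b i) ^ p ∧ v = algebraMap k _ (c i))
    (hl : l.Nodup) (hmem : ∀ i, i ∈ l) : Module.Basis (TruncExp p T) k (RingQuot r) :=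
  Module.Basis.mk
    (linearIndependent_truncated c (fun f => monomialBasis_apply b hl hmem f) hl (fun i _ => hmem i)
      (fun i hi => commute_pow_ι (hT i hi)) fun u v => (hr u v).1)
    (span_truncated_eq_top c
      (fun i j => by
        simpa using mkAlgHom_ι_comm_mem_span (d := fun _ => ()) (by simp) r i j)
      (adjoin_range_mkAlgHom_ι b.span_eq r)
      (fun i hi => by
        rw [← map_pow, RingQuot.mkAlgHom_rel k ((hr _ _).2 ⟨i, hi, rfl, rfl⟩), AlgHom.commutes])
      hl hmem).ge

theorem reducedBasis_apply (hT : ∀ i ∈ T, ∀ y, (LieAlgebra.ad k 𝔩 (b i) ^ p) y = 0)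
    (hr : ∀ u v, r u v ↔ ∃ i ∈ T, u = ι k (b i) ^ p ∧ v = algebraMap k _ (c i))
    (hl : l.Nodup) (hmem : ∀ i, i ∈ l) (f : TruncExp p T) :
    reducedBasis b c hT hr hl hmem f =
      monomial (fun i => RingQuot.mkAlgHom k r (ι k (b i))) l f.1 := by
  simp [reducedBasis]

end ReducedBasis

end PBW

namespace PBW

variable {A B : Type*} [Fintype A] [Fintype B]

theorem nodup_toList_sum : ((Finset.univ : Finset A).toList.map Sum.inl ++
    (Finset.univ : Finset B).toList.map Sum.inr : List (A ⊕ B)).Nodup := by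
  refine List.Nodup.append ((Finset.nodup_toList _).map Sum.inl_injective)
    ((Finset.nodup_toList _).map Sum.inr_injective) ?_
  simp [List.disjoint_left]

theorem mem_toList_sum (i : A ⊕ B) : i ∈ ((Finset.univ : Finset A).toList.map Sum.inl ++
    (Finset.univ : Finset B).toList.map Sum.inr : List (A ⊕ B)) := by
  rcases i with a | b <;> simp

end PBW

namespace StdLevi

open PBW

attribute [local instance] LieRing.ofAssociativeRing

variable {K ι X Y 𝔤 : Type*} [Field K] [Finite ι] [AddCommGroup X] [AddCommGroup Y]
  [LieRing 𝔤] [LieAlgebra K 𝔤] {D : ReductiveLie K ι X Y 𝔤} (L : StdLevi D) (p : ℕ) {S T : Set ι}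

/-- The root vectors in `U_S`. -/
abbrev rootVec (α : S) : L.US p S := L.toUS p S (L.eS α.1 α.2)

theorem rootVec_pow (α : S) : L.rootVec p α ^ p = algebraMap K _ (L.χ (D.e α) ^ p) := by
  have := RingQuot.mkAlgHom_rel K (URel.pow (L := L) (p := p) α.1 α.2)
  rwa [map_pow, AlgHom.commutes] at this

theorem inclUS_toUS (hST : S ⊆ T) (x : L.gS S) :
    L.inclUS p hST (L.toUS p S x) = L.toUS p T (LieSubalgebra.inclusion (L.gS_mono hST) x) := by
  rw [inclUS, toUS, RingQuot.liftAlgHom_mkAlgHom_apply, AlgHom.comp_apply,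
    UniversalEnvelopingAlgebra.lift_ι_apply]
  rfl

theorem ad_eS_pow_char [Fact p.Prime] [CharP K p] (α : S) (x : L.gS S) :
    (LieAlgebra.ad K (L.gS S) (L.eS α.1 α.2) ^ p) x = 0 :=
  Subtype.ext <| (WGrading.pow_comm (L.gS S).toSubmodule.subtype _ (LieAlgebra.ad K 𝔤 (D.e α))
    (fun _ => rfl) p x).trans (LinearMap.congr_fun (D.ad_e_pow_char p α) _)

theorem uRel_iff {I : Type*} {b : I → L.gS S} {R : Set I}
    (hR : b '' R = Set.range fun α : S => L.eS α.1 α.2)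
    (u v : UniversalEnvelopingAlgebra K (L.gS S)) :
    L.URel p S u v ↔ ∃ i ∈ R, u = UniversalEnvelopingAlgebra.ι K (b i) ^ p ∧
      v = algebraMap K _ (L.χ (b i : 𝔤) ^ p) := by
  constructor
  · rintro ⟨α, hα⟩
    obtain ⟨i, hi, hiα⟩ := hR.ge ⟨⟨α, hα⟩, rfl⟩
    exact ⟨i, hi, by rw [hiα], by rw [hiα]; rfl⟩
  · rintro ⟨i, hi, rfl, rfl⟩
    obtain ⟨α, hα⟩ := hR.le ⟨i, hi, rfl⟩
    rw [← hα]
    exact URel.pow α.1 α.2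

theorem toUS_pow_of_image_eq {I : Type*} {b : I → L.gS S} {R : Set I}
    (hR : b '' R = Set.range fun α : S => L.eS α.1 α.2) {i : I} (hi : i ∈ R) :
    L.toUS p S (b i) ^ p = algebraMap K _ (L.χ (b i : 𝔤) ^ p) := by
  obtain ⟨α, hα⟩ := hR.le ⟨i, hi, rfl⟩
  rw [← hα]
  exact L.rootVec_pow p α

section Basis

variable [Fact p.Prime] [CharP K p] {I : Type*} {l : List I}

/-- The monomials in a basis `b` of `𝔤_S` which are truncated at the indices of the root vectors
form a basis of `U_S`. -/
def usBasis (b : Module.Basis I K (L.gS S)) {R : Set I}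
    (hR : b '' R = Set.range fun α : S => L.eS α.1 α.2) (hl : l.Nodup) (hmem : ∀ i, i ∈ l) :
    Module.Basis (TruncExp p R) K (L.US p S) :=
  reducedBasis b (fun i => L.χ (b i : 𝔤) ^ p)
    (fun i hi x => by
      obtain ⟨α, hα⟩ := hR.le ⟨i, hi, rfl⟩
      rw [← hα]
      exact L.ad_eS_pow_char p α x)
    (L.uRel_iff p hR) hl hmem

theorem usBasis_apply (b : Module.Basis I K (L.gS S)) {R : Set I}
    (hR : b '' R = Set.range fun α : S => L.eS α.1 α.2) (hl : l.Nodup) (hmem : ∀ i, i ∈ l)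
    (f : TruncExp p R) :
    L.usBasis p b hR hl hmem f = monomial (fun i => L.toUS p S (b i)) l f.1 :=
  reducedBasis_apply ..

end Basis

section RelativeBasis

variable {J : Type*} (y : Module.Basis J K (CartanAlg K Y))

open Classical in
/-- Splits the index set of the generators of `𝔤_S` into the roots outside of `T` and the index set
of the generators of `𝔤_T`. -/
def diffSumEquiv (hTS : T ⊆ S) (J : Type*) : ↥(S \ T) ⊕ (T ⊕ J) ≃ S ⊕ J :=
  (Equiv.sumAssoc _ _ _).symm.trans
    (((Equiv.sumComm _ _).trans (Equiv.Set.sumDiffSubset hTS)).sumCongr (Equiv.refl J))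

/-- The basis of `𝔤_S` in which the basis elements outside of `𝔤_T` come first. -/
def relGenBasis (hS : D.IsClosedSet S) (hTS : T ⊆ S) :
    Module.Basis (↥(S \ T) ⊕ (T ⊕ J)) K (L.gS S) :=
  (L.genBasis y hS).reindex (diffSumEquiv hTS J).symm

variable (hS : D.IsClosedSet S) (hTS : T ⊆ S)

theorem relGenBasis_inl (α : ↥(S \ T)) :
    L.relGenBasis y hS hTS (Sum.inl α) = L.eS α.1 α.2.1 := by
  simp [relGenBasis, diffSumEquiv, genBasis_inl]

theorem relGenBasis_inr (hT : D.IsClosedSet T) (i : T ⊕ J) : L.relGenBasis y hS hTS (Sum.inr i) =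
    LieSubalgebra.inclusion (L.gS_mono hTS) (L.genBasis y hT i) := by
  rcases i with α | j
  · simp [relGenBasis, diffSumEquiv, genBasis_inl]
    rfl
  · simp [relGenBasis, diffSumEquiv, genBasis_inr]
    rfl

theorem genBasis_image_range_inl :
    L.genBasis y hS '' Set.range Sum.inl = Set.range fun α : S => L.eS α.1 α.2 := by
  rw [← Set.range_comp]
  exact congrArg Set.range (funext fun α => L.genBasis_inl y hS α)

theorem relGenBasis_image (hT : D.IsClosedSet T) :
    L.relGenBasis y hS hTS '' (Set.range Sum.inl ∪ Sum.inr '' Set.range Sum.inl) =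
      Set.range fun α : S => L.eS α.1 α.2 := by
  ext z
  simp only [Set.image_union, Set.mem_union, Set.mem_image, Set.mem_range, exists_exists_eq_and,
    L.relGenBasis_inl, L.relGenBasis_inr y hS hTS hT, genBasis_inl]
  constructor
  · rintro (⟨α, rfl⟩ | ⟨α, rfl⟩)
    · exact ⟨⟨α, α.2.1⟩, rfl⟩
    · exact ⟨⟨α, hTS α.2⟩, rfl⟩
  · rintro ⟨α, rfl⟩
    by_cases hα : α.1 ∈ T
    · exact Or.inr ⟨⟨α, hα⟩, rfl⟩
    · exact Or.inl ⟨⟨α, α.2, hα⟩, rfl⟩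

theorem lie_relGenBasis_mem_span (i j : ↥(S \ T) ⊕ (T ⊕ J)) :
    ⁅L.relGenBasis y hS hTS i, L.relGenBasis y hS hTS j⁆ ∈ Submodule.span K
      (L.relGenBasis y hS hTS '' {a | D.genWeight S J (diffSumEquiv hTS J a) =
        D.genWeight S J (diffSumEquiv hTS J i) + D.genWeight S J (diffSumEquiv hTS J j)}) := by
  simp only [relGenBasis, Module.Basis.reindex_apply, Equiv.symm_symm]
  refine Submodule.span_mono ?_ (L.lie_genBasis_mem_span y hS _ _)
  rintro _ ⟨a, ha, rfl⟩
  exact ⟨(diffSumEquiv hTS J).symm a, by simpa using ha, by simp⟩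

end RelativeBasis

section RightBasis

variable [DecidableEq ι] [Fact p.Prime] [CharP K p] [Module.Finite ℤ Y]

/-- `U_S` is a free right module over `U_T` on the truncated monomials in the `e_α`, `α ∈ S \ T`. -/
def rightBasis [Fintype ↥(S \ T)] (hS : D.IsClosedSet S) (hT : D.IsClosedSet T) (hTS : T ⊆ S) :
    RightBasis (L.inclUS p hTS) (↥(S \ T) → Fin p) :=
  let y := Module.finBasis K (CartanAlg K Y)
  let _ := Fintype.ofFinite T
  monomialRightBasis (l₁ := Finset.univ.toList) (l₂ := Finset.univ.toList)
    (x := fun i => L.toUS p S (L.relGenBasis y hS hTS i))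
    (fun i => (L.inclUS_toUS p hTS _).trans
      (congrArg _ (L.relGenBasis_inr y hS hTS hT i).symm))
    (L.usBasis p _ (L.genBasis_image_range_inl y hT) (Finset.nodup_toList _)
      fun i => Finset.mem_toList.2 (Finset.mem_univ i))
    (L.usBasis_apply p _ _ _ _)
    (L.usBasis p _ (L.relGenBasis_image y hS hTS hT) nodup_toList_sum mem_toList_sum)
    (L.usBasis_apply p _ _ _ _)

theorem rightBasis_E [Fintype ↥(S \ T)] (hS : D.IsClosedSet S) (hT : D.IsClosedSet T)
    (hTS : T ⊆ S) (g : ↥(S \ T) → Fin p) : (L.rightBasis p hS hT hTS).E g =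
      monomial (fun α => L.rootVec p (Set.inclusion Set.sdiff_subset α)) Finset.univ.toList
        fun α => g α := by
  simp only [rightBasis, monomialRightBasis, RightBasis.ofBasis, Function.comp_def,
    relGenBasis_inl, Set.inclusion]

end RightBasis

theorem nsmul_wt_root_eq_zero [CharP K p] {α : ι} (h : L.χ (D.e α) ≠ 0) :
    p • L.wt (D.P.root α) = 0 := by
  have hα : D.P.root α ∈ L.ZI := by
    let _ := D.P.indexNeg
    have hpos : D.b.IsPos (-α) :=
      (RootPairing.Base.IsPos.or_neg D.b α).resolve_left fun hp => h (L.χ_pos α hp)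
    have hroot : D.P.root α = -D.P.root (-α) := by simp
    have hI : -α ∈ L.I := by_contra fun hI => h (L.χ_neg_not_mem (-α) α hpos hroot hI)
    exact hroot ▸ neg_mem (AddSubgroup.subset_closure ⟨-α, hI, rfl⟩)
  rw [← map_nsmul]
  refine Subtype.ext (Prod.ext ((QuotientAddGroup.eq_zero_iff _).2 (nsmul_mem hα p)) ?_)
  change D.diff (p • D.P.root α) = 0
  rw [map_nsmul, ← Nat.cast_smul_eq_nsmul K, CharP.cast_eq_zero, zero_smul]

/-- The weight of a product of root vectors. -/
def wordWt (l : List S) : L.Wt := (l.map fun α : S => L.wt (D.P.root α)).sum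

/-- A basis of `U_S` as a right module over `U_∅ = U(𝔥)` which consists of products of root vectors
and with respect to which all products of root vectors are homogeneous. -/
structure HomogeneousBasis (S : Set ι) where
  n : ℕ
  word : Fin n → List S
  basis : RightBasis (L.inclUS p (Set.empty_subset S)) (Fin n)
  E_eq : ∀ i, basis.E i = ((word i).map (L.rootVec p)).prod
  word_mem_span : ∀ l : List S, (l.map (L.rootVec p)).prod ∈ Submodule.span K (Set.image2
    (fun k u => basis.E k * L.inclUS p (Set.empty_subset S) u)
    {k | L.wordWt (word k) = L.wordWt l} Set.univ)

section Homogeneous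

variable [DecidableEq ι] [Fact p.Prime] [CharP K p] [Module.Finite ℤ Y] [Fintype ↥(S \ ∅)]

theorem word_mem_span_rightBasis (hS : D.IsClosedSet S) (m : List ↥(S \ ∅)) :
    (m.map fun α => L.rootVec p (Set.inclusion Set.sdiff_subset α)).prod ∈ Submodule.span K
      (Set.image2 (fun g u => (L.rightBasis p hS D.isClosedSet_empty (Set.empty_subset S)).E g *
          L.inclUS p (Set.empty_subset S) u)
        {g | degree (fun α : ↥(S \ ∅) => L.wt (D.P.root α)) Finset.univ.toList (fun α => g α) =
          (m.map fun α : ↥(S \ ∅) => L.wt (D.P.root α)).sum} Set.univ) := by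
  let y := Module.finBasis K (CartanAlg K Y)
  let e := diffSumEquiv (Set.empty_subset S) (Fin (Module.finrank K (CartanAlg K Y)))
  let b := L.relGenBasis y hS (Set.empty_subset S)
  let d i := L.wt (D.genWeight S _ (e i))
  have hd_inl (α : ↥(S \ ∅)) : d (Sum.inl α) = L.wt (D.P.root α) := by
    simp [d, e, diffSumEquiv, ReductiveLie.genWeight]
  have hd_inr (i) : d (Sum.inr i) = 0 := by
    rcases i with α | j
    · exact α.2.elim
    · simp [d, e, diffSumEquiv, ReductiveLie.genWeight]
  have hR := L.relGenBasis_image y hS (Set.empty_subset S) D.isClosedSet_empty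
  have hspan := word_mem_span_monomial_mul (p := p) (fun i => L.χ (b i : 𝔤) ^ p) (d := d)
    (mkAlgHom_ι_comm_mem_span (d := d) (fun i j => Submodule.span_mono
      (Set.image_mono fun a ha => (congrArg L.wt ha).trans (map_add _ _ _))
      (L.lie_relGenBasis_mem_span y hS (Set.empty_subset S) i j)) (L.URel p S))
    (fun i hi => L.toUS_pow_of_image_eq p hR hi)
    (by
      rintro _ (⟨α, rfl⟩ | ⟨_, ⟨α, rfl⟩, rfl⟩) hc
      · rw [hd_inl]
        refine L.nsmul_wt_root_eq_zero p fun h0 => hc ?_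
        simp [b, relGenBasis_inl, eS, h0, (Fact.out : p.Prime).ne_zero]
      · exact α.2.elim)
    hd_inr (fun i => (L.inclUS_toUS p (Set.empty_subset S) _).trans
      (congrArg _ (L.relGenBasis_inr y hS (Set.empty_subset S) D.isClosedSet_empty i).symm))
    nodup_toList_sum mem_toList_sum (m.map Sum.inl)
  simp only [List.map_map, Function.comp_def, hd_inl, relGenBasis_inl] at hspan
  simp only [rightBasis_E]
  exact hspan

end Homogeneous

theorem nonempty_homogeneousBasis [Fact p.Prime] [CharP K p] [Module.Finite ℤ Y]
    (hS : D.IsClosedSet S) : Nonempty (L.HomogeneousBasis p S) := by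
  classical
  let _ := Fintype.ofFinite ↥(S \ ∅)
  let j : ↥(S \ ∅) → S := Set.inclusion Set.sdiff_subset
  let word (g : ↥(S \ ∅) → Fin p) : List ↥(S \ ∅) :=
    (Finset.univ.toList.map fun α => List.replicate (g α) α).flatten
  have hword (g) : (L.rightBasis p hS D.isClosedSet_empty (Set.empty_subset S)).E g =
      ((word g).map fun α => L.rootVec p (j α)).prod := by
    rw [rightBasis_E, monomial_eq_prod_map_flatten]
  have hdegree (g) : L.wordWt ((word g).map j) =
      degree (fun α : ↥(S \ ∅) => L.wt (D.P.root α)) Finset.univ.toList fun α => g α := by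
    rw [wordWt, List.map_map, ← sum_map_flatten]
    rfl
  let ε := Fintype.equivFin (↥(S \ ∅) → Fin p)
  refine ⟨⟨_, fun i => (word (ε.symm i)).map j,
    (L.rightBasis p hS D.isClosedSet_empty (Set.empty_subset S)).reindex ε, fun i => ?_,
    fun l => ?_⟩⟩
  · rw [List.map_map]
    exact hword (ε.symm i)
  · have hspan := L.word_mem_span_rightBasis p hS
      (l.map fun α : S => ⟨α, Set.mem_sdiff_of_mem α.2 (Set.notMem_empty _)⟩)
    rw [List.map_map, List.map_map] at hspan
    refine Submodule.span_mono ?_ hspan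
    rintro _ ⟨g, hg, u, -, rfl⟩
    refine ⟨ε g, ?_, u, trivial, by simp [RightBasis.reindex]⟩
    rw [Set.mem_ofPred_eq, Equiv.symm_apply_apply, hdegree, hg]
    rfl

end StdLevi

namespace StdLevi

attribute [local instance] LieRing.ofAssociativeRing

variable {K ι X Y 𝔤 : Type*} [Field K] [Finite ι] [AddCommGroup X] [AddCommGroup Y]
  [LieRing 𝔤] [LieAlgebra K 𝔤] {D : ReductiveLie K ι X Y 𝔤} (L : StdLevi D) {p : ℕ} {S : Set ι}

theorem US_induction {C : L.US p S → Prop} (algebraMap : ∀ c : K, C (algebraMap K _ c))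
    (toUS : ∀ x, C (L.toUS p S x)) (add : ∀ u v, C u → C v → C (u + v))
    (mul : ∀ u v, C u → C v → C (u * v)) (u : L.US p S) : C u := by
  have hu : u ∈ Algebra.adjoin K (Set.range (L.toUS p S)) := by
    have := PBW.adjoin_range_mkAlgHom_ι (y := (id : L.gS S → L.gS S)) (by simp) (L.URel p S)
    exact this ▸ Algebra.mem_top
  induction hu using Algebra.adjoin_induction with
  | mem u hu =>
    obtain ⟨x, rfl⟩ := hu
    exact toUS x
  | algebraMap c => exact algebraMap c
  | add u v _ _ hu hv => exact add u v hu hv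
  | mul u v _ _ hu hv => exact mul u v hu hv

theorem toUS_add (x y : L.gS S) : L.toUS p S (x + y) = L.toUS p S x + L.toUS p S y := by
  rw [toUS, map_add, map_add]
  rfl

theorem toUS_smul (c : K) (x : L.gS S) : L.toUS p S (c • x) = c • L.toUS p S x := by
  rw [toUS, map_smul, map_smul]
  rfl

theorem toUS_lie (x y : L.gS S) :
    L.toUS p S ⁅x, y⁆ = L.toUS p S x * L.toUS p S y - L.toUS p S y * L.toUS p S x := by
  rw [toUS, LieHom.map_lie, LieRing.of_associative_ring_bracket, map_sub, map_mul, map_mul]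
  rfl

end StdLevi

/-! ### Induced objects -/

namespace CMod

variable {K : Type u} {ι X Y 𝔤 : Type*} [Field K] [Finite ι] [AddCommGroup X] [AddCommGroup Y]
  [LieRing 𝔤] [LieAlgebra K 𝔤] {D : ReductiveLie K ι X Y 𝔤}
  {p : ℕ} {L : StdLevi D} {S T : Set ι} {A : Type u} [CommRing A] [Algebra K A]
  {π : CartanAlg K Y →ₗ[K] A}

attribute [local instance] LieRing.ofAssociativeRing in
theorem act_toUS (M : CMod p L S A π) (x : L.gS S) : M.act (L.toUS p S x) = M.ρ x := by
  let _ : Algebra K (Module.End A M) :=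
    ((algebraMap A (Module.End A M)).comp (algebraMap K A)).toAlgebra' fun c f => by
      ext m; simp
  exact (RingQuot.liftAlgHom_mkAlgHom_apply K _ _ _).trans
    (UniversalEnvelopingAlgebra.lift_ι_apply K _ x)

attribute [local instance] LieRing.ofAssociativeRing in
theorem act_algebraMap (M : CMod p L S A π) (c : K) (m : M) :
    M.act (algebraMap K _ c) m = algebraMap K A c • m := by
  let _ : Algebra K (Module.End A M) :=
    ((algebraMap A (Module.End A M)).comp (algebraMap K A)).toAlgebra' fun c f => by
      ext m; simp
  have : M.act (algebraMap K _ c) = algebraMap K (Module.End A M) c := AlgHom.commutes _ c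
  exact LinearMap.congr_fun this m

theorem act_mul (M : CMod p L S A π) (u v : L.US p S) (m : M) :
    M.act (u * v) m = M.act u (M.act v m) := by
  rw [map_mul, Module.End.mul_apply]

theorem lin_act {M N : CMod p L S A π} (f : M ⟶ N) (u : L.US p S) (m : M) :
    lin f (M.act u m) = N.act u (lin f m) := by
  induction u using L.US_induction generalizing m with
  | algebraMap c => rw [act_algebraMap, act_algebraMap, map_smul]
  | toUS x => rw [act_toUS, act_toUS, lin_ρ]
  | add u v hu hv => simp only [map_add, LinearMap.add_apply, hu, hv]
  | mul u v hu hv => rw [act_mul, act_mul, hu, hv]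

theorem res_act (hTS : T ⊆ S) (M : CMod p L S A π) (u : L.US p T) (m : M) :
    (M.res hTS).act u m = M.act (L.inclUS p hTS u) m := by
  induction u using L.US_induction generalizing m with
  | algebraMap c =>
    rw [AlgHom.commutes, act_algebraMap]
    exact act_algebraMap (M.res hTS) c m
  | toUS x =>
    rw [act_toUS, L.inclUS_toUS, act_toUS]
    rfl
  | add u v hu hv =>
    rw [map_add, map_add, map_add]
    exact congrArg₂ (· + ·) (hu m) (hv m)
  | mul u v hu hv =>
    exact (act_mul (M.res hTS) u v m).trans (((congrArg _ (hv m)).trans (hu _)).trans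
      (by rw [map_mul, act_mul]))

section Induced

variable {hTS : T ⊆ S} {M : CMod p L T A π} {G : CMod p L S A π} {κ : Type*} [Fintype κ]
  (B : RightBasis (L.inclUS p hTS) κ)

/-- The map `(mⱼ)ⱼ ↦ ∑ⱼ Eⱼ i(mⱼ)` for a basis `E` of `U_S` over `U_T`. -/
def basisMap (i : M ⟶ G.res hTS) : (κ → M) →ₗ[A] G :=
  ∑ j, G.act (B.E j) ∘ₗ (lin i : M →ₗ[A] G) ∘ₗ LinearMap.proj j

theorem basisMap_apply (i : M ⟶ G.res hTS) (f : κ → M) :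
    basisMap B i f = indMap hTS i (∑ j, B.E j ⊗ₜ[ℤ] f j) := by
  simp only [basisMap, LinearMap.sum_apply, map_sum]
  rfl

/-- The map `u ⊗ m ↦ (uⱼ m)ⱼ` for the coordinates `uⱼ` of `u` with respect to a basis of `U_S` over
`U_T`. -/
def tensorCoord (M : CMod p L T A π) : L.US p S ⊗[ℤ] M →ₗ[ℤ] (κ → M) :=
  TensorProduct.lift (LinearMap.mk₂ ℤ (fun u m j => M.act (B.coord u j) m)
    (fun u v m => by funext j; simp)
    (fun z u m => by
      funext j
      rw [map_zsmul, Pi.smul_apply, map_zsmul]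
      rfl)
    (fun u m m' => by funext j; simp)
    (fun z u m => by funext j; simp))

theorem tensorCoord_tmul (u : L.US p S) (m : M) :
    tensorCoord B M (u ⊗ₜ m) = fun j => M.act (B.coord u j) m := rfl

theorem basisMap_tensorCoord (i : M ⟶ G.res hTS) (t : L.US p S ⊗[ℤ] M) :
    basisMap B i (tensorCoord B M t) = indMap hTS i t := by
  induction t with
  | zero => simp
  | add s t hs ht => rw [map_add, map_add, map_add, hs, ht]
  | tmul u m =>
    have hi (v : L.US p T) : (lin i (M.act v m) : G) = G.act (L.inclUS p hTS v) (lin i m) :=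
      (lin_act i v m).trans (res_act hTS G v _)
    rw [basisMap_apply, tensorCoord_tmul, map_sum]
    conv_rhs => rw [← B.sum_coord u, TensorProduct.sum_tmul, map_sum]
    refine Finset.sum_congr rfl fun j _ => ?_
    exact (congrArg (G.act (B.E j)) (hi _)).trans (act_mul G _ _ _).symm

theorem bijective_basisMap {i : M ⟶ G.res hTS} (hsurj : Function.Surjective (indMap hTS i))
    (hker : LinearMap.ker (indMap hTS i) = Submodule.span ℤ
      {t | ∃ (u : L.US p S) (b : L.US p T) (m : M),
        t = (u * L.inclUS p hTS b) ⊗ₜ[ℤ] m - u ⊗ₜ[ℤ] (M.act b m)}) :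
    Function.Bijective (basisMap B i) := by
  classical
  have hle : LinearMap.ker (indMap hTS i) ≤ LinearMap.ker (tensorCoord B M) := by
    rw [hker, Submodule.span_le]
    rintro _ ⟨u, b, m, rfl⟩
    rw [SetLike.mem_coe, LinearMap.mem_ker, map_sub, sub_eq_zero]
    simp only [tensorCoord_tmul, B.coord_mul_map, act_mul]
  have hcoord (f : κ → M) : tensorCoord B M (∑ j, B.E j ⊗ₜ f j) = f := by
    funext k
    simp only [map_sum, tensorCoord_tmul, B.coord_E, Finset.sum_apply]
    rw [Finset.sum_eq_single k (fun j _ hj => by rw [Pi.single_eq_of_ne hj.symm, map_zero]; rfl)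
      (by simp), Pi.single_eq_same, map_one]
    rfl
  refine ⟨(injective_iff_map_eq_zero _).2 fun f hf => ?_, fun g => ?_⟩
  · rw [← hcoord f]
    exact hle (by rwa [basisMap_apply] at hf)
  · obtain ⟨t, rfl⟩ := hsurj g
    exact ⟨_, basisMap_tensorCoord B i t⟩

end Induced

theorem IsInduced.projective [Fact p.Prime] [CharP K p] [Module.Finite ℤ Y]
    (hT : D.IsClosedSet T) (hS : D.IsClosedSet S) {hTS : T ⊆ S} {M : CMod p L T A π}
    {G : CMod p L S A π} (h : IsInduced hTS M G) [Module.Projective A M] :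
    Module.Projective A G := by
  classical
  have := Fintype.ofFinite ↥(S \ T)
  obtain ⟨i, hsurj, hker⟩ := h
  have hbij := bijective_basisMap (L.rightBasis p hS hT hTS) hsurj hker
  have : Module.Projective A ((↥(S \ T) → Fin p) → M) := Module.Projective.of_equiv
    (DFinsupp.linearEquivFunOnFintype (R := A) (M := fun _ => M))
  exact Module.Projective.of_equiv (LinearEquiv.ofBijective _ hbij)

/-- The linear equivalence underlying an isomorphism. -/
def linIso {M N : CMod p L S A π} (e : M ≅ N) : M ≃ₗ[A] N :=
  LinearEquiv.ofLinearMap (lin e.hom) (lin e.inv)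
    (by rw [← lin_comp, e.inv_hom_id]; rfl) (by rw [← lin_comp, e.hom_inv_id]; rfl)

theorem IsQI.projective [Fact p.Prime] [CharP K p] [Module.Finite ℤ Y] {μ : X}
    {G : CMod p L Set.univ A π} (h : G.IsQI μ) : Module.Projective A G := by
  obtain ⟨N, N', ⟨Z, Q, f, -, -, φ, -⟩, ⟨⟨e⟩, -⟩, hind⟩ := h
  have : Module.Projective A (Q.baseChange A) :=
    inferInstanceAs (Module.Projective A (A ⊗[K] Q))
  have : Module.Projective A N := Module.Projective.of_equiv φ
  have : Module.Projective A N' := Module.Projective.of_equiv (linIso e).symm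
  exact hind.projective L.isClosedSet_RP D.isClosedSet_univ

theorem subsingleton_of_isZero {M : CMod p L S A π} (hM : Limits.IsZero M) : Subsingleton M :=
  subsingleton_of_forall_eq 0 fun m =>
    congrArg (fun q : M ⟶ M => lin q m) ((Limits.IsZero.iff_id_eq_zero M).1 hM)

variable [IsNoetherianRing A]

theorem exact_lin {C : ShortComplex (CMod p L S A π)} (hC : C.Exact) :
    Function.Exact (lin C.f) (lin C.g) := by
  intro m
  constructor
  · intro hm
    obtain ⟨Q, q, _, x, hx⟩ := hC.exact_up_to_refinements (kerι C.g) (kerι_comp C.g)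
    obtain ⟨y, hy⟩ := surj_of_epi q ⟨m, hm⟩
    refine ⟨lin x y, (congrArg (fun f : Q ⟶ C.X₂ => lin f y) hx).symm.trans ?_⟩
    exact congrArg (lin (kerι C.g)) hy
  · rintro ⟨m, rfl⟩
    exact congrArg (fun q => lin q m) C.zero

theorem projective_of_shortExact {C : ShortComplex (CMod p L S A π)} (hC : C.ShortExact)
    [Module.Projective A C.X₁] [Module.Projective A C.X₃] : Module.Projective A C.X₂ := by
  have := hC.mono_f
  have := hC.epi_g
  obtain ⟨s, hs⟩ := Module.projective_lifting_property (lin C.g) LinearMap.id (surj_of_epi C.g)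
  exact Module.Projective.of_equiv
    ((exact_lin hC.exact).splitSurjectiveEquiv (inj_of_mono C.f) ⟨s, hs⟩).1.symm

theorem HasQFiltration.projective [Fact p.Prime] [CharP K p] [Module.Finite ℤ Y]
    {M : CMod p L Set.univ A π} (h : M.HasQFiltration) : Module.Projective A M := by
  induction h with
  | zero M hM =>
    have := subsingleton_of_isZero hM
    infer_instance
  | step C hC _ μ h₃ ih =>
    have := h₃.projective
    exact projective_of_shortExact hC

end CMod

/-! ### Free objects -/

namespace StdLevi

attribute [local instance] LieRing.ofAssociativeRing

variable {K ι X Y 𝔤 : Type*} [Field K] [Finite ι] [AddCommGroup X] [AddCommGroup Y]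
  [LieRing 𝔤] [LieAlgebra K 𝔤] {D : ReductiveLie K ι X Y 𝔤} (L : StdLevi D)

theorem exists_hS_eq (x : L.gS ∅) : ∃ y, L.hS ∅ y = x := by
  let W : LieSubalgebra K 𝔤 :=
    { LinearMap.range D.h with
      lie_mem' := by
        rintro _ _ ⟨x, rfl⟩ ⟨y, rfl⟩
        exact D.lie_h_h x y ▸ zero_mem (LinearMap.range D.h) }
  have hW : L.gS ∅ ≤ W := LieSubalgebra.lieSpan_le.2 (by
    rw [Set.image_empty, Set.union_empty]
    rintro _ ⟨x, rfl⟩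
    exact ⟨x, rfl⟩)
  obtain ⟨y, hy⟩ := hW x.2
  exact ⟨y, Subtype.ext hy⟩

/-- The identification of `𝔥` with `𝔤_∅`. -/
def cartanEquiv : CartanAlg K Y ≃ₗ[K] L.gS ∅ :=
  LinearEquiv.ofBijective
    ({ toFun := L.hS ∅
       map_add' := fun x y => Subtype.ext (map_add D.h x y)
       map_smul' := fun c x => Subtype.ext (map_smul D.h c x) } : CartanAlg K Y →ₗ[K] L.gS ∅)
    ⟨fun x y h => congrArg Prod.fst (D.bijective.1 (a₁ := (x, 0)) (a₂ := (y, 0))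
      (by simpa using show D.h x = D.h y from congrArg Subtype.val h)), L.exists_hS_eq⟩

theorem cartanEquiv_symm_hS (x : CartanAlg K Y) : L.cartanEquiv.symm (L.hS ∅ x) = x :=
  L.cartanEquiv.symm_apply_apply x

variable (p : ℕ) {A : Type*} [CommRing A] [Algebra K A] (θ : CartanAlg K Y →ₗ[K] A)

/-- The algebra homomorphism `U(𝔥) → A` which extends a linear map `θ : 𝔥 → A`. -/
def evU : L.US p ∅ →ₐ[K] A :=
  RingQuot.liftAlgHom K
    ⟨UniversalEnvelopingAlgebra.lift K
      { θ ∘ₗ L.cartanEquiv.symm.toLinearMap with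
        map_lie' := fun {x y} => by
          obtain ⟨x, rfl⟩ := L.exists_hS_eq x
          obtain ⟨y, rfl⟩ := L.exists_hS_eq y
          have h : ⁅L.hS ∅ x, L.hS ∅ y⁆ = 0 := Subtype.ext (D.lie_h_h x y)
          rw [h, LieRing.of_associative_ring_bracket, mul_comm, sub_self]
          exact map_zero (θ ∘ₗ L.cartanEquiv.symm.toLinearMap) },
      fun _ _ h => by obtain ⟨_, hα⟩ := h; exact hα.elim⟩

theorem evU_hS (x : CartanAlg K Y) : L.evU p θ (L.toUS p ∅ (L.hS ∅ x)) = θ x :=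
  (RingQuot.liftAlgHom_mkAlgHom_apply K _ _ _).trans
    ((UniversalEnvelopingAlgebra.lift_ι_apply K _ _).trans
      (congrArg θ (L.cartanEquiv_symm_hS x)))

variable {S : Set ι}

theorem hS_mul_rootVec (x : CartanAlg K Y) (α : S) :
    L.toUS p S (L.hS S x) * L.rootVec p α = L.rootVec p α *
      (L.toUS p S (L.hS S x) + algebraMap K _ (D.diff (D.P.root α) x)) := by
  have hlie : ⁅L.hS S x, L.eS α.1 α.2⁆ = D.diff (D.P.root α) x • L.eS α.1 α.2 :=
    Subtype.ext (D.lie_h_e_eq_diff x α)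
  have hmul := L.toUS_lie (p := p) (L.hS S x) (L.eS α.1 α.2)
  rw [hlie, toUS_smul, eq_sub_iff_add_eq] at hmul
  rw [← hmul, mul_add, ← Algebra.commutes, ← Algebra.smul_def, add_comm]

theorem hS_mul_word (x : CartanAlg K Y) (l : List S) :
    L.toUS p S (L.hS S x) * (l.map (L.rootVec p)).prod = (l.map (L.rootVec p)).prod *
      (L.toUS p S (L.hS S x) + algebraMap K _ ((L.wordWt l).1.2 x)) := by
  induction l with
  | nil => simp [wordWt]
  | cons α l ih =>
    have hwt : (L.wordWt (α :: l)).1.2 x = D.diff (D.P.root α) x + (L.wordWt l).1.2 x := rfl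
    rw [List.map_cons, List.prod_cons, ← mul_assoc, hS_mul_rootVec, hwt, mul_assoc, add_mul, ih,
      Algebra.commutes, mul_assoc, ← mul_add, add_assoc, map_add, add_comm (algebraMap K _ _)]

namespace HomogeneousBasis

variable {L p} (B : L.HomogeneousBasis p S)

/-- The weights of the members of a homogeneous basis. -/
def deg (i : Fin B.n) : L.Wt := L.wordWt (B.word i)

theorem coord_word_eq_zero {l : List S} {i : Fin B.n} (h : B.deg i ≠ L.wordWt l) :
    B.basis.coord (l.map (L.rootVec p)).prod i = 0 :=
  B.basis.coord_eq_zero_of_mem_span (B.word_mem_span l) h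

theorem coord_one_eq_zero {i : Fin B.n} (h : B.deg i ≠ 0) : B.basis.coord 1 i = 0 :=
  B.coord_word_eq_zero (l := []) h

theorem coord_rootVec_mul_E_eq_zero {α : S} {i k : Fin B.n}
    (h : B.deg i ≠ L.wt (D.P.root α) + B.deg k) :
    B.basis.coord (L.rootVec p α * B.basis.E k) i = 0 := by
  rw [B.E_eq]
  exact B.coord_word_eq_zero (l := α :: B.word k) h

theorem coord_hS_mul_E (x : CartanAlg K Y) (i : Fin B.n) :
    B.basis.coord (L.toUS p S (L.hS S x) * B.basis.E i) =
      Pi.single i (L.toUS p ∅ (L.hS ∅ x) + algebraMap K _ ((B.deg i).1.2 x)) := by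
  rw [← B.basis.coord_E_mul_map, map_add, L.inclUS_toUS, AlgHom.commutes, B.E_eq, hS_mul_word]
  rfl

/-- The matrices by which `U_S` acts on the direct sum of the modules induced from the
one-dimensional `U(𝔥)`-modules on which `𝔥` acts by the linear maps `θ j`. -/
def inducedMatrix {m : ℕ} (θ : Fin m → CartanAlg K Y →ₗ[K] A) :
    L.US p S →ₐ[K] Matrix (Fin B.n × Fin m) (Fin B.n × Fin m) A where
  toRingHom := (Matrix.blockDiagonalRingHom _ _ A).comp
    (RingHom.pi fun j => ((L.evU p (θ j)).mapMatrix.comp B.basis.leftMulMatrix).toRingHom)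
  commutes' c := by
    change Matrix.blockDiagonal (fun j => (L.evU p (θ j)).mapMatrix
      (B.basis.leftMulMatrix (algebraMap K _ c))) = _
    ext ⟨i, j⟩ ⟨i', j'⟩
    simp [Matrix.blockDiagonal_apply, Matrix.algebraMap_matrix_apply, ← ite_and, and_comm]

theorem inducedMatrix_apply {m : ℕ} (θ : Fin m → CartanAlg K Y →ₗ[K] A) (u : L.US p S)
    (i i' : Fin B.n) (j j' : Fin m) : B.inducedMatrix θ u (i, j) (i', j') =
      if j = j' then L.evU p (θ j) (B.basis.coord (u * B.basis.E i') i) else 0 := rfl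

theorem inducedMatrix_mulVec {m : ℕ} (θ : Fin m → CartanAlg K Y →ₗ[K] A) (u : L.US p S)
    (f : Fin B.n × Fin m → A) (i : Fin B.n) (j : Fin m) : (B.inducedMatrix θ u).mulVec f (i, j) =
      ∑ k, L.evU p (θ j) (B.basis.coord (u * B.basis.E k) i) * f (k, j) := by
  simp [Matrix.mulVec, dotProduct, Fintype.sum_prod_type, inducedMatrix_apply]

end HomogeneousBasis

end StdLevi

section CoordPiece

variable {κ W A : Type*} [CommRing A]

variable (A) in
/-- The functions supported on the indices of degree `v`. -/
def coordPiece (d : κ → W) (v : W) : Submodule A (κ → A) where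
  carrier := {f | ∀ i, d i ≠ v → f i = 0}
  zero_mem' := fun _ _ => rfl
  add_mem' hf hg i h := by rw [Pi.add_apply, hf i h, hg i h, add_zero]
  smul_mem' a f hf i h := by rw [Pi.smul_apply, hf i h, smul_zero]

theorem single_mem_coordPiece [DecidableEq κ] (d : κ → W) (i : κ) (a : A) :
    Pi.single i a ∈ coordPiece A d (d i) :=
  fun _ h => Pi.single_eq_of_ne (M := fun _ => A) (fun hk => h (congrArg d hk)) a

theorem iSupIndep_coordPiece (d : κ → W) : iSupIndep (coordPiece A d) := by
  classical
  refine WGrading.indep_of_proj _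
    (fun v => LinearMap.pi fun i => if d i = v then LinearMap.proj i else 0) ?_ ?_
  · intro v f hf
    funext i
    by_cases h : d i = v
    · simp [h]
    · simp [h, hf i h]
  · intro v v' hv f hf
    funext i
    by_cases h : d i = v'
    · simp [h, hf i (h ▸ hv.symm)]
    · simp [h]

theorem iSup_coordPiece [Finite κ] (d : κ → W) : ⨆ v, coordPiece A d v = ⊤ := by
  classical
  have := Fintype.ofFinite κ
  refine eq_top_iff.2 fun f _ => ?_
  rw [← Finset.univ_sum_single f]
  exact Submodule.sum_mem _ fun i _ =>
    Submodule.mem_iSup_of_mem (d i) (single_mem_coordPiece d i (f i))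

end CoordPiece

theorem algebraMap_mulVec {k A κ : Type*} [CommRing k] [CommRing A] [Algebra k A] [Fintype κ]
    [DecidableEq κ] (c : k) (f : κ → A) :
    (algebraMap k (Matrix κ κ A) c).mulVec f = algebraMap k A c • f := by
  rw [Algebra.algebraMap_eq_smul_one, Matrix.smul_mulVec, Matrix.one_mulVec, algebraMap_smul]

namespace CMod

open StdLevi

variable {K : Type u} {ι X Y 𝔤 : Type*} [Field K] [Finite ι] [AddCommGroup X] [AddCommGroup Y]
  [LieRing 𝔤] [LieAlgebra K 𝔤] {D : ReductiveLie K ι X Y 𝔤}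
  {p : ℕ} {L : StdLevi D} {S : Set ι} {A : Type u} [CommRing A] [Algebra K A]

section OfMatrix

variable {π : CartanAlg K Y →ₗ[K] A} {κ : Type} [Fintype κ] [DecidableEq κ]
  (R : L.US p S →ₐ[K] Matrix κ κ A) (d : κ → L.Wt)
  (hh : ∀ x, R (L.toUS p S (L.hS S x)) =
    Matrix.diagonal fun i => π x + algebraMap K A ((d i).1.2 x))
  (he : ∀ (α : S) i k, d i ≠ d k + L.wt (D.P.root α) → R (L.rootVec p α) i k = 0)

/-- The object of column vectors on which `U_S` acts by the matrices `R u`, where the `i`-th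
standard vector has weight `d i`. -/
def ofMatrix : CMod p L S A π where
  carrier := κ → A
  ρ :=
    { toFun := fun x => (R (L.toUS p S x)).mulVecLin
      map_add' := fun x y => by
        rw [L.toUS_add, map_add, Matrix.mulVecLin_add]
      map_smul' := fun c x => LinearMap.ext fun f => by
        rw [L.toUS_smul, map_smul, Matrix.mulVecLin_apply, Matrix.smul_mulVec,
          ← algebraMap_smul A c]
        rfl }
  ρ_lie x y := LinearMap.ext fun f => by
    simp [L.toUS_lie]
  ρ_pow α hα f := by
    change ((R (L.rootVec p ⟨α, hα⟩)).mulVecLin ^ p) f = _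
    rw [← Matrix.toLin'_apply', ← Matrix.toLin'_pow, ← map_pow, L.rootVec_pow, AlgHom.commutes]
    exact algebraMap_mulVec _ f
  finite := inferInstance
  piece := coordPiece A d
  piece_indep := iSupIndep_coordPiece d
  piece_span := iSup_coordPiece d
  h_act v f hf x := by
    change (R (L.toUS p S (L.hS S x))).mulVec f = _
    funext i
    rw [hh, Matrix.mulVec_diagonal, Pi.smul_apply, smul_eq_mul]
    by_cases hi : d i = v
    · rw [hi]
    · rw [hf i hi, mul_zero, mul_zero]
  e_act α hα v f hf i hi := by
    refine Finset.sum_eq_zero fun k _ => ?_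
    by_cases hk : d k = v
    · exact (congrArg (· * f k) (he ⟨α, hα⟩ i k (hk ▸ hi))).trans (zero_mul _)
    · rw [hf k hk, mul_zero]

theorem act_ofMatrix (u : L.US p S) (f : κ → A) :
    (ofMatrix R d hh he).act u f = (R u).mulVec f := by
  induction u using L.US_induction generalizing f with
  | algebraMap c =>
    rw [AlgHom.commutes, algebraMap_mulVec]
    exact act_algebraMap (ofMatrix R d hh he) c f
  | toUS x =>
    rw [act_toUS]
    rfl
  | add u v hu hv =>
    rw [map_add, map_add, Matrix.add_mulVec]
    exact congrArg₂ (· + ·) (hu f) (hv f)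
  | mul u v hu hv =>
    rw [map_mul, map_mul, ← Matrix.mulVec_mulVec]
    exact (congrArg ((ofMatrix R d hh he).act u) (hv f)).trans (hu _)

end OfMatrix

variable (π : CartanAlg K Y →ₗ[K] A)

/-- The linear map by which `𝔥` acts on the piece of weight `w`. -/
def wtForm (w : L.Wt) : CartanAlg K Y →ₗ[K] A := π + (Algebra.linearMap K A) ∘ₗ w.1.2

theorem wtForm_apply (w : L.Wt) (x) : wtForm π w x = π x + algebraMap K A (w.1.2 x) := rfl

variable {π} in
theorem act_inclUS (M : CMod p L S A π) {w : L.Wt} {m : M} (hm : m ∈ M.piece w)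
    (u : L.US p ∅) : M.act (L.inclUS p (Set.empty_subset S) u) m = L.evU p (wtForm π w) u • m := by
  induction u using L.US_induction with
  | algebraMap c => rw [AlgHom.commutes, AlgHom.commutes, act_algebraMap]
  | toUS x =>
    obtain ⟨y, rfl⟩ := L.exists_hS_eq x
    rw [L.inclUS_toUS, act_toUS, evU_hS, wtForm_apply]
    exact M.h_act w m hm y
  | add u v hu hv => rw [map_add, map_add, map_add, LinearMap.add_apply, hu, hv, add_smul]
  | mul u v hu hv =>
    rw [map_mul (L.inclUS p _), map_mul (L.evU p _), act_mul, hv, map_smul, hu, smul_smul, mul_comm]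

variable (B : L.HomogeneousBasis p S) {m : ℕ} (w : Fin m → L.Wt)

theorem inducedMatrix_hS (x : CartanAlg K Y) :
    B.inducedMatrix (fun j => wtForm π (w j)) (L.toUS p S (L.hS S x)) =
      Matrix.diagonal fun q => π x + algebraMap K A ((B.deg q.1 + w q.2).1.2 x) := by
  ext ⟨i, j⟩ ⟨i', j'⟩
  rw [B.inducedMatrix_apply, B.coord_hS_mul_E, Matrix.diagonal_apply]
  rcases eq_or_ne i i' with rfl | hi
  · simp [evU_hS, wtForm_apply, add_assoc, add_comm, add_left_comm]
  · simp [hi]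

theorem inducedMatrix_rootVec_eq_zero (θ : Fin m → CartanAlg K Y →ₗ[K] A) {α : S}
    {q r : Fin B.n × Fin m}
    (h : B.deg q.1 + w q.2 ≠ B.deg r.1 + w r.2 + L.wt (D.P.root α)) :
    B.inducedMatrix θ (L.rootVec p α) q r = 0 := by
  obtain ⟨i, j⟩ := q
  obtain ⟨i', j'⟩ := r
  rw [B.inducedMatrix_apply, ite_eq_right_iff]
  rintro rfl
  rw [B.coord_rootVec_mul_E_eq_zero, map_zero]
  intro hi
  exact h (by rw [hi, add_comm (L.wt _), add_right_comm])

/-- The object freely generated by vectors of weights `w j`: the direct sum of the objects induced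
from the corresponding characters of `𝔥`. -/
def freeObj : CMod p L S A π :=
  ofMatrix (B.inducedMatrix fun j => wtForm π (w j)) (fun q => B.deg q.1 + w q.2)
    (inducedMatrix_hS π B w) fun _ _ _ => inducedMatrix_rootVec_eq_zero B w _

theorem act_freeObj (u : L.US p S) (f : Fin B.n × Fin m → A) :
    (freeObj π B w).act u f = ((B.inducedMatrix fun j => wtForm π (w j)) u).mulVec f :=
  act_ofMatrix _ _ _ _ u f

/-- The free generators of `freeObj`. -/
def freeGen (j : Fin m) : freeObj π B w :=
  (fun q => if q.2 = j then L.evU p (wtForm π (w j)) (B.basis.coord 1 q.1) else 0 :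
    Fin B.n × Fin m → A)

theorem freeGen_mem_piece (j : Fin m) : freeGen π B w j ∈ (freeObj π B w).piece (w j) := by
  rintro ⟨i, j'⟩ h
  refine ite_eq_right_iff.2 fun (hj : j' = j) => ?_
  have hi : B.deg i ≠ 0 := fun hi => h (show B.deg i + w j' = w j by rw [hi, zero_add, hj])
  rw [B.coord_one_eq_zero hi, map_zero]

theorem act_E_freeGen (i : Fin B.n) (j : Fin m) :
    (freeObj π B w).act (B.basis.E i) (freeGen π B w j) =
      (Pi.single (i, j) 1 : Fin B.n × Fin m → A) := by
  refine (act_freeObj π B w _ _).trans (funext fun ⟨i', j'⟩ => ?_)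
  refine (B.inducedMatrix_mulVec _ _ _ _ _).trans ?_
  rcases eq_or_ne j' j with rfl | hj
  · simp only [freeGen, if_true, ← map_mul, ← map_sum]
    rw [← B.basis.coord_mul, mul_one, B.basis.coord_E]
    rcases eq_or_ne i' i with rfl | hi
    · simp
    · simp [hi]
  · simp [freeGen, hj]

/-- The object `P` is freely generated by the vectors `v j` of weight `w j`. -/
structure IsFreeOn {π : CartanAlg K Y →ₗ[K] A} (B : L.HomogeneousBasis p S) (P : CMod p L S A π)
    {m : ℕ} (w : Fin m → L.Wt) (v : Fin m → P) where
  mem_piece : ∀ j, v j ∈ P.piece (w j)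
  basis : Module.Basis (Fin B.n × Fin m) A P
  basis_apply : ∀ i j, basis (i, j) = P.act (B.basis.E i) (v j)

/-- The object `freeObj` is free on the vectors `freeGen`. -/
def isFreeOn_freeObj : IsFreeOn B (freeObj π B w) w (freeGen π B w) where
  mem_piece := freeGen_mem_piece π B w
  basis := Pi.basisFun A (Fin B.n × Fin m)
  basis_apply i j := (Pi.basisFun_apply A _ _).trans (act_E_freeGen π B w i j).symm

end CMod

namespace CMod

open StdLevi

variable {K : Type u} {ι X Y 𝔤 : Type*} [Field K] [Finite ι] [AddCommGroup X] [AddCommGroup Y]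
  [LieRing 𝔤] [LieAlgebra K 𝔤] {D : ReductiveLie K ι X Y 𝔤}
  {p : ℕ} {L : StdLevi D} {S : Set ι} {A : Type u} [CommRing A] [Algebra K A]
  {π : CartanAlg K Y →ₗ[K] A}

section Pieces

theorem act_word_mem_piece (M : CMod p L S A π) (l : List S) {w : L.Wt} {m : M}
    (hm : m ∈ M.piece w) :
    M.act (l.map (L.rootVec p)).prod m ∈ M.piece (L.wordWt l + w) := by
  induction l with
  | nil => simpa [wordWt] using hm
  | cons α l ih =>
    have h := M.e_act α α.2 _ _ ih
    rw [List.map_cons, List.prod_cons, act_mul, act_toUS, wordWt, List.map_cons, List.sum_cons,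
      add_assoc, add_comm]
    exact h

theorem map_piece_of_span {M N : CMod p L S A π} (f : M →ₗ[A] N) {I : Type*} {b : I → M}
    (hb : Submodule.span A (Set.range b) = ⊤) {v : I → L.Wt} (hv : ∀ i, b i ∈ M.piece (v i))
    (hf : ∀ i, f (b i) ∈ N.piece (v i)) (w : L.Wt) (m : M) (hm : m ∈ M.piece w) :
    f m ∈ N.piece w := by
  have map_proj : f ∘ₗ M.proj w = N.proj w ∘ₗ f := LinearMap.ext_on_range hb fun i => by
    rw [LinearMap.comp_apply, LinearMap.comp_apply]
    by_cases h : v i = w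
    · rw [M.proj_same w _ (h ▸ hv i), N.proj_same w _ (h ▸ hf i)]
    · rw [M.proj_ne _ w h _ (hv i), N.proj_ne _ w h _ (hf i), map_zero]
  rw [← M.proj_same w m hm]
  exact DFunLike.congr_fun map_proj m ▸ N.proj_mem w (f m)

theorem exists_homogeneous_generators (M : CMod p L S A π) :
    ∃ (m : ℕ) (w : Fin m → L.Wt) (g : Fin m → M), (∀ j, g j ∈ M.piece (w j)) ∧
      Submodule.span A (Set.range g) = ⊤ := by
  classical
  obtain ⟨s, hs⟩ := M.finite.fg_top
  choose t ht using M.proj_sum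
  let T := s.sigma t
  let ε := T.equivFin
  refine ⟨T.card, fun j => (ε.symm j).1.2, fun j => M.proj (ε.symm j).1.2 (ε.symm j).1.1,
    fun j => M.proj_mem _ _, ?_⟩
  rw [eq_top_iff, ← hs, Submodule.span_le]
  intro x hx
  rw [ht x]
  refine Submodule.sum_mem _ fun w hw => Submodule.subset_span ⟨ε ⟨⟨x, w⟩, ?_⟩, ?_⟩
  · exact Finset.mem_sigma.2 ⟨hx, hw⟩
  · simp

/-- The projection of an object onto one of its pieces. -/
def toPiece (M : CMod p L S A π) (w : L.Wt) : M →ₗ[A] M.piece w :=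
  (M.proj w).codRestrict _ (M.proj_mem w)

theorem toPiece_comp_subtype (M : CMod p L S A π) (w : L.Wt) :
    M.toPiece w ∘ₗ (M.piece w).subtype = LinearMap.id :=
  LinearMap.ext fun m => Subtype.ext (M.proj_same w m m.2)

theorem projective_piece (M : CMod p L S A π) [Module.Projective A M] (w : L.Wt) :
    Module.Projective A (M.piece w) :=
  Module.Projective.of_split _ _ (M.toPiece_comp_subtype w)

end Pieces

theorem act_eq_sum (B : L.HomogeneousBasis p S) (M : CMod p L S A π) {w : L.Wt} {x : M}
    (hx : x ∈ M.piece w) (u : L.US p S) :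
    M.act u x = ∑ i, L.evU p (wtForm π w) (B.basis.coord u i) • M.act (B.basis.E i) x := by
  conv_lhs => rw [← B.basis.sum_coord u, map_sum, LinearMap.sum_apply]
  refine Finset.sum_congr rfl fun i _ => ?_
  rw [act_mul, M.act_inclUS hx, map_smul]

namespace IsFreeOn

variable {B : L.HomogeneousBasis p S} {P : CMod p L S A π} {m : ℕ} {w : Fin m → L.Wt}
  {v : Fin m → P} (F : IsFreeOn B P w v)

/-- The linear map underlying `desc`. -/
def descLin (N : CMod p L S A π) (n : ∀ j, N.piece (w j)) : P →ₗ[A] N :=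
  F.basis.constr A fun q => N.act (B.basis.E q.1) (n q.2)

variable (N : CMod p L S A π) (n : ∀ j, N.piece (w j))

theorem descLin_act (u : L.US p S) (j : Fin m) : F.descLin N n (P.act u (v j)) = N.act u (n j) := by
  rw [act_eq_sum B P (F.mem_piece j), act_eq_sum B N (n j).2, map_sum]
  refine Finset.sum_congr rfl fun i _ => ?_
  rw [map_smul, ← F.basis_apply, descLin, Module.Basis.constr_basis]

theorem descLin_ρ (x : L.gS S) : F.descLin N n ∘ₗ P.ρ x = N.ρ x ∘ₗ F.descLin N n :=
  F.basis.ext fun ⟨i, j⟩ => by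
    rw [LinearMap.comp_apply, LinearMap.comp_apply, F.basis_apply, ← act_toUS, ← act_toUS,
      ← act_mul, F.descLin_act, F.descLin_act, act_mul]

/-- The morphism from a free object with given values on the generators. -/
def desc : P ⟶ N :=
  mkHom (F.descLin N n) (fun x => DFunLike.congr_fun (F.descLin_ρ N n x)) <|
    map_piece_of_span _ F.basis.span_eq (v := fun q => B.deg q.1 + w q.2)
      (fun ⟨i, j⟩ => by
        rw [F.basis_apply, B.E_eq]
        exact P.act_word_mem_piece _ (F.mem_piece j))
      (fun ⟨i, j⟩ => by
        rw [F.basis_apply, F.descLin_act, B.E_eq]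
        exact N.act_word_mem_piece _ (n j).2)

theorem desc_gen (j : Fin m) : lin (F.desc N n) (v j) = n j := by
  change F.descLin N n (v j) = n j
  simpa using F.descLin_act N n 1 j

variable {N} in
include F in
theorem hom_ext {f g : P ⟶ N} (h : ∀ j, lin f (v j) = lin g (v j)) : f = g := by
  have : lin f = lin g := F.basis.ext fun ⟨i, j⟩ => by
    rw [F.basis_apply, lin_act, lin_act, h]
  exact CMod.hom_ext (DFunLike.congr_fun this)

/-- Morphisms from a free object are given by their values on the generators. -/
def homEquiv : (P ⟶ N) ≃ₗ[A] ∀ j, N.piece (w j) where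
  toFun f j := ⟨lin f (v j), lin_piece f _ _ (F.mem_piece j)⟩
  map_add' _ _ := rfl
  map_smul' _ _ := rfl
  invFun := F.desc N
  left_inv _ := F.hom_ext fun j => F.desc_gen N _ j
  right_inv n := funext fun j => Subtype.ext (F.desc_gen N n j)

end IsFreeOn

section BaseChange

variable (A' : Type u) [CommRing A'] [Algebra K A'] [Algebra A A'] [IsScalarTower K A A']

theorem act_baseChange (M : CMod p L S A π) (u : L.US p S) (a : A') (x : M) :
    (M.baseChange A').act u (a ⊗ₜ[A] x : A' ⊗[A] M) = (a ⊗ₜ[A] (M.act u x) : A' ⊗[A] M) := by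
  induction u using L.US_induction generalizing x with
  | algebraMap c =>
    refine (act_algebraMap (M.baseChange A') c _).trans ?_
    rw [act_algebraMap, TensorProduct.tmul_smul, ← algebraMap_smul A',
      ← IsScalarTower.algebraMap_apply]
    rfl
  | toUS y =>
    rw [act_toUS, act_toUS]
    rfl
  | add u v hu hv =>
    rw [map_add, map_add, LinearMap.add_apply, TensorProduct.tmul_add]
    exact congrArg₂ (· + ·) (hu x) (hv x)
  | mul u v hu hv =>
    rw [map_mul, act_mul]
    exact (congrArg ((M.baseChange A').act u) (hv x)).trans (hu _)

/-- Free objects remain free under extension of scalars. -/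
def IsFreeOn.baseChange {B : L.HomogeneousBasis p S} {P : CMod p L S A π} {m : ℕ}
    {w : Fin m → L.Wt} {v : Fin m → P} (F : IsFreeOn B P w v) :
    IsFreeOn B (P.baseChange A') w (fun j => (1 ⊗ₜ[A] v j : A' ⊗[A] P)) where
  mem_piece j := Submodule.tmul_mem_baseChange_of_mem 1 (F.mem_piece j)
  basis := Module.Basis.baseChange A' F.basis
  basis_apply i j := by
    refine (Module.Basis.baseChange_apply A' F.basis (i, j)).trans ?_
    rw [F.basis_apply]
    exact (act_baseChange A' P _ 1 _).symm

/-- The canonical map `A' ⊗ Hom(M, N) → Hom(M ⊗ A', N ⊗ A')`. -/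
def homBaseChange (M N : CMod p L S A π) :
    A' ⊗[A] (M ⟶ N) →ₗ[A'] (M.baseChange A' ⟶ N.baseChange A') :=
  letI : Module A (M.baseChange A' ⟶ N.baseChange A') := Module.compHom _ (algebraMap A A')
  haveI : IsScalarTower A A' (M.baseChange A' ⟶ N.baseChange A') :=
    IsScalarTower.of_algebraMap_smul fun _ _ => rfl
  LinearMap.liftBaseChange A'
    { toFun := baseChangeMap A'
      map_add' := fun f g => CMod.hom_ext fun x =>
        DFunLike.congr_fun (LinearMap.baseChange_add (A := A') (lin f) (lin g)) x
      map_smul' := fun a f => CMod.hom_ext fun x => by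
        refine (DFunLike.congr_fun (LinearMap.baseChange_smul (A := A') a (lin f)) x).trans ?_
        exact (algebraMap_smul A' a _).symm }

theorem homBaseChange_tmul (M N : CMod p L S A π) (a : A') (f : M ⟶ N) :
    homBaseChange A' M N (a ⊗ₜ f) = a • baseChangeMap A' f := rfl

/-- Extension of scalars commutes with taking a piece. -/
def pieceBaseChange (N : CMod p L S A π) (w : L.Wt) :
    A' ⊗[A] N.piece w ≃ₗ[A'] (N.baseChange A').piece w :=
  LinearEquiv.ofInjective ((N.piece w).subtype.baseChange A') <|
    Function.LeftInverse.injective (g := (N.toPiece w).baseChange A') fun x => by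
      rw [← LinearMap.comp_apply, ← LinearMap.baseChange_comp, toPiece_comp_subtype,
        LinearMap.baseChange_id, LinearMap.id_apply]

end BaseChange

/-- The object `P` is freely generated by finitely many homogeneous vectors. -/
def IsFree (P : CMod p L S A π) : Prop :=
  ∃ (B : L.HomogeneousBasis p S) (m : ℕ) (w : Fin m → L.Wt) (v : Fin m → P),
    Nonempty (IsFreeOn B P w v)

theorem exists_free_cover (hB : Nonempty (L.HomogeneousBasis p S)) (M : CMod p L S A π) :
    ∃ (P : CMod p L S A π) (f : P ⟶ M), IsFree P ∧ Function.Surjective (lin f) := by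
  obtain ⟨B⟩ := hB
  obtain ⟨m, w, g, hg, hs⟩ := M.exists_homogeneous_generators
  let F := isFreeOn_freeObj π B w
  refine ⟨freeObj π B w, F.desc M fun j => ⟨g j, hg j⟩, ⟨B, m, w, _, ⟨F⟩⟩, ?_⟩
  rw [← LinearMap.range_eq_top, eq_top_iff, ← hs, Submodule.span_le]
  rintro _ ⟨j, rfl⟩
  exact ⟨_, F.desc_gen M _ j⟩

namespace IsFree

variable {P : CMod p L S A π} (hP : IsFree P)
include hP

theorem projective : Projective P where
  factors {E Z} f e _ := by
    obtain ⟨B, m, w, v, ⟨F⟩⟩ := hP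
    choose y hy using fun j => surj_of_epi e (lin f (v j))
    refine ⟨F.desc E fun j => ⟨E.proj (w j) (y j), E.proj_mem _ _⟩, F.hom_ext fun j => ?_⟩
    rw [lin_comp, LinearMap.comp_apply, F.desc_gen, lin_proj, hy,
      proj_same _ _ _ (lin_piece f _ _ (F.mem_piece j))]

theorem free : Module.Free A P :=
  let ⟨_, _, _, _, ⟨F⟩⟩ := hP
  Module.Free.of_basis F.basis

theorem projective_hom (N : CMod p L S A π) [Module.Projective A N] :
    Module.Projective A (P ⟶ N) := by
  obtain ⟨B, m, w, v, ⟨F⟩⟩ := hP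
  have := fun j => projective_piece N (w j)
  have : Module.Projective A (∀ j, N.piece (w j)) := Module.Projective.of_equiv
    (DFinsupp.linearEquivFunOnFintype (R := A) (M := fun j => N.piece (w j)))
  exact Module.Projective.of_equiv (F.homEquiv N).symm

theorem finite_hom [IsNoetherianRing A] (N : CMod p L S A π) : Module.Finite A (P ⟶ N) :=
  let ⟨_, _, _, _, ⟨F⟩⟩ := hP
  Module.Finite.equiv (F.homEquiv N).symm

variable (A' : Type u) [CommRing A'] [Algebra K A'] [Algebra A A'] [IsScalarTower K A A']

theorem baseChange : IsFree (P.baseChange A') :=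
  let ⟨B, m, w, _, ⟨F⟩⟩ := hP
  ⟨B, m, w, _, ⟨F.baseChange A'⟩⟩

theorem bijective_homBaseChange (N : CMod p L S A π) :
    Function.Bijective (homBaseChange A' P N) := by
  obtain ⟨B, m, w, v, ⟨F⟩⟩ := hP
  let T : A' ⊗[A] (P ⟶ N) ≃ₗ[A'] ∀ j, (N.baseChange A').piece (w j) :=
    (F.homEquiv N).baseChange A A' _ _ ≪≫ₗ TensorProduct.piRight A A' A' _ ≪≫ₗ
      LinearEquiv.piCongrRight fun j => pieceBaseChange A' N (w j)
  let E := (F.baseChange A').homEquiv (N.baseChange A')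
  have hT : E.toLinearMap ∘ₗ homBaseChange A' P N = T.toLinearMap := by
    refine LinearMap.ext fun x => ?_
    induction x with
    | zero => rw [map_zero, map_zero]
    | add x y hx hy => rw [map_add, map_add, hx, hy]
    | tmul a f => ?_
    refine funext fun j => Subtype.ext ?_
    change a • ((1 : A') ⊗ₜ[A] lin f (v j)) = a ⊗ₜ[A] lin f (v j)
    rw [TensorProduct.smul_tmul', smul_eq_mul, mul_one]
  refine (Function.Bijective.of_comp_iff' E.bijective _).1 ?_
  exact (congrArg (fun g : _ →ₗ[A'] _ => Function.Bijective g) hT).mpr T.bijective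

end IsFree

end CMod

/-! ### Complexes which are exact modulo all maximal ideals -/

section SplitInjective

open TensorProduct

variable {R M N : Type*} [CommRing R] [AddCommGroup M] [Module R M] [AddCommGroup N] [Module R N]

theorem lTensor_injective_of_equiv {Q Q' : Type*} [AddCommGroup Q] [Module R Q] [AddCommGroup Q']
    [Module R Q'] (e : Q ≃ₗ[R] Q') {l : M →ₗ[R] N} (h : Function.Injective (l.lTensor Q)) :
    Function.Injective (l.lTensor Q') := by
  have hcomm : l.lTensor Q' ∘ₗ e.toLinearMap.rTensor M = e.toLinearMap.rTensor N ∘ₗ l.lTensor Q :=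
    (LinearMap.lTensor_comp_rTensor ..).trans (LinearMap.rTensor_comp_lTensor ..).symm
  refine (Function.Injective.of_comp_iff' _ (e.rTensor M).bijective).1 ?_
  exact (congrArg (fun g : _ →ₗ[R] _ => Function.Injective g) hcomm).mpr
    ((e.rTensor N).injective.comp h)

theorem lTensor_baseChange_injective (S k : Type*) [CommRing S] [Algebra R S] [CommRing k]
    [Algebra R k] [Algebra S k] [IsScalarTower R S k] {l : M →ₗ[R] N}
    (h : Function.Injective (l.lTensor k)) :
    Function.Injective ((l.baseChange S).lTensor k) := by
  let eM := AlgebraTensorModule.cancelBaseChange R S k k M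
  let eN := AlgebraTensorModule.cancelBaseChange R S k k N
  have hcomm : eN.toLinearMap ∘ₗ (l.baseChange S).baseChange k =
      l.baseChange k ∘ₗ eM.toLinearMap := by
    ext m
    simp [eM, eN]
  refine Function.Injective.of_comp (f := eN) ?_
  exact (congrArg (fun g : _ →ₗ[k] _ => Function.Injective g) hcomm).mpr (h.comp eM.injective)

theorem lTensor_residueField_injective (𝔪 : Ideal R) [𝔪.IsMaximal] {l : M →ₗ[R] N}
    (h : Function.Injective (l.lTensor (R ⧸ 𝔪))) :
    Function.Injective ((l.baseChange (Localization.AtPrime 𝔪)).lTensor 𝔪.ResidueField) :=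
  lTensor_baseChange_injective _ _ <| lTensor_injective_of_equiv
    (LinearEquiv.ofBijective ((Algebra.linearMap (R ⧸ 𝔪) 𝔪.ResidueField).restrictScalars R)
      𝔪.bijective_algebraMap_quotient_residueField) h

variable [Module.Finite R N] [Module.Projective R N] {l : M →ₗ[R] N}
  (h : ∀ 𝔪 : Ideal R, 𝔪.IsMaximal → Function.Injective (l.lTensor (R ⧸ 𝔪)))
include h

theorem injective_of_lTensor_quotient_injective [Module.Finite R M] : Function.Injective l := by
  refine fun x y hxy => Module.eq_of_localization_maximal _
    (fun 𝔪 _ => TensorProduct.mk R (Localization.AtPrime 𝔪) M 1) x y fun 𝔪 h𝔪 => ?_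
  have : Module.Free (Localization.AtPrime 𝔪) (Localization.AtPrime 𝔪 ⊗[R] N) :=
    Module.free_of_flat_of_isLocalRing
  obtain ⟨r, hr⟩ := (IsLocalRing.split_injective_iff_lTensor_residueField_injective _).2
    (lTensor_residueField_injective 𝔪 (h 𝔪 h𝔪))
  have hinj : Function.Injective (l.baseChange (Localization.AtPrime 𝔪)) :=
    Function.LeftInverse.injective (DFunLike.congr_fun hr)
  exact hinj (by simp [hxy])

theorem projective_quotient_range_of_lTensor_quotient_injective [Module.Finite R M]
    [IsNoetherianRing R] : Module.Projective R (N ⧸ LinearMap.range l) := by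
  have := Module.finitePresentation_of_finite R (N ⧸ LinearMap.range l)
  refine Module.projective_of_localization_maximal'
    (fun 𝔪 _ => Localization.AtPrime 𝔪)
    (fun 𝔪 _ => Localization.AtPrime 𝔪 ⊗[R] (N ⧸ LinearMap.range l))
    (fun 𝔪 _ => TensorProduct.mk R (Localization.AtPrime 𝔪) _ 1) fun 𝔪 h𝔪 => ?_
  have : Module.Free (Localization.AtPrime 𝔪) (Localization.AtPrime 𝔪 ⊗[R] N) :=
    Module.free_of_flat_of_isLocalRing
  have := Module.free_of_lTensor_residueField_injective
    (f := l.baseChange (Localization.AtPrime 𝔪))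
    (g := (LinearMap.range l).mkQ.baseChange (Localization.AtPrime 𝔪))
    (LinearMap.lTensor_surjective _ (Submodule.mkQ_surjective _))
    (lTensor_exact _ (LinearMap.exact_map_mkQ_range l) (Submodule.mkQ_surjective _))
    (lTensor_residueField_injective 𝔪 (h 𝔪 h𝔪))
  infer_instance

theorem exists_leftInverse_of_lTensor_quotient_injective [Module.Finite R M] [IsNoetherianRing R] :
    ∃ r : N →ₗ[R] M, r ∘ₗ l = LinearMap.id := by
  have := projective_quotient_range_of_lTensor_quotient_injective h
  obtain ⟨s, hs⟩ := Module.projective_lifting_property (LinearMap.range l).mkQ LinearMap.id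
    (Submodule.mkQ_surjective _)
  have htfae := (LinearMap.exact_map_mkQ_range l).split_tfae'.out 0 1
  exact (htfae.1 ⟨injective_of_lTensor_quotient_injective h, s, hs⟩).2

end SplitInjective

section Contraction

variable {R C₀ C₁ C₂ : Type*} [CommRing R] [AddCommGroup C₀] [Module R C₀] [AddCommGroup C₁]
  [Module R C₁] [AddCommGroup C₂] [Module R C₂] {d₀ : C₀ →ₗ[R] C₁} {d₁ : C₁ →ₗ[R] C₂}

theorem exists_section_of_projective_quotient_range
    [Module.Projective R C₁] [Module.Projective R (C₁ ⧸ LinearMap.range d₀)] :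
    ∃ (h : C₁ →ₗ[R] C₀) (σ : (C₁ ⧸ LinearMap.range d₀) →ₗ[R] C₁),
      d₀ ∘ₗ h + σ ∘ₗ (LinearMap.range d₀).mkQ = LinearMap.id := by
  let q := (LinearMap.range d₀).mkQ
  obtain ⟨σ, hσ⟩ := Module.projective_lifting_property q LinearMap.id (Submodule.mkQ_surjective _)
  have mem_range (x : C₁) : (LinearMap.id - σ ∘ₗ q : C₁ →ₗ[R] C₁) x ∈ LinearMap.range d₀ := by
    refine (Submodule.Quotient.mk_eq_zero _).1 ((map_sub q x _).trans (sub_eq_zero.2 ?_))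
    exact (DFunLike.congr_fun hσ (q x)).symm
  obtain ⟨h, hh⟩ := Module.projective_lifting_property d₀.rangeRestrict
    ((LinearMap.id - σ ∘ₗ q).codRestrict _ mem_range) d₀.surjective_rangeRestrict
  refine ⟨h, σ, LinearMap.ext fun x => ?_⟩
  have hx : d₀ (h x) = x - σ (q x) := congrArg Subtype.val (DFunLike.congr_fun hh x)
  exact (congrArg (· + σ (q x)) hx).trans (sub_add_cancel x _)

theorem exists_contraction [IsNoetherianRing R] [Module.Finite R C₁] [Module.Finite R C₂]
    [Module.Projective R C₁] [Module.Projective R C₂] (hd : d₁ ∘ₗ d₀ = 0)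
    (h : ∀ 𝔪 : Ideal R, 𝔪.IsMaximal →
      Function.Exact (d₀.lTensor (R ⧸ 𝔪)) (d₁.lTensor (R ⧸ 𝔪))) :
    ∃ (h₁ : C₁ →ₗ[R] C₀) (h₂ : C₂ →ₗ[R] C₁), d₀ ∘ₗ h₁ + h₂ ∘ₗ d₁ = LinearMap.id := by
  let q := (LinearMap.range d₀).mkQ
  let l : (C₁ ⧸ LinearMap.range d₀) →ₗ[R] C₂ :=
    (LinearMap.range d₀).liftQ d₁ (LinearMap.range_le_ker_iff.2 hd)
  have hl : l ∘ₗ q = d₁ := Submodule.liftQ_mkQ _ _ _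
  have hinj (𝔪 : Ideal R) (h𝔪 : 𝔪.IsMaximal) : Function.Injective (l.lTensor (R ⧸ 𝔪)) := by
    refine (injective_iff_map_eq_zero _).2 fun t ht => ?_
    obtain ⟨s, rfl⟩ := LinearMap.lTensor_surjective (R ⧸ 𝔪) (Submodule.mkQ_surjective _) t
    rw [← LinearMap.comp_apply, ← LinearMap.lTensor_comp, hl] at ht
    obtain ⟨y, rfl⟩ := (h 𝔪 h𝔪 s).1 ht
    rw [← LinearMap.comp_apply, ← LinearMap.lTensor_comp, LinearMap.range_mkQ_comp,
      LinearMap.lTensor_zero, LinearMap.zero_apply]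
  obtain ⟨r, hr⟩ := exists_leftInverse_of_lTensor_quotient_injective hinj
  have : Module.Projective R (C₁ ⧸ LinearMap.range d₀) := Module.Projective.of_split l r hr
  obtain ⟨h₁, σ, hσ⟩ := exists_section_of_projective_quotient_range (d₀ := d₀)
  refine ⟨h₁, σ ∘ₗ r, ?_⟩
  rw [← hl, LinearMap.comp_assoc, ← LinearMap.comp_assoc q l r, hr, LinearMap.id_comp, hσ]

theorem lTensor_exact_of_contraction {h₁ : C₁ →ₗ[R] C₀} {h₂ : C₂ →ₗ[R] C₁} (hd : d₁ ∘ₗ d₀ = 0)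
    (hh : d₀ ∘ₗ h₁ + h₂ ∘ₗ d₁ = LinearMap.id) (Q : Type*) [AddCommGroup Q] [Module R Q] :
    Function.Exact (d₀.lTensor Q) (d₁.lTensor Q) := by
  refine LinearMap.exact_of_comp_of_mem_range ?_ fun x hx => ⟨h₁.lTensor Q x, ?_⟩
  · rw [← LinearMap.lTensor_comp, hd, LinearMap.lTensor_zero]
  · have := DFunLike.congr_fun (congrArg (LinearMap.lTensor Q) hh) x
    rwa [LinearMap.lTensor_add, LinearMap.lTensor_comp, LinearMap.lTensor_comp,
      LinearMap.add_apply, LinearMap.comp_apply, LinearMap.comp_apply, hx, map_zero, add_zero,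
      LinearMap.lTensor_id] at this

theorem comp_comp_eq_self_of_contraction {h₁ : C₁ →ₗ[R] C₀} {h₂ : C₂ →ₗ[R] C₁}
    (hd : d₁ ∘ₗ d₀ = 0) (hh : d₀ ∘ₗ h₁ + h₂ ∘ₗ d₁ = LinearMap.id) : d₀ ∘ₗ h₁ ∘ₗ d₀ = d₀ := by
  have := congrArg (· ∘ₗ d₀) hh
  simpa [LinearMap.add_comp, LinearMap.comp_assoc, hd] using this

theorem exists_retraction_of_comp_comp_eq_self {K : Type*} [AddCommGroup K] [Module R K]
    {j : K →ₗ[R] C₀} (hj : Function.Injective j) (hjd : Function.Exact j d₀)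
    {h : C₁ →ₗ[R] C₀} (hh : d₀ ∘ₗ h ∘ₗ d₀ = d₀) :
    ∃ s : C₀ →ₗ[R] K, s ∘ₗ j = LinearMap.id ∧ j ∘ₗ s + h ∘ₗ d₀ = LinearMap.id := by
  have hd₀ (x : C₀) : d₀ (h (d₀ x)) = d₀ x := DFunLike.congr_fun hh x
  have mem_range (x : C₀) : (LinearMap.id - h ∘ₗ d₀ : C₀ →ₗ[R] C₀) x ∈ LinearMap.range j :=
    (hjd _).1 (by simp [hd₀])
  let e := LinearEquiv.ofInjective j hj
  let s : C₀ →ₗ[R] K := e.symm ∘ₗ (LinearMap.id - h ∘ₗ d₀).codRestrict _ mem_range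
  have hs (x : C₀) : j (s x) = x - h (d₀ x) := congrArg Subtype.val (e.apply_symm_apply _)
  refine ⟨s, LinearMap.ext fun x => hj ?_, LinearMap.ext fun x => ?_⟩
  · simp [hs, hjd.apply_apply_eq_zero]
  · simp [hs]

end Contraction

section ExtShift

open Abelian

variable {C : Type*} [Category C] [CategoryTheory.Abelian C] [HasExt C]
  {T : ShortComplex C} (hT : T.ShortExact) [Projective T.X₂] (N : C)

include hT in
theorem subsingleton_ext_one_iff :
    Subsingleton (Ext T.X₃ N 1) ↔ ∀ φ : T.X₁ ⟶ N, ∃ ψ : T.X₂ ⟶ N, T.f ≫ ψ = φ := by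
  constructor
  · intro _ φ
    obtain ⟨x, hx⟩ := Ext.contravariant_sequence_exact₁ hT N (Ext.mk₀ φ) (add_zero 1)
      (Subsingleton.elim _ _)
    obtain ⟨ψ, rfl⟩ := Ext.homEquiv₀.symm.surjective x
    refine ⟨ψ, Ext.homEquiv₀.symm.injective ?_⟩
    simpa using hx
  · intro h
    refine subsingleton_of_forall_eq 0 fun x => ?_
    obtain ⟨y, rfl⟩ := Ext.contravariant_sequence_exact₃ hT N x (Ext.eq_zero_of_projective _)
      (add_zero 1)
    obtain ⟨φ, rfl⟩ := Ext.homEquiv₀.symm.surjective y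
    obtain ⟨ψ, rfl⟩ := h φ
    have : Ext.homEquiv₀.symm (T.f ≫ ψ) = (Ext.mk₀ T.f).comp (Ext.mk₀ ψ) (zero_add 0) := by
      simp
    rw [this]
    exact hT.extClass_comp_assoc _

include hT in
theorem subsingleton_ext_one_iff_of_presentation {P₁ P₂ : C} {d : P₂ ⟶ P₁} {e : P₁ ⟶ T.X₁} [Epi e]
    {w : d ≫ e = 0} (hde : (ShortComplex.mk d e w).Exact) :
    Subsingleton (Ext T.X₃ N 1) ↔
      ∀ g : P₁ ⟶ N, d ≫ g = 0 → ∃ ψ : T.X₂ ⟶ N, (e ≫ T.f) ≫ ψ = g := by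
  refine (subsingleton_ext_one_iff hT N).trans ⟨fun h g hg => ?_, fun h φ => ?_⟩
  · obtain ⟨ψ, hψ⟩ := h (hde.desc g hg)
    exact ⟨ψ, by rw [Category.assoc, hψ]; exact hde.g_desc g hg⟩
  · obtain ⟨ψ, hψ⟩ := h (e ≫ φ) (by rw [reassoc_of% w, Limits.zero_comp])
    exact ⟨ψ, by rwa [Category.assoc, cancel_epi] at hψ⟩

include hT in
theorem subsingleton_ext_add_two_iff (n : ℕ) :
    Subsingleton (Ext T.X₃ N (n + 2)) ↔ Subsingleton (Ext T.X₁ N (n + 1)) := by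
  refine ⟨fun _ => subsingleton_of_forall_eq 0 fun x => ?_,
    fun _ => subsingleton_of_forall_eq 0 fun x => ?_⟩
  · obtain ⟨y, rfl⟩ := Ext.contravariant_sequence_exact₁ hT N x (n₁ := n + 2) (by omega)
      (Subsingleton.elim _ _)
    rw [Ext.eq_zero_of_projective y, Ext.comp_zero]
  · obtain ⟨y, rfl⟩ := Ext.contravariant_sequence_exact₃ hT N x (Ext.eq_zero_of_projective _)
      (n₀ := n + 1) (by omega)
    rw [Subsingleton.elim y 0, Ext.comp_zero]

end ExtShift

/-! ### Extensions and change of scalars -/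

namespace CMod

open StdLevi

variable {K : Type u} {ι X Y 𝔤 : Type*} [Field K] [Finite ι] [AddCommGroup X] [AddCommGroup Y]
  [LieRing 𝔤] [LieAlgebra K 𝔤] {D : ReductiveLie K ι X Y 𝔤}
  {p : ℕ} {L : StdLevi D} {S : Set ι} {A : Type u} [CommRing A] [Algebra K A]
  {π : CartanAlg K Y →ₗ[K] A}

section Exactness

variable [IsNoetherianRing A]

theorem exact_of_exact_lin {T : ShortComplex (CMod p L S A π)}
    (h : Function.Exact (lin T.f) (lin T.g)) : T.Exact := by
  rw [T.exact_iff_of_forks (kerIsLimit T.g) (cokerIsColimit T.f)]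
  ext m
  exact (Submodule.Quotient.mk_eq_zero _).2 ((h _).1 m.2)

theorem exact_lin_kerι {P M : CMod p L S A π} (f : P ⟶ M) :
    Function.Exact (lin (kerι f)) (lin f) := fun y =>
  ⟨fun hy => ⟨⟨y, hy⟩, rfl⟩, by rintro ⟨x, rfl⟩; exact x.2⟩

theorem exists_retraction_kerι {P M : CMod p L S A π} [Module.Projective A M] {f : P ⟶ M}
    (hf : Function.Surjective (lin f)) :
    ∃ r : P →ₗ[A] ker f, r ∘ₗ lin (kerι f) = LinearMap.id := by
  obtain ⟨s, hs⟩ := Module.projective_lifting_property (lin f) LinearMap.id hf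
  have htfae := (exact_lin_kerι f).split_tfae'.out 0 1
  exact (htfae.1 ⟨Subtype.val_injective, s, hs⟩).2

theorem projective_ker {P M : CMod p L S A π} [Module.Projective A P] [Module.Projective A M]
    {f : P ⟶ M} (hf : Function.Surjective (lin f)) : Module.Projective A (ker f) :=
  have ⟨r, hr⟩ := exists_retraction_kerι hf
  Module.Projective.of_split (lin (kerι f)) r hr

end Exactness

/-- Precomposition with `f` as a linear map. -/
def precomp {M M' : CMod p L S A π} (f : M ⟶ M') (N : CMod p L S A π) :
    (M' ⟶ N) →ₗ[A] (M ⟶ N) where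
  toFun g := f ≫ g
  map_add' _ _ := rfl
  map_smul' _ _ := rfl

theorem precomp_comp {M M' M'' : CMod p L S A π} (f : M ⟶ M') (g : M' ⟶ M'')
    (N : CMod p L S A π) : precomp (f ≫ g) N = precomp f N ∘ₗ precomp g N :=
  LinearMap.ext fun h => Category.assoc f g h

theorem precomp_zero (M M' N : CMod p L S A π) : precomp (0 : M ⟶ M') N = 0 :=
  LinearMap.ext fun g => (Limits.zero_comp : (0 : M ⟶ M') ≫ g = 0)

theorem precomp_injective {M M' : CMod p L S A π} {f : M ⟶ M'}
    (hf : Function.Surjective (lin f)) (N : CMod p L S A π) : Function.Injective (precomp f N) :=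
  have := epi_of_surj f hf
  fun _ _ => (cancel_epi f).1

theorem exact_precomp [IsNoetherianRing A] {P₁ P₀ M : CMod p L S A π} {d : P₁ ⟶ P₀} {f : P₀ ⟶ M}
    (h : Function.Exact (lin d) (lin f)) (hf : Function.Surjective (lin f)) (N : CMod p L S A π) :
    Function.Exact (precomp f N) (precomp d N) := by
  have := epi_of_surj f hf
  have w : d ≫ f = 0 := CMod.hom_ext h.apply_apply_eq_zero
  have hT : (ShortComplex.mk d f w).Exact := exact_of_exact_lin h
  refine LinearMap.exact_of_comp_of_mem_range ?_ fun g hg => ⟨hT.desc g hg, hT.g_desc g hg⟩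
  rw [← precomp_comp, w, precomp_zero]

section BaseChangeMap

variable (A' : Type u) [CommRing A'] [Algebra K A'] [Algebra A A'] [IsScalarTower K A A']

theorem baseChangeMap_comp {M N Q : CMod p L S A π} (f : M ⟶ N) (g : N ⟶ Q) :
    baseChangeMap A' (f ≫ g) = baseChangeMap A' f ≫ baseChangeMap A' g :=
  CMod.hom_ext fun x => DFunLike.congr_fun (LinearMap.baseChange_comp (A := A') (lin f) (lin g)) x

theorem surjective_lin_baseChangeMap {P M : CMod p L S A π} {f : P ⟶ M}
    (hf : Function.Surjective (lin f)) : Function.Surjective (lin (baseChangeMap A' f)) :=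
  LinearMap.lTensor_surjective A' hf

theorem exact_lin_baseChangeMap {P M Q : CMod p L S A π} {f : P ⟶ M} {g : M ⟶ Q}
    (h : Function.Exact (lin f) (lin g)) (hg : Function.Surjective (lin g)) :
    Function.Exact (lin (baseChangeMap A' f)) (lin (baseChangeMap A' g)) :=
  lTensor_exact A' h hg

theorem homBaseChange_precomp {P Q : CMod p L S A π} (f : P ⟶ Q) (N : CMod p L S A π) :
    homBaseChange A' P N ∘ₗ (precomp f N).baseChange A' =
      precomp (baseChangeMap A' f) (N.baseChange A') ∘ₗ homBaseChange A' Q N := by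
  refine LinearMap.ext fun x => ?_
  induction x with
  | zero => rw [map_zero, map_zero]
  | add x y hx hy => rw [map_add, map_add, hx, hy]
  | tmul a g =>
    change a • baseChangeMap A' (f ≫ g) = baseChangeMap A' f ≫ (a • baseChangeMap A' g)
    rw [Linear.comp_smul, baseChangeMap_comp]

/-- The short complex `ker f ⊗ A' → P ⊗ A' → M ⊗ A'`. -/
abbrev kerBaseChange [IsNoetherianRing A] {P M : CMod p L S A π} {f : P ⟶ M}
    (hf : Function.Surjective (lin f)) : ShortComplex (CMod p L S A' (bcπ A' π)) :=
  ShortComplex.mk (baseChangeMap A' (kerι f)) (baseChangeMap A' f)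
    (CMod.hom_ext (exact_lin_baseChangeMap A' (exact_lin_kerι f) hf).apply_apply_eq_zero)

theorem shortExact_kerBaseChange [IsNoetherianRing A] [IsNoetherianRing A'] {P M : CMod p L S A π}
    [Module.Projective A M] {f : P ⟶ M} (hf : Function.Surjective (lin f)) :
    (kerBaseChange A' hf).ShortExact where
  exact := exact_of_exact_lin (exact_lin_baseChangeMap A' (exact_lin_kerι f) hf)
  mono_f := by
    obtain ⟨r, hr⟩ := exists_retraction_kerι hf
    have hr' : r.baseChange A' ∘ₗ (lin (kerι f)).baseChange A' = LinearMap.id := by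
      rw [← LinearMap.baseChange_comp, hr, LinearMap.baseChange_id]
    exact mono_of_inj _ (Function.LeftInverse.injective (DFunLike.congr_fun hr'))
  epi_g := epi_of_surj _ (surjective_lin_baseChangeMap A' hf)

end BaseChangeMap

/-- The first terms `P₂ → P₁ → P₀ → M → 0` of a free resolution, with `P₁ → P₀` given by its
corestriction `ε₁` to the first syzygy. -/
structure FreePresentation [IsNoetherianRing A] (M : CMod p L S A π) where
  {P₀ P₁ P₂ : CMod p L S A π}
  isFree₀ : IsFree P₀
  isFree₁ : IsFree P₁
  isFree₂ : IsFree P₂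
  ε₀ : P₀ ⟶ M
  ε₁ : P₁ ⟶ ker ε₀
  d₂ : P₂ ⟶ P₁
  surjective₀ : Function.Surjective (lin ε₀)
  surjective₁ : Function.Surjective (lin ε₁)
  exact : Function.Exact (lin d₂) (lin ε₁)

namespace FreePresentation

variable [IsNoetherianRing A] {M : CMod p L S A π}

theorem nonempty (hB : Nonempty (L.HomogeneousBasis p S)) (M : CMod p L S A π) :
    Nonempty (FreePresentation M) := by
  obtain ⟨P₀, ε₀, isFree₀, surjective₀⟩ := exists_free_cover hB M
  obtain ⟨P₁, ε₁, isFree₁, surjective₁⟩ := exists_free_cover hB (ker ε₀)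
  obtain ⟨P₂, ε₂, isFree₂, surjective₂⟩ := exists_free_cover hB (ker ε₁)
  refine ⟨⟨isFree₀, isFree₁, isFree₂, ε₀, ε₁, ε₂ ≫ kerι ε₁, surjective₀, surjective₁, ?_⟩⟩
  rw [lin_comp]
  exact (Function.Surjective.comp_exact_iff_exact surjective₂).2 (exact_lin_kerι ε₁)

variable (F : FreePresentation M)

/-- The differential `P₁ → P₀`. -/
def d₁ : F.P₁ ⟶ F.P₀ := F.ε₁ ≫ kerι F.ε₀

theorem exact_lin_d₁ : Function.Exact (lin F.d₁) (lin F.ε₀) := by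
  rw [d₁, lin_comp]
  exact (Function.Surjective.comp_exact_iff_exact F.surjective₁).2 (exact_lin_kerι F.ε₀)

theorem precomp_d₂_comp_precomp_d₁ (N : CMod p L S A π) :
    precomp F.d₂ N ∘ₗ precomp F.d₁ N = 0 := by
  have w : F.d₂ ≫ F.ε₁ = 0 := CMod.hom_ext F.exact.apply_apply_eq_zero
  rw [← precomp_comp, d₁, reassoc_of% w, Limits.zero_comp, precomp_zero]

variable (A' : Type u) [CommRing A'] [IsNoetherianRing A'] [Algebra K A'] [Algebra A A']
  [IsScalarTower K A A']

theorem extVanishes_one_iff [Module.Projective A M] (N : CMod p L S A' (bcπ A' π)) :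
    (M.baseChange A').ExtVanishes N 1 ↔
      Function.Exact (precomp (baseChangeMap A' F.d₁) N) (precomp (baseChangeMap A' F.d₂) N) := by
  have := HasExt.standard (CMod p L S A' (bcπ A' π))
  have : Projective (kerBaseChange A' F.surjective₀).X₂ := (F.isFree₀.baseChange A').projective
  have : Epi (baseChangeMap A' F.ε₁) :=
    epi_of_surj _ (surjective_lin_baseChangeMap A' F.surjective₁)
  have hexact := exact_lin_baseChangeMap A' F.exact F.surjective₁
  have w : baseChangeMap A' F.d₂ ≫ baseChangeMap A' F.ε₁ = 0 :=
    CMod.hom_ext hexact.apply_apply_eq_zero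
  refine (subsingleton_ext_one_iff_of_presentation (shortExact_kerBaseChange A' F.surjective₀) N
    (exact_of_exact_lin (T := ShortComplex.mk _ _ w) hexact)).trans ?_
  rw [d₁, baseChangeMap_comp]
  refine ⟨fun h => LinearMap.exact_of_comp_of_mem_range ?_ h, fun h g => (h g).1⟩
  rw [← precomp_comp, reassoc_of% w, Limits.zero_comp, precomp_zero]

theorem extVanishes_one_iff_exact_lTensor [Module.Projective A M] (N : CMod p L S A π) :
    (M.baseChange A').ExtVanishes (N.baseChange A') 1 ↔
      Function.Exact ((precomp F.d₁ N).lTensor A') ((precomp F.d₂ N).lTensor A') := by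
  have h₀ := F.isFree₀.bijective_homBaseChange A' N
  have h₁ := F.isFree₁.bijective_homBaseChange A' N
  have h₂ := F.isFree₂.bijective_homBaseChange A' N
  rw [F.extVanishes_one_iff A']
  exact (Function.Exact.iff_of_ladder_linearEquiv (e₁ := LinearEquiv.ofBijective _ h₀)
    (e₂ := LinearEquiv.ofBijective _ h₁) (e₃ := LinearEquiv.ofBijective _ h₂)
    (homBaseChange_precomp A' F.d₁ N).symm (homBaseChange_precomp A' F.d₂ N).symm)

end FreePresentation

end CMod

namespace CMod

open StdLevi

variable {K : Type u} {ι X Y 𝔤 : Type*} [Field K] [Finite ι] [AddCommGroup X] [AddCommGroup Y]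
  [LieRing 𝔤] [LieAlgebra K 𝔤] {D : ReductiveLie K ι X Y 𝔤}
  {p : ℕ} {L : StdLevi D} {S : Set ι} {A : Type u} [CommRing A] [IsNoetherianRing A] [Algebra K A]
  {π : CartanAlg K Y →ₗ[K] A} {M N : CMod p L S A π} [Module.Projective A M]

namespace FreePresentation

variable (F : FreePresentation M) [Module.Projective A N]
  (hExt : ∀ 𝔪 : Ideal A, 𝔪.IsMaximal →
    (M.baseChange (A ⧸ 𝔪)).ExtVanishes (N.baseChange (A ⧸ 𝔪)) 1)

include F hExt

theorem exists_contraction_precomp :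
    ∃ (h₁ : (F.P₁ ⟶ N) →ₗ[A] (F.P₀ ⟶ N)) (h₂ : (F.P₂ ⟶ N) →ₗ[A] (F.P₁ ⟶ N)),
      precomp F.d₁ N ∘ₗ h₁ + h₂ ∘ₗ precomp F.d₂ N = LinearMap.id :=
  have := F.isFree₁.projective_hom N
  have := F.isFree₂.projective_hom N
  have := F.isFree₁.finite_hom N
  have := F.isFree₂.finite_hom N
  exists_contraction (F.precomp_d₂_comp_precomp_d₁ N) fun 𝔪 h𝔪 =>
    (F.extVanishes_one_iff_exact_lTensor (A ⧸ 𝔪) N).1 (hExt 𝔪 h𝔪)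

theorem exists_retraction_precomp_ε₀ :
    ∃ (s : (F.P₀ ⟶ N) →ₗ[A] (M ⟶ N)) (h : (F.P₁ ⟶ N) →ₗ[A] (F.P₀ ⟶ N)),
      s ∘ₗ precomp F.ε₀ N = LinearMap.id ∧
        precomp F.ε₀ N ∘ₗ s + h ∘ₗ precomp F.d₁ N = LinearMap.id := by
  obtain ⟨h₁, h₂, hh⟩ := F.exists_contraction_precomp hExt
  obtain ⟨s, hs⟩ := exists_retraction_of_comp_comp_eq_self (precomp_injective F.surjective₀ N)
    (exact_precomp F.exact_lin_d₁ F.surjective₀ N)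
    (comp_comp_eq_self_of_contraction (F.precomp_d₂_comp_precomp_d₁ N) hh)
  exact ⟨s, h₁, hs⟩

theorem projective_hom : Module.Projective A (M ⟶ N) :=
  have ⟨s, _, hs, _⟩ := F.exists_retraction_precomp_ε₀ hExt
  have := F.isFree₀.projective_hom N
  Module.Projective.of_split (precomp F.ε₀ N) s hs

variable (A' : Type u) [CommRing A'] [IsNoetherianRing A'] [Algebra K A'] [Algebra A A']
  [IsScalarTower K A A']

theorem extVanishes_one_baseChange : (M.baseChange A').ExtVanishes (N.baseChange A') 1 :=
  have ⟨_, _, hh⟩ := F.exists_contraction_precomp hExt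
  (F.extVanishes_one_iff_exact_lTensor A' N).2
    (lTensor_exact_of_contraction (F.precomp_d₂_comp_precomp_d₁ N) hh A')

theorem bijective_homBaseChange : Function.Bijective (homBaseChange A' M N) := by
  obtain ⟨s, h, hs, hh⟩ := F.exists_retraction_precomp_ε₀ hExt
  have hs' : s.baseChange A' ∘ₗ (precomp F.ε₀ N).baseChange A' = LinearMap.id := by
    rw [← LinearMap.baseChange_comp, hs, LinearMap.baseChange_id]
  have hexact := exact_precomp F.exact_lin_d₁ F.surjective₀ N
  have hsurj := surjective_lin_baseChangeMap A' F.surjective₀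
  exact LinearMap.bijective_of_bijective_of_injective_of_left_exact
    ((precomp F.ε₀ N).baseChange A') ((precomp F.d₁ N).baseChange A')
    (precomp (baseChangeMap A' F.ε₀) _) (precomp (baseChangeMap A' F.d₁) _)
    (homBaseChange A' M N) (homBaseChange A' F.P₀ N) (homBaseChange A' F.P₁ N)
    (homBaseChange_precomp A' F.ε₀ N).symm (homBaseChange_precomp A' F.d₁ N).symm
    (lTensor_exact_of_contraction hexact.linearMap_comp_eq_zero hh A')
    (exact_precomp (exact_lin_baseChangeMap A' F.exact_lin_d₁ F.surjective₀) hsurj _)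
    (F.isFree₀.bijective_homBaseChange A' N) (F.isFree₁.bijective_homBaseChange A' N).injective
    (Function.LeftInverse.injective (DFunLike.congr_fun hs')) (precomp_injective hsurj _)

end FreePresentation

theorem extVanishes_add_two_iff_ker {P : CMod p L S A π} (hP : IsFree P) {f : P ⟶ M}
    (hf : Function.Surjective (lin f)) (A' : Type u) [CommRing A'] [IsNoetherianRing A']
    [Algebra K A'] [Algebra A A'] [IsScalarTower K A A'] (N : CMod p L S A' (bcπ A' π)) (i : ℕ) :
    (M.baseChange A').ExtVanishes N (i + 2) ↔ ((ker f).baseChange A').ExtVanishes N (i + 1) :=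
  have := HasExt.standard (CMod p L S A' (bcπ A' π))
  have : Projective (kerBaseChange A' hf).X₂ := (hP.baseChange A').projective
  subsingleton_ext_add_two_iff (shortExact_kerBaseChange A' hf) N i

theorem extVanishes_baseChange (hB : Nonempty (L.HomogeneousBasis p S)) [Module.Projective A N]
    {i : ℕ} (hExt : ∀ 𝔪 : Ideal A, 𝔪.IsMaximal →
      (M.baseChange (A ⧸ 𝔪)).ExtVanishes (N.baseChange (A ⧸ 𝔪)) (i + 1))
    (A' : Type u) [CommRing A'] [IsNoetherianRing A'] [Algebra K A'] [Algebra A A']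
    [IsScalarTower K A A'] : (M.baseChange A').ExtVanishes (N.baseChange A') (i + 1) := by
  induction i generalizing M with
  | zero =>
    obtain ⟨F⟩ := FreePresentation.nonempty hB M
    exact F.extVanishes_one_baseChange hExt A'
  | succ i ih =>
    obtain ⟨P, f, hP, hf⟩ := exists_free_cover hB M
    have := hP.free
    have := projective_ker hf
    exact (extVanishes_add_two_iff_ker hP hf A' _ i).2 (ih fun 𝔪 h𝔪 =>
      (extVanishes_add_two_iff_ker hP hf (A ⧸ 𝔪) _ i).1 (hExt 𝔪 h𝔪))

end CMod

end

theorem mainTheorem11_general {p : ℕ} [Fact p.Prime] {K : Type u} [Field K] [CharP K p]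
    {ι X Y 𝔤 : Type*} [Finite ι] [AddCommGroup X] [AddCommGroup Y] [Module.Finite ℤ Y]
    [LieRing 𝔤] [LieAlgebra K 𝔤] {D : ReductiveLie K ι X Y 𝔤} {L : StdLevi D}
    {S : Set ι} (hS : D.IsClosedSet S)
    {A : Type u} [CommRing A] [IsNoetherianRing A] [Algebra K A] {π : CartanAlg K Y →ₗ[K] A}
    (M N : CMod p L S A π) [Module.Projective A M] [Module.Projective A N]
    (hExt : ∀ (𝔪 : Ideal A), 𝔪.IsMaximal → ∀ i : ℕ, 0 < i →
      (M.baseChange (A ⧸ 𝔪)).ExtVanishes (N.baseChange (A ⧸ 𝔪)) i) :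
    Module.Projective A (M ⟶ N) ∧
    (∀ (A' : Type u) [CommRing A'] [IsNoetherianRing A'] [Algebra K A'] [Algebra A A']
      [IsScalarTower K A A'], ∀ i : ℕ, 0 < i →
      (M.baseChange A').ExtVanishes (N.baseChange A') i) ∧
    (∀ (A' : Type u) [CommRing A'] [IsNoetherianRing A'] [Algebra K A'] [Algebra A A']
      [IsScalarTower K A A'],
      ∃ Ψ : A' ⊗[A] (M ⟶ N) ≃ₗ[A'] (M.baseChange A' ⟶ N.baseChange A'),
        ∀ (a : A') (f : M ⟶ N), Ψ (a ⊗ₜ f) = a • CMod.baseChangeMap A' f) := by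
  have hB : Nonempty (L.HomogeneousBasis p S) := L.nonempty_homogeneousBasis p hS
  obtain ⟨F⟩ := CMod.FreePresentation.nonempty hB M
  have hExt₁ 𝔪 h𝔪 := hExt 𝔪 h𝔪 1 one_pos
  refine ⟨F.projective_hom hExt₁, fun A' _ _ _ _ _ i hi => ?_, fun A' _ _ _ _ _ =>
    ⟨LinearEquiv.ofBijective _ (F.bijective_homBaseChange hExt₁ A'),
      CMod.homBaseChange_tmul A' M N⟩⟩
  obtain ⟨i, rfl⟩ := Nat.exists_eq_succ_of_ne_zero hi.ne'
  exact CMod.extVanishes_baseChange hB (fun 𝔪 h𝔪 => hExt 𝔪 h𝔪 (i + 1) hi) A'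

theorem mainTheorem11 {p : ℕ} [Fact p.Prime] {K : Type u} [Field K] [IsAlgClosed K] [CharP K p]
    {ι X Y 𝔤 : Type*} [Finite ι] [AddCommGroup X] [Module.Finite ℤ X] [AddCommGroup Y]
    [Module.Finite ℤ Y] [LieRing 𝔤] [LieAlgebra K 𝔤]
    (D : ReductiveLie K ι X Y 𝔤) (hsc : D.SimplyConnectedDerived) (hgood : D.IsGoodPrime p)
    (hform : D.HasInvariantForm) (L : StdLevi D)
    {A : Type u} [CommRing A] [IsNoetherianRing A] [Algebra K A]
    (π : CartanAlg K Y →ₗ[K] A) (hπ : ∀ α ∈ L.RI, π (1 ⊗ₜ D.P.coroot α) = 0)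
    (M N : CMod p L Set.univ A π) (hM : M.HasQFiltration) (hN : Module.Projective A N)
    (hExt : ∀ (𝔪 : Ideal A), 𝔪.IsMaximal → ∀ i : ℕ, 0 < i →
      (M.baseChange (A ⧸ 𝔪)).ExtVanishes (N.baseChange (A ⧸ 𝔪)) i) :
    Module.Projective A (M ⟶ N) ∧
    (∀ (A' : Type u) [CommRing A'] [IsNoetherianRing A'] [Algebra K A'] [Algebra A A']
      [IsScalarTower K A A'], ∀ i : ℕ, 0 < i →
      (M.baseChange A').ExtVanishes (N.baseChange A') i) ∧
    (∀ (A' : Type u) [CommRing A'] [IsNoetherianRing A'] [Algebra K A'] [Algebra A A']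
      [IsScalarTower K A A'],
      ∃ Ψ : A' ⊗[A] (M ⟶ N) ≃ₗ[A'] (M.baseChange A' ⟶ N.baseChange A'),
        ∀ (a : A') (f : M ⟶ N), Ψ (a ⊗ₜ f) = a • CMod.baseChangeMap A' f) := by
  have := hM.projective
  exact mainTheorem11_general D.isClosedSet_univ M N hExt
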